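/- **Setting.** Let $p_1,\dots,p_{n+1}$ and $q_1,\dots,q_m$ be $n+1+m$ pairwise distinct complex numbers. Let $\pi:\mathbb M\to\mathbb C^2$ be the blow-up of the origin, $\mathcal L=\pi^{-1}(0)\cong\mathbb{CP}^1$, with charts $(x,u)$, $u=y/x$, and $(v,y)$, $v=x/y$. Germs of holomorphic foliations at $0\in\mathbb C^2$ are given by germs of holomorphic vector fields $P\partial_x+Q\partial_y$ with isolated zeros; $P_k,Q_k$ are the homogeneous parts of degree $k$; a tilde denotes the blow-up of a foliation, and $\tilde H$ the lift to $\mathbb M$ of a biholomorphism $H$. *The class $\mathcal N_{\mathsf p}(\mathbf h)$.* Foliations $\mathcal F$ of multiplicity $n$ with $R_{n+1}(1,u)=c\prod_i(u-p_i)$, $c\ne0$, where $R_{n+1}=xQ_n-yP_n$ (so $\tilde{\mathcal F}$ has on $\mathcal L$ exactly the simple singular points $(0,p_i)$), whose hidden holonomy (the holonomy of the leaf $\mathcal L\smallsetminus\{p_i\}$ along loops with base point $u_0$, on the transversal $u=u_0$) is conjugate to $\mathbf h$ by one germ $\chi:(\mathbb C,0)\to(\mathbb C,0)$ with $\chi'(0)=1$.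 *The class $\mathcal D_{\mathsf q}(\mathcal I)$.* Dicritical foliations $\mathcal G$ with principal part $W\cdot(x\partial_x+y\partial_y)$, $W$ homogeneous of degree $m$, $W(1,u)=c\prod_j(u-q_j)$, $c\neq0$, such that $\tilde{\mathcal G}$ is regular (with a simple tangency with $\mathcal L$) at each $(0,q_j)$ and the involution of $(\mathcal L,q_j)$ exchanging the two intersection points of nearby leaves with $\mathcal L$ is $I_j$, where $\mathcal I=(I_1,\dots,I_m)$. Put $g_j(u)=(q_j-u)(I_j(u)-q_j)$. *Reference pair.* Fix $\mathcal F_\mu\in\mathcal N_{\mathsf p}(\mathbf h)$ whose separatrices are exactly the lines $y=p_ix$; let $\mathcal G_{\mathbf r}$ be the radial foliation and $\lambda_i$ the Camacho–Sad index of $\tilde{\mathcal F}_\mu$ at $(0,p_i)$ (relative to $\mathcal L$). Fix biholomorphisms $\xi_i=(\varepsilon_i,u)$ near $(0,p_i)$, taking the foliation of $\lambda_ix\partial_x+(u-p_i)\partial_u$ to $\tilde{\mathcal F}_\mu$, and $\zeta_j=(\varsigma_j,u)$ near $(0,q_j)$, taking $(x=\mathrm{cst})$ to $\tilde{\mathcal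 F}_\mu$, where $\varepsilon_i=\sum_{k\ge1}\varepsilon_{i,k}(u)x^k$, $\varepsilon_{i,1}(p_i)=1$, and $\varsigma_j=\sum_{k\ge1}\varsigma_{j,k}(u)x^k$, $\varsigma_{j,1}(q_j)=1$, $\varsigma_{j,k}(q_j)=0$ for $k>1$. *Normalizing transformations.* Normalizing transformations of a pair $(\mathcal F,\mathcal G)\in\mathcal N_{\mathsf p}(\mathbf h)\times\mathcal D_{\mathsf q}(\mathcal I)$ with respect to $(\mathcal F_\mu,\mathcal G_{\mathbf r})$, with local models given by germs $s_i=\sum_{r\ge1}s_{i,r}x^r$ and $z_j=\sum_{r\ge1}z_{j,r}x^r$, $z_{j,1}\ne0$, are: - $\mathbf H_{\mathbf n}$, a biholomorphism between neighbourhoods of $\mathcal L\smallsetminus\{p_i,q_j\}$ in $\mathbb M$, the identity on $\mathcal L\smallsetminus\{p_i,q_j\}$, equal to $(x+O(x^2),u+O(x))$ in the coordinates $(x,u)$, taking $(\tilde{\mathcal F}_\mu,\tilde{\mathcal G}_{\mathbf r})$ to $(\tilde{\mathcal F},\tilde{\mathcal G})$; - $H_{p_i}$, a biholomorphism from a neighbourhood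 of $(0,p_i)$ in $\mathbb C^2$ to a neighbourhood of $(0,p_i)$ in $\mathbb M$, the identity on $x=0$, taking the foliation of $\lambda_ix\partial_x+(u-p_i)\partial_u$ to $\tilde{\mathcal F}$ and $(u+s_i(x)=\mathrm{cst})$ to $\tilde{\mathcal G}$; - $H_{q_j}$, a biholomorphism from a neighbourhood of $(0,q_j)$ in $\mathbb C^2$ to a neighbourhood of $(0,q_j)$ in $\mathbb M$, the identity on $x=0$, taking $(x=\mathrm{cst})$ to $\tilde{\mathcal F}$ and $(z_j(x)+g_j(u)=\mathrm{cst})$ to $\tilde{\mathcal G}$; such that, near the punctured disks around $(0,p_i)$ and $(0,q_j)$ in $\{x=0\}$, $H_{p_i}=\mathbf H_{\mathbf n}\circ\xi_i\circ\Psi_i$ and $H_{q_j}=\mathbf H_{\mathbf n}\circ\zeta_j\circ\Phi_j$, where $\Psi_i=\bigl(x(1+\tfrac{s_i(x)}{u-p_i})^{\lambda_i},\,u+s_i(x)\bigr)$ and $\Phi_j=(x,\phi_j)$ with $\phi_j=u+\sum_{k\ge1}\phi_{j,k}(u)x^k$, $g_j\circ\phi_j=g_j(u)+z_j(x)$. *Canonical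 coefficients.* For sequences $A=(A_r)$ of functions of $u$ and $k\ge1$, let $\mathbf A_{p_i,k+1}[A]$ be the coefficient of $x^{k+1}$ in $\bigl(\sum_{r=1}^kA_r(u)x^r\bigr)\circ\bigl(\sum_{l=1}^k\varepsilon_{i,l}(u)x^l,u\bigr)\circ\Psi_i^{(k)}$, where $\Psi_i^{(k)}$ is $\Psi_i$ with $s_i$ replaced by $\sum_{r\le k}s_{i,r}x^r$; let $\mathbf A_{q_j,k+1}[A]$ be the coefficient of $x^{k+1}$ in $\bigl(\sum_{r=1}^kA_r(u)x^r\bigr)\circ\bigl(\sum_{l=1}^k\varsigma_{j,l}(u)x^l,u\bigr)\circ\bigl(x,u+\sum_{l=1}^k\phi_{j,l}(u)x^l\bigr)$; and let $\mathbf B_{p_i,k+1}[B]=\mathbf A_{p_i,k+1}[B]$ and $\mathbf B_{q_j,k+1}[B]=\mathbf A_{q_j,k+1}[B]+\phi_{j,k+1}-z_{j,k+1}/g_j'$. With $(\,\cdot\,)_{\mathcal P,c}$ denoting the principal part at $c\in\mathbb C$, put $$a_{\mathbf n,1}=1,\quad a_{p_i,1}=\varepsilon_{i,1},\quad a_{q_j,1}=\varsigma_{j,1},$$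 $$b_{\mathbf n,1}=-\sum_j\Bigl(\frac{z_{j,1}}{\varsigma_{j,1}g_j'}\Bigr)_{\mathcal P,q_j},\quad b_{p_i,1}=s_{i,1}+\varepsilon_{i,1}b_{\mathbf n,1},\quad b_{q_j,1}=\frac{z_{j,1}}{g_j'}+\varsigma_{j,1}b_{\mathbf n,1},$$ and recursively, for $k\ge1$, with $\mathbf A_{\cdot,k+1}=\mathbf A_{\cdot,k+1}[(a_{\mathbf n,r})_{r\le k}]$ and $\mathbf B_{\cdot,k+1}=\mathbf B_{\cdot,k+1}[(b_{\mathbf n,r})_{r\le k}]$, $$a_{\mathbf n,k+1}=-\sum_i\Bigl(\frac{\mathbf A_{p_i,k+1}}{\varepsilon_{i,1}^{k+1}}\Bigr)_{\mathcal P,p_i}-\sum_j\Bigl(\frac{\mathbf A_{q_j,k+1}}{\varsigma_{j,1}^{k+1}}\Bigr)_{\mathcal P,q_j},$$ $$a_{p_i,k+1}=\varepsilon_{i,k+1}+\mathbf A_{p_i,k+1}+\varepsilon_{i,1}^{k+1}a_{\mathbf n,k+1},\qquad a_{q_j,k+1}=\varsigma_{j,k+1}+\mathbf A_{q_j,k+1}+\varsigma_{j,1}^{k+1}a_{\mathbf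 n,k+1},$$ $$b_{\mathbf n,k+1}=-\sum_i\Bigl(\frac{\mathbf B_{p_i,k+1}}{\varepsilon_{i,1}^{k+1}}\Bigr)_{\mathcal P,p_i}-\sum_j\Bigl(\frac{z_{j,k+1}}{\varsigma_{j,1}^{k+1}g_j'}+\frac{\mathbf B_{q_j,k+1}}{\varsigma_{j,1}^{k+1}}\Bigr)_{\mathcal P,q_j},$$ $$b_{p_i,k+1}=s_{i,k+1}+\varepsilon_{i,k+1}b_{\mathbf n,1}+\mathbf B_{p_i,k+1}+\varepsilon_{i,1}^{k+1}b_{\mathbf n,k+1},$$ $$b_{q_j,k+1}=\frac{z_{j,k+1}}{g_j'}+\varsigma_{j,k+1}b_{\mathbf n,1}+\mathbf B_{q_j,k+1}+\varsigma_{j,1}^{k+1}b_{\mathbf n,k+1}$$ (the functions with index $p_i$, $q_j$ being extended to the removable singularity at $p_i$, $q_j$). **Theorem.** Let $(\mathcal F,\mathcal G)\in\mathcal N_{\mathsf p}(\mathbf h)\times\mathcal D_{\mathsf q}(\mathcal I)$, assume that the $y$-axis is invariant by $\mathcal G$, and let $\mathbf H_{\mathbf n},H_{p_i},H_{q_j}$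 be normalizing transformations of $(\mathcal F,\mathcal G)$ with respect to $(\mathcal F_\mu,\mathcal G_{\mathbf r})$, with local models given by $s_i$, $z_j$. Then for every $k\ge1$ there is a germ of biholomorphism $\mathcal H^k:(\mathbb C^2,0)\to(\mathbb C^2,0)$, tangent to the identity and preserving the $y$-axis, such that $(\mathcal H^k(\mathcal F),\mathcal H^k(\mathcal G))\in\mathcal N_{\mathsf p}(\mathbf h)\times\mathcal D_{\mathsf q}(\mathcal I)$, and this pair has the normalizing transformations $\tilde{\mathcal H}^k\circ\mathbf H_{\mathbf n}$, $\tilde{\mathcal H}^k\circ H_{p_i}$, $\tilde{\mathcal H}^k\circ H_{q_j}$ (with the same local models), which in the coordinates $(x,u)$ have the form $$\tilde{\mathcal H}^k\circ H_{[\cdot]}=\Bigl(\sum_{r=1}^ka_{[\cdot],r}(u)x^r+O(x^{k+1}),\ u+\sum_{r=1}^kb_{[\cdot],r}(u)x^r+O(x^{k+1})\Bigr),\qquad[\cdot]=\mathbf n,\,p_i,\,q_j .$$ Moreover, for $1\le r\le k$, $a_{\mathbf n,r}$ and $b_{\mathbf n,r}$ are holomorphic on $\mathcal L\smallsetminus\{p_1,\dots,p_{n+1},q_1,\dots,q_m\}$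 (including $u=\infty$), $a_{p_i,r},b_{p_i,r}$ are holomorphic near $p_i$, and $a_{q_j,r},b_{q_j,r}$ are holomorphic near $q_j$. -/

import Mathlib

open Filter Topology

noncomputable section

/-! ## Taylor coefficients and homogeneous parts -/

/-- The coefficient of `x ^ k` in the Taylor series of `f` at `0`. -/
def taylorCoeff (k : ℕ) (f : ℂ → ℂ) : ℂ := iteratedDeriv k f 0 / (k.factorial : ℂ)

/-- The coefficient function `f_k(u)` in `f (x, u) = ∑ f_k(u) x ^ k`. -/
def xCoeff (k : ℕ) (f : ℂ × ℂ → ℂ) (u : ℂ) : ℂ := taylorCoeff k fun x => f (x, u)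

/-- The homogeneous part of degree `k` of `f` at the origin of `ℂ²`. -/
def homPart (k : ℕ) (f : ℂ × ℂ → ℂ) (z : ℂ × ℂ) : ℂ :=
  taylorCoeff k fun t => f (t * z.1, t * z.2)

/-- The determinant of two vectors of `ℂ²`; it vanishes iff they are parallel. -/
def det2 (a b : ℂ × ℂ) : ℂ := a.1 * b.2 - a.2 * b.1

/-! ## Germs of foliations of `(ℂ², 0)`

A germ of foliation is represented by a germ of holomorphic vector field with isolated zeros;
two vector fields represent the same foliation iff they are parallel near `0`. -/

/-- `v` is a germ at `0` of a holomorphic vector field with (at most) an isolated zero at `0`. -/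
def IsFoliationGerm (v : ℂ × ℂ → ℂ × ℂ) : Prop :=
  AnalyticAt ℂ v 0 ∧ ∀ᶠ z in 𝓝[≠] (0 : ℂ × ℂ), v z ≠ 0

/-- Near `z₀`, the map `h` takes the foliation of the vector field `X` to that of `v`. -/
def CarriesAt (h : ℂ × ℂ → ℂ × ℂ) (X v : ℂ × ℂ → ℂ × ℂ) (z₀ : ℂ × ℂ) : Prop :=
  ∀ᶠ z in 𝓝 z₀, det2 (fderiv ℂ h z (X z)) (v (h z)) = 0

/-- A germ of biholomorphism of `(ℂ², 0)` tangent to the identity. -/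
def IsTangentToId (H : ℂ × ℂ → ℂ × ℂ) : Prop :=
  AnalyticAt ℂ H 0 ∧ H 0 = 0 ∧ fderiv ℂ H 0 = ContinuousLinearMap.id ℂ (ℂ × ℂ)

/-- All homogeneous parts of `v` of degree `< k` vanish. -/
def VanishesToOrder (k : ℕ) (v : ℂ × ℂ → ℂ × ℂ) : Prop :=
  ∀ j < k, ∀ z, homPart j (fun w => (v w).1) z = 0 ∧ homPart j (fun w => (v w).2) z = 0

/-- For `v = (P, Q)`: the polynomial `u ↦ P_k(1, u)`. -/
def radialPoly (k : ℕ) (v : ℂ × ℂ → ℂ × ℂ) (u : ℂ) : ℂ := homPart k (fun w => (v w).1) (1, u)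

/-- For `v = (P, Q)`: the polynomial `u ↦ R_{k+1}(1, u)`, where `R_{k+1} = x Q_k - y P_k`. -/
def tangentPoly (k : ℕ) (v : ℂ × ℂ → ℂ × ℂ) (u : ℂ) : ℂ :=
  homPart k (fun w => (v w).2) (1, u) - u * homPart k (fun w => (v w).1) (1, u)

/-- The pull-back `(P, (Q - u P) / x)` of `v = (P, Q)` under `(x, u) ↦ (x, u x)`, multiplied by `x` so
as to be holomorphic.  Off the divisor `x = 0` it spans the blow-up of the foliation of `v`. -/
def liftField (v : ℂ × ℂ → ℂ × ℂ) (z : ℂ × ℂ) : ℂ × ℂ :=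
  (z.1 * (v (z.1, z.2 * z.1)).1, (v (z.1, z.2 * z.1)).2 - z.2 * (v (z.1, z.2 * z.1)).1)

/-- `f` is a (submersive) first integral, near the point `z₀` of the chart `(x, u)`, of the blow-up
of the foliation of `v`. -/
def IsFirstIntegralAt (v : ℂ × ℂ → ℂ × ℂ) (f : ℂ × ℂ → ℂ) (z₀ : ℂ × ℂ) : Prop :=
  AnalyticAt ℂ f z₀ ∧ fderiv ℂ f z₀ ≠ 0 ∧ ∀ᶠ z in 𝓝 z₀, fderiv ℂ f z (liftField v z) = 0

/-- `h` is the holonomy, along the loop `γ` of the exceptional divisor, of the blow-up of the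
foliation of `v`, on the transversal `{u = u₀}` with coordinate `x`: the first integral which is `x`
on the transversal is continued analytically along `γ` (as first integral of the foliation), and at
the end takes the value `x` at the point of the transversal with coordinate `h x`. -/
def IsHolonomy (v : ℂ × ℂ → ℂ × ℂ) {u₀ : ℂ} (γ : Path u₀ u₀) (h : ℂ → ℂ) : Prop :=
  AnalyticAt ℂ h 0 ∧ h 0 = 0 ∧
    ∃ f : unitInterval → ℂ × ℂ → ℂ,
      (∀ t, IsFirstIntegralAt v (f t) (0, γ t)) ∧
      (∀ t, ∀ᶠ s in 𝓝 t, f s =ᶠ[𝓝 ((0 : ℂ), γ s)] f t) ∧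
      (∀ᶠ x in 𝓝 (0 : ℂ), f 0 (x, u₀) = x) ∧
      ∀ᶠ x in 𝓝 (0 : ℂ), f 1 (h x, u₀) = x

/-- The class `N_p(h)`: germs of non dicritical foliations whose blow-up has exactly the simple
singular points `p₁, …, p_{n+1}` on the divisor (all of them in the chart `u = y / x`), and whose
hidden holonomy, the holonomy of the leaf `L ∖ {p₁, …, p_{n+1}}` with base point `u₀`,
is conjugate to `h` by one germ `χ` tangent to the identity. -/
structure IsNonDicritical {n : ℕ} (p : Fin (n + 1) → ℂ) {u₀ : ℂ} (h : Path u₀ u₀ → ℂ → ℂ)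
    (v : ℂ × ℂ → ℂ × ℂ) : Prop where
  germ : IsFoliationGerm v
  order : VanishesToOrder n v
  singular : ∃ c : ℂ, c ≠ 0 ∧ ∀ u, tangentPoly n v u = c * ∏ i, (u - p i)
  holonomy : ∃ χ : ℂ → ℂ, AnalyticAt ℂ χ 0 ∧ χ 0 = 0 ∧ deriv χ 0 = 1 ∧
    ∀ γ : Path u₀ u₀, (∀ t i, γ t ≠ p i) →
      AnalyticAt ℂ (h γ) 0 ∧ h γ 0 = 0 ∧
      ∃ g : ℂ → ℂ, IsHolonomy v γ g ∧ ∀ᶠ x in 𝓝 (0 : ℂ), g (χ x) = χ (h γ x)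

/-- `J` is the involution of the blow-up of the foliation of `w` at its simple tangency point
`(0, c)` with the divisor: the holomorphic involution of `(L, c)`, fixing `c` and not the identity,
which exchanges the two points in which a nearby leaf meets `L`. -/
def IsTangencyInvolution (w : ℂ × ℂ → ℂ × ℂ) (c : ℂ) (J : ℂ → ℂ) : Prop :=
  AnalyticAt ℂ J c ∧ J c = c ∧ deriv J c = -1 ∧ (∀ᶠ u in 𝓝 c, J (J u) = u) ∧
    ∃ f : ℂ × ℂ → ℂ, IsFirstIntegralAt w f (0, c) ∧ ∀ᶠ u in 𝓝 c, f (0, J u) = f (0, u)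

/-- The class `D_q(I)`: germs of dicritical foliations whose blow-up is transverse to the divisor
outside `q₁, …, q_m` (all of them in the chart `u = y / x`), where it is regular and has simple
tangencies with associated involutions `I₁, …, I_m`.  The principal part is `W (x ∂x + y ∂y)`, `W`
homogeneous of degree `m`, with `W(1, u) = c ∏ (u - q_j)`. -/
structure IsDicritical {m : ℕ} (q : Fin m → ℂ) (I : Fin m → ℂ → ℂ) (w : ℂ × ℂ → ℂ × ℂ) :
    Prop where
  germ : IsFoliationGerm w
  order : VanishesToOrder (m + 1) w
  dicritical : ∀ u, tangentPoly (m + 1) w u = 0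
  tangency : ∃ c : ℂ, c ≠ 0 ∧ ∀ u, radialPoly (m + 1) w u = c * ∏ j, (u - q j)
  regular : ∀ j, tangentPoly (m + 2) w (q j) ≠ 0
  involution : ∀ j, IsTangencyInvolution w (q j) (I j)

/-- The `y`-axis is invariant by the foliation of `w`. -/
def YAxisInvariant (w : ℂ × ℂ → ℂ × ℂ) : Prop := ∀ᶠ y in 𝓝 (0 : ℂ), (w (0, y)).1 = 0

/-- The lines `y = p_i x` are separatrices of the foliation of `v`, and there are no others. -/
def HasLinesAsSeparatrices {n : ℕ} (p : Fin (n + 1) → ℂ) (v : ℂ × ℂ → ℂ × ℂ) : Prop :=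
  (∀ i, ∀ᶠ x in 𝓝 (0 : ℂ), (v (x, p i * x)).2 = p i * (v (x, p i * x)).1) ∧
  ∀ γ : ℂ → ℂ × ℂ, AnalyticAt ℂ γ 0 → γ 0 = 0 → (∀ᶠ t in 𝓝[≠] (0 : ℂ), γ t ≠ 0) →
    (∀ᶠ t in 𝓝 (0 : ℂ), det2 (deriv γ t) (v (γ t)) = 0) →
    ∃ i, ∀ᶠ t in 𝓝 (0 : ℂ), (γ t).2 = p i * (γ t).1

/-- The Camacho–Sad index, relative to the divisor, of the blow-up of the non dicritical foliation
of `v` of multiplicity `n` at its simple singular point `(0, c)`: the residue at `c` of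
`P_n(1, u) / R_{n+1}(1, u)`. -/
def camachoSad (n : ℕ) (v : ℂ × ℂ → ℂ × ℂ) (c : ℂ) : ℂ :=
  radialPoly n v c / deriv (tangentPoly n v) c

/-! ## The blow-up of `ℂ²` at the origin -/

/-- The line through the origin with slope `ℓ` contains `z`. -/
def OnLine (z : ℂ × ℂ) (ℓ : OnePoint ℂ) : Prop :=
  (ℓ = OnePoint.infty → z.1 = 0) ∧ ∀ u : ℂ, ℓ = (u : OnePoint ℂ) → z.2 = u * z.1

/-- The blow-up `M` of `ℂ²` at the origin. -/
@[ext]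
structure Blowup where
  pt : ℂ × ℂ
  slope : OnePoint ℂ
  mem : OnLine pt slope

/-- The slope of the line through the origin and `z ≠ 0`. -/
def slopeOf (z : ℂ × ℂ) : OnePoint ℂ :=
  if z.1 = 0 then OnePoint.infty else ((z.2 / z.1 : ℂ) : OnePoint ℂ)

theorem onLine_slopeOf (z : ℂ × ℂ) : OnLine z (slopeOf z) := by
  unfold OnLine slopeOf
  split_ifs with h
  · exact ⟨fun _ => h, fun u hu => absurd hu (OnePoint.infty_ne_coe u)⟩
  · refine ⟨fun hu => absurd hu (OnePoint.coe_ne_infty _), fun u hu => ?_⟩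
    rw [← OnePoint.coe_injective hu]
    field_simp

theorem onLine_zero (ℓ : OnePoint ℂ) : OnLine 0 ℓ := ⟨fun _ => rfl, fun _ _ => by simp⟩

namespace Blowup

/-- The standard chart `(x, u)`, `u = y / x`. -/
def chartX (z : ℂ × ℂ) : Blowup where
  pt := (z.1, z.2 * z.1)
  slope := (z.2 : OnePoint ℂ)
  mem := ⟨fun h => absurd h (OnePoint.coe_ne_infty _), fun u hu => by
    rw [← OnePoint.coe_injective hu]⟩

/-- The standard chart `(v, y)`, `v = x / y`. -/
def chartY (z : ℂ × ℂ) : Blowup where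
  pt := (z.1 * z.2, z.2)
  slope := if z.1 = 0 then OnePoint.infty else ((z.1⁻¹ : ℂ) : OnePoint ℂ)
  mem := by
    unfold OnLine
    split_ifs with h
    · exact ⟨fun _ => by simp [h], fun u hu => absurd hu (OnePoint.infty_ne_coe u)⟩
    · refine ⟨fun hu => absurd hu (OnePoint.coe_ne_infty _), fun u hu => ?_⟩
      rw [← OnePoint.coe_injective hu]
      field_simp

/-- The coordinates `(x, u)` of a point of the first chart. -/
def coordX (a : Blowup) : ℂ × ℂ := (a.pt.1, a.slope.elim 0 id)

/-- `M` carries the topology obtained by gluing the two charts. -/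
instance : TopologicalSpace Blowup :=
  TopologicalSpace.coinduced chartX inferInstance ⊔ TopologicalSpace.coinduced chartY inferInstance

theorem isOpen_iff (U : Set Blowup) :
    IsOpen U ↔ IsOpen (chartX ⁻¹' U) ∧ IsOpen (chartY ⁻¹' U) := Iff.rfl

/-- The inverse of the projection `M → ℂ²` outside the exceptional divisor. -/
def ofPoint (z : ℂ × ℂ) : Blowup := ⟨z, slopeOf z, onLine_slopeOf z⟩

/-- The exceptional divisor `L` without the points of the set `S ⊆ ℂ` of slopes. -/
def puncturedDivisor (S : Set ℂ) : Set Blowup :=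
  {a | a.pt = 0 ∧ ∀ u ∈ S, a.slope ≠ (u : OnePoint ℂ)}

/-- The lift to `M` of a germ of biholomorphism `H` of `(ℂ², 0)` tangent to the identity; it is the
identity on the divisor. -/
def lift (H : ℂ × ℂ → ℂ × ℂ) (a : Blowup) : Blowup :=
  if H a.pt = 0 then ⟨0, a.slope, onLine_zero _⟩ else ofPoint (H a.pt)

/-- `F : (ℂ², z) → M` is a germ of biholomorphism onto a neighbourhood of `F z`. -/
def IsBiholAt (F : ℂ × ℂ → Blowup) (z : ℂ × ℂ) : Prop :=
  ∃ c : ℂ × ℂ → Blowup, (c = chartX ∨ c = chartY) ∧ ∃ N : ℂ × ℂ → ℂ × ℂ,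
    AnalyticAt ℂ N z ∧ (fderiv ℂ N z).det ≠ 0 ∧ ∀ᶠ w in 𝓝 z, F w = c (N w)

/-- `F` is a biholomorphism of the open set `U` onto an open subset of `M`. -/
def IsBiholOn (F : Blowup → Blowup) (U : Set Blowup) : Prop :=
  IsOpen U ∧ Set.InjOn F U ∧
    (∀ z, chartX z ∈ U → IsBiholAt (fun w => F (chartX w)) z) ∧
    ∀ z, chartY z ∈ U → IsBiholAt (fun w => F (chartY w)) z

/-- On `U`, `F` takes the blow-up of the foliation of `v` to that of `v'` (the condition is stated
outside the divisor, in the coordinates of `ℂ²`). -/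
def CarriesOn (F : Blowup → Blowup) (U : Set Blowup) (v v' : ℂ × ℂ → ℂ × ℂ) : Prop :=
  ∀ z : ℂ × ℂ, z ≠ 0 → ofPoint z ∈ U →
    det2 (fderiv ℂ (fun w => (F (ofPoint w)).pt) z (v z)) (v' (F (ofPoint z)).pt) = 0

end Blowup

open Blowup

/-! ## The maps `ξ_i`, `ζ_j`, attached to `F_μ`, and the normalizing transformations -/

/-- The linear vector field `λ x ∂x + (u - c) ∂u`. -/
def linearField (lam c : ℂ) (z : ℂ × ℂ) : ℂ × ℂ := (lam * z.1, z.2 - c)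

/-- `ξ = (ε, u)` is a biholomorphism near `(0, c)` which is the identity on `x = 0`, takes the
linear foliation of index `λ` to the blow-up of the foliation of `μ`, and has
`ε = ∑ ε_k(u) x ^ k` with `ε_1(c) = 1`. -/
def IsXi (μ : ℂ × ℂ → ℂ × ℂ) (lam c : ℂ) (ε : ℂ × ℂ → ℂ) : Prop :=
  AnalyticAt ℂ ε (0, c) ∧ (∀ᶠ u in 𝓝 c, ε (0, u) = 0) ∧ xCoeff 1 ε c = 1 ∧
    CarriesAt (fun z => (chartX (ε z, z.2)).pt) (linearField lam c) μ (0, c)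

/-- `ζ = (ς, u)` is a biholomorphism near `(0, c)` which is the identity on `x = 0`, takes the
foliation `x = cst` to the blow-up of the foliation of `μ`, and has `ς = ∑ ς_k(u) x ^ k` with
`ς_1(c) = 1` and `ς_k(c) = 0` for `k > 1`. -/
def IsZeta (μ : ℂ × ℂ → ℂ × ℂ) (c : ℂ) (ς : ℂ × ℂ → ℂ) : Prop :=
  AnalyticAt ℂ ς (0, c) ∧ (∀ᶠ u in 𝓝 c, ς (0, u) = 0) ∧ xCoeff 1 ς c = 1 ∧
    (∀ k, 1 < k → xCoeff k ς c = 0) ∧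
    CarriesAt (fun z => (chartX (ς z, z.2)).pt) (fun _ => (0, 1)) μ (0, c)

/-- `Ψ(x, u) = (x (1 + s(x) / (u - c)) ^ λ, u + s(x))`, with the branch of the power which is `1`
on `x = 0`. -/
def Psi (lam c : ℂ) (s : ℂ → ℂ) (z : ℂ × ℂ) : ℂ × ℂ :=
  (z.1 * (1 + s z.1 / (z.2 - c)) ^ lam, z.2 + s z.1)

/-- The function `g(u) = (c - u) (J(u) - c)` of an involution `J` with fixed point `c`. -/
def involutionFun (c : ℂ) (J : ℂ → ℂ) (u : ℂ) : ℂ := (c - u) * (J u - c)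

/-- `(H_n, (H_{p_i}), (H_{q_j}))` are normalizing transformations of the foliation pair `(v, w)`
with respect to `(F_μ, G_r)`, the local models being given by the functions `s_i`, `z_j`. -/
structure IsNormalizing {n m : ℕ} (p : Fin (n + 1) → ℂ) (q : Fin m → ℂ) (I : Fin m → ℂ → ℂ)
    (μ : ℂ × ℂ → ℂ × ℂ) (ε : Fin (n + 1) → ℂ × ℂ → ℂ) (ς : Fin m → ℂ × ℂ → ℂ)
    (s : Fin (n + 1) → ℂ → ℂ) (z : Fin m → ℂ → ℂ) (v w : ℂ × ℂ → ℂ × ℂ)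
    (Hn : Blowup → Blowup) (Hp : Fin (n + 1) → ℂ × ℂ → Blowup) (Hq : Fin m → ℂ × ℂ → Blowup) :
    Prop where
  /-- `H_n` is a biholomorphism between neighbourhoods of the punctured sphere, taking the blow-ups
  of `F_μ` and of the radial foliation to those of `F` and `G`. -/
  regular_bihol : ∃ U : Set Blowup, puncturedDivisor (Set.range p ∪ Set.range q) ⊆ U ∧
    IsBiholOn Hn U ∧ CarriesOn Hn U μ v ∧ CarriesOn Hn U (fun a => a) w
  regular_id : ∀ a ∈ puncturedDivisor (Set.range p ∪ Set.range q), Hn a = a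
  /-- `H_n (x, u) = (x + O(x²), u + O(x))`. -/
  regular_jet : ∀ u : ℂ, u ∉ Set.range p ∪ Set.range q →
    ((fun a : ℂ × ℂ => (coordX (Hn (chartX a))).1 - a.1) =O[𝓝 (0, u)] fun a => a.1 ^ 2) ∧
    ((fun a : ℂ × ℂ => (coordX (Hn (chartX a))).2 - a.2) =O[𝓝 (0, u)] fun a => a.1)
  /-- The local models at the singular points: `u + s_i(x) = cst`. -/
  s_germ : ∀ i, AnalyticAt ℂ (s i) 0 ∧ s i 0 = 0
  singular_bihol : ∀ i, IsBiholAt (Hp i) (0, p i)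
  singular_id : ∀ i, ∀ᶠ u in 𝓝 (p i), Hp i (0, u) = chartX (0, u)
  singular_carries : ∀ i,
    CarriesAt (fun a => (Hp i a).pt) (linearField (camachoSad n μ (p i)) (p i)) v (0, p i) ∧
    CarriesAt (fun a => (Hp i a).pt) (fun a => (1, -deriv (s i) a.1)) w (0, p i)
  /-- The local models at the tangency points: `z_j(x) + g_j(u) = cst`. -/
  z_germ : ∀ j, AnalyticAt ℂ (z j) 0 ∧ z j 0 = 0 ∧ deriv (z j) 0 ≠ 0
  tangency_bihol : ∀ j, IsBiholAt (Hq j) (0, q j)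
  tangency_id : ∀ j, ∀ᶠ u in 𝓝 (q j), Hq j (0, u) = chartX (0, u)
  tangency_carries : ∀ j,
    CarriesAt (fun a => (Hq j a).pt) (fun _ => (0, 1)) v (0, q j) ∧
    CarriesAt (fun a => (Hq j a).pt)
      (fun a => (deriv (involutionFun (q j) (I j)) a.2, -deriv (z j) a.1)) w (0, q j)
  /-- `H_{p_i} = H_n ∘ ξ_i ∘ Ψ_i` near the punctured disk. -/
  factorization_p : ∀ i, ∀ᶠ u in 𝓝[≠] (p i), ∀ᶠ a in 𝓝 ((0 : ℂ), u),
    Hp i a = Hn (chartX (ε i (Psi (camachoSad n μ (p i)) (p i) (s i) a),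
      (Psi (camachoSad n μ (p i)) (p i) (s i) a).2))
  /-- `H_{q_j} = H_n ∘ ζ_j ∘ Φ_j` near the punctured disk, where `Φ_j = (x, φ_j)`,
  `φ_j = u + O(x)` and `g_j ∘ φ_j (x, u) = g_j(u) + z_j(x)`. -/
  factorization_q : ∀ j, ∃ φ : ℂ × ℂ → ℂ, ∀ᶠ u in 𝓝[≠] (q j),
    AnalyticAt ℂ φ (0, u) ∧ φ (0, u) = u ∧ ∀ᶠ a in 𝓝 ((0 : ℂ), u),
      involutionFun (q j) (I j) (φ a) = involutionFun (q j) (I j) a.2 + z j a.1 ∧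
      Hq j a = Hn (chartX (ς j (a.1, φ a), φ a))

/-! ## The canonical coefficients -/

/-- `P(1 / (u - c))` is the principal part at `c` of `f`: `P` has no constant term, and
`f - P(1 / (u - c))` extends holomorphically to `c`. -/
def IsPrincipalPart (f : ℂ → ℂ) (c : ℂ) (P : Polynomial ℂ) : Prop :=
  P.coeff 0 = 0 ∧ ∃ r : ℂ → ℂ, AnalyticAt ℂ r c ∧
    ∀ᶠ u in 𝓝[≠] c, f u = P.eval ((u - c)⁻¹) + r u

open Classical in
/-- The principal part at `c` of a function `f` with at most a pole at `c` (a rational function of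
`u`; by convention `0` if `f` is not meromorphic at `c`). -/
def principalPart (f : ℂ → ℂ) (c : ℂ) (u : ℂ) : ℂ :=
  if h : ∃ P, IsPrincipalPart f c P then (Classical.choose h).eval ((u - c)⁻¹) else 0

/-- The function `f`, with its value at `c` replaced by the limit at `c`. -/
def extendAt (f : ℂ → ℂ) (c : ℂ) : ℂ → ℂ :=
  open Classical in Function.update f c (limUnder (𝓝[≠] c) f)

/-- The functionals `𝐀_p[λ, s_r; ε_r, A_r]_{r=1}^k` and `𝐁_p[λ, s_r; ε_r, B_r]_{r=1}^k` (they are the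
same) at a singular point: the coefficient of `x^(k+1)` in
`(∑_{r ≤ k} A_r(u) x^r) ∘ (∑_{l ≤ k} ε_l(u) x^l, u) ∘ Ψ`, where in `Ψ` the series `s` is
truncated to `∑_{r ≤ k} s_r x^r`. -/
def functionalP (k : ℕ) (lam c : ℂ) (s : ℕ → ℂ) (ε A : ℕ → ℂ → ℂ) (u : ℂ) : ℂ :=
  taylorCoeff (k + 1) fun x =>
    let S : ℂ → ℂ := fun t => ∑ r ∈ Finset.Icc 1 k, s r * t ^ r
    let y : ℂ × ℂ := Psi lam c S (x, u)
    ∑ r ∈ Finset.Icc 1 k, A r y.2 * (∑ l ∈ Finset.Icc 1 k, ε l y.2 * y.1 ^ l) ^ r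

/-- The coefficients of the solution `φ = u + ∑ φ_k(u) x^k` of `g ∘ φ = g + ∑_{k ≥ 1} z_k x^k`. -/
def phiCoeff (g : ℂ → ℂ) (z : ℕ → ℂ) (u : ℂ) : ℕ → ℂ
  | 0 => u
  | k + 1 =>
    (z (k + 1) - taylorCoeff (k + 1) fun x => g (∑ l : Fin (k + 1), phiCoeff g z u l * x ^ (l : ℕ)))
      / deriv g u
  decreasing_by exact l.isLt

/-- The functional `𝐀_q[z_r; g, ς_r, A_r]_{r=1}^k` at a tangency point: the coefficient of `x^(k+1)`
in `(∑_{r ≤ k} A_r(u) x^r) ∘ (∑_{l ≤ k} ς_l(u) x^l, u) ∘ (x, ∑_{l ≤ k} φ_l(u) x^l)`. -/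
def functionalAQ (k : ℕ) (g : ℂ → ℂ) (z : ℕ → ℂ) (ς A : ℕ → ℂ → ℂ) (u : ℂ) : ℂ :=
  taylorCoeff (k + 1) fun x =>
    let y : ℂ := ∑ l ∈ Finset.range (k + 1), phiCoeff g z u l * x ^ l
    ∑ r ∈ Finset.Icc 1 k, A r y * (∑ l ∈ Finset.Icc 1 k, ς l y * x ^ l) ^ r

/-- The functional `𝐁_q[z_r; g, ς_r, B_r]_{r=1}^k`: besides the composition as in `functionalAQ`, it
contains `φ_{k+1} - z_{k+1} / g'`, which only involves `z_1, …, z_k`. -/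
def functionalBQ (k : ℕ) (g : ℂ → ℂ) (z : ℕ → ℂ) (ς B : ℕ → ℂ → ℂ) (u : ℂ) : ℂ :=
  (phiCoeff g z u (k + 1) - z (k + 1) / deriv g u) + functionalAQ k g z ς B u

/-- The data of the local models and of the maps `ξ_i`, `ζ_j` on which the canonical coefficients
depend, as sequences of coefficients. -/
structure ModelData (n m : ℕ) where
  p : Fin (n + 1) → ℂ
  q : Fin m → ℂ
  lam : Fin (n + 1) → ℂ
  s : Fin (n + 1) → ℕ → ℂ
  z : Fin m → ℕ → ℂ
  g : Fin m → ℂ → ℂ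
  eps : Fin (n + 1) → ℕ → ℂ → ℂ
  sig : Fin m → ℕ → ℂ → ℂ

namespace ModelData

variable {n m : ℕ} (D : ModelData n m)

/-- The canonical coefficients `a_{n,r}`. -/
def aN : ℕ → ℂ → ℂ
  | 0 => fun _ => 0
  | 1 => fun _ => 1
  | k + 2 =>
    let a : ℕ → ℂ → ℂ := fun r => if _h : r < k + 2 then aN r else fun _ => 0
    fun u =>
      - (∑ i, principalPart
          (fun t => functionalP (k + 1) (D.lam i) (D.p i) (D.s i) (D.eps i) a t
            / (D.eps i 1 t) ^ (k + 2)) (D.p i) u)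
      - ∑ j, principalPart
          (fun t => functionalAQ (k + 1) (D.g j) (D.z j) (D.sig j) a t
            / (D.sig j 1 t) ^ (k + 2)) (D.q j) u

/-- The canonical coefficients `b_{n,r}`. -/
def bN : ℕ → ℂ → ℂ
  | 0 => fun _ => 0
  | 1 => fun u =>
      - ∑ j, principalPart (fun t => D.z j 1 / (D.sig j 1 t * deriv (D.g j) t)) (D.q j) u
  | k + 2 =>
    let b : ℕ → ℂ → ℂ := fun r => if _h : r < k + 2 then bN r else fun _ => 0
    fun u =>
      - (∑ i, principalPart
          (fun t => functionalP (k + 1) (D.lam i) (D.p i) (D.s i) (D.eps i) b t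
            / (D.eps i 1 t) ^ (k + 2)) (D.p i) u)
      - ∑ j, principalPart
          (fun t => D.z j (k + 2) / ((D.sig j 1 t) ^ (k + 2) * deriv (D.g j) t)
            + functionalBQ (k + 1) (D.g j) (D.z j) (D.sig j) b t
              / (D.sig j 1 t) ^ (k + 2)) (D.q j) u

/-- The canonical coefficients `a_{p_i,r}` (extended to the removable singularity `p_i`). -/
def aP (i : Fin (n + 1)) : ℕ → ℂ → ℂ
  | 0 => fun _ => 0
  | 1 => D.eps i 1
  | k + 2 => extendAt (fun u =>
      D.eps i (k + 2) u
        + functionalP (k + 1) (D.lam i) (D.p i) (D.s i) (D.eps i) D.aN u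
        + (D.eps i 1 u) ^ (k + 2) * D.aN (k + 2) u) (D.p i)

/-- The canonical coefficients `b_{p_i,r}` (extended to the removable singularity `p_i`). -/
def bP (i : Fin (n + 1)) : ℕ → ℂ → ℂ
  | 0 => fun _ => 0
  | 1 => fun u => D.s i 1 + D.eps i 1 u * D.bN 1 u
  | k + 2 => extendAt (fun u =>
      D.s i (k + 2) + D.eps i (k + 2) u * D.bN 1 u
        + functionalP (k + 1) (D.lam i) (D.p i) (D.s i) (D.eps i) D.bN u
        + (D.eps i 1 u) ^ (k + 2) * D.bN (k + 2) u) (D.p i)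

/-- The canonical coefficients `a_{q_j,r}` (extended to the removable singularity `q_j`). -/
def aQ (j : Fin m) : ℕ → ℂ → ℂ
  | 0 => fun _ => 0
  | 1 => D.sig j 1
  | k + 2 => extendAt (fun u =>
      D.sig j (k + 2) u
        + functionalAQ (k + 1) (D.g j) (D.z j) (D.sig j) D.aN u
        + (D.sig j 1 u) ^ (k + 2) * D.aN (k + 2) u) (D.q j)

/-- The canonical coefficients `b_{q_j,r}` (extended to the removable singularity `q_j`). -/
def bQ (j : Fin m) : ℕ → ℂ → ℂ
  | 0 => fun _ => 0
  | 1 => extendAt (fun u => D.z j 1 / deriv (D.g j) u + D.sig j 1 u * D.bN 1 u) (D.q j)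
  | k + 2 => extendAt (fun u =>
      D.z j (k + 2) / deriv (D.g j) u + D.sig j (k + 2) u * D.bN 1 u
        + functionalBQ (k + 1) (D.g j) (D.z j) (D.sig j) D.bN u
        + (D.sig j 1 u) ^ (k + 2) * D.bN (k + 2) u) (D.q j)

end ModelData

/-- The data from which the canonical coefficients are computed: the Camacho–Sad indices of `F_μ`,
the Taylor coefficients of `s_i`, `z_j`, the functions `g_j`, and the coefficients of `ε_i`, `ς_j`. -/
def modelData {n m : ℕ} (p : Fin (n + 1) → ℂ) (q : Fin m → ℂ) (I : Fin m → ℂ → ℂ)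
    (μ : ℂ × ℂ → ℂ × ℂ) (ε : Fin (n + 1) → ℂ × ℂ → ℂ) (ς : Fin m → ℂ × ℂ → ℂ)
    (s : Fin (n + 1) → ℂ → ℂ) (z : Fin m → ℂ → ℂ) : ModelData n m where
  p := p
  q := q
  lam i := camachoSad n μ (p i)
  s i r := taylorCoeff r (s i)
  z j r := taylorCoeff r (z j)
  g j := involutionFun (q j) (I j)
  eps i r := xCoeff r (ε i)
  sig j r := xCoeff r (ς j)

/-- Near the point `(0, c)` of the chart `(x, u)`, the map `F` with values in `M` has, in the
coordinates `(x, u)`, the form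
`(∑_{r=1}^k a_r(u) x^r + O(x^(k+1)), u + ∑_{r=1}^k b_r(u) x^r + O(x^(k+1)))`. -/
def HasJetAt (k : ℕ) (F : ℂ × ℂ → Blowup) (a b : ℕ → ℂ → ℂ) (c : ℂ) : Prop :=
  ((fun y : ℂ × ℂ => (coordX (F y)).1 - ∑ r ∈ Finset.Icc 1 k, a r y.2 * y.1 ^ r)
      =O[𝓝 (0, c)] fun y => y.1 ^ (k + 1)) ∧
  ((fun y : ℂ × ℂ => (coordX (F y)).2 - (y.2 + ∑ r ∈ Finset.Icc 1 k, b r y.2 * y.1 ^ r))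
      =O[𝓝 (0, c)] fun y => y.1 ^ (k + 1))

/-- `f` is holomorphic on the Riemann sphere minus the finite set `S ⊆ ℂ`. -/
def HolomorphicOffInSphere (f : ℂ → ℂ) (S : Set ℂ) : Prop :=
  (∀ u ∉ S, AnalyticAt ℂ f u) ∧
    ∃ G : ℂ → ℂ, AnalyticAt ℂ G 0 ∧ ∀ᶠ t in 𝓝[≠] (0 : ℂ), f t⁻¹ = G t

end

/-! ## Taylor coefficients in one variable -/

/-! Everything rests on the freedom to compose normalizing transformations on the left with the lift
of a germ tangent to the identity. This changes neither the local models nor the factorizations, and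
by `IsNonDicritical.of_isPush`, `IsDicritical.of_isPush` and `IsNormalizing.of_isPush` the
transported pair is of the same kind. The coefficients of `H_n` in powers of `x` are made canonical
one order at a time; those of `H_{p_i}` and `H_{q_j}` then follow from the factorizations.

Assume that the coefficients of `H_n` are canonical up to order `k`. The coefficient of order `k +
1` in `H_{p_i} = H_n ∘ ξ_i ∘ Ψ_i` (`jet_p`) shows that the coefficient of `H_{p_i}` is the canonical
one plus the defect of `H_n`, i.e. actual minus canonical coefficient of order `k + 1`, times
`ε_{i,1} ^ (k + 1)`. The left side is holomorphic at `p_i` because `H_{p_i}` is; the canonical one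
is holomorphic because the recursion subtracts exactly the principal parts (`analyticAt_aP`,
`analyticAt_bP`); and `ε_{i,1}(p_i) = 1`. So the defect extends holomorphically across `p_i`, and
likewise across `q_j` (`jet_q`, `analyticAt_aQ`, `analyticAt_bQ`): it is entire.

At `u = ∞` the invariance of the `y`-axis enters. The `y`-axis is the only leaf of `G` through its
point of the divisor (`eq_zero_of_tangent`), so `H_n` preserves it, and in the chart `(v, y)` it is
`(v V, y Y)` with `V = 1` at the origin. Passing to `(x, u)` gives poles of order at most `k` and `k
+ 2` at infinity (`jet_infinity`). By Liouville the two defects are polynomials `P`, `Q` of degrees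
at most `k` and `k + 2` (`exists_defect`).

These are precisely the defects that a germ of `ℂ²` preserving the `y`-axis can remove: with `P` and
`Q` made homogeneous of degrees `k` and `k + 2`, the lift of `(x - x P, y - y P - Q)` lowers the
coefficients of order `k + 1` by `P` and `Q` and keeps the smaller ones
(`IsDivisorGerm.jet_correction`). For `k = 0` the normalization `x + O(x²)` forces `P = 0`, so the
correction is still tangent to the identity. Induction on `k` (`exists_jets`) concludes. -/

theorem taylorCoeff_congr {f g : ℂ → ℂ} (h : f =ᶠ[𝓝 0] g) (k : ℕ) :
    taylorCoeff k f = taylorCoeff k g := by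
  unfold taylorCoeff
  rw [h.iteratedDeriv_eq k]

theorem taylorCoeff_zero (f : ℂ → ℂ) : taylorCoeff 0 f = f 0 := by
  simp [taylorCoeff]

theorem taylorCoeff_one (f : ℂ → ℂ) : taylorCoeff 1 f = deriv f 0 := by
  simp [taylorCoeff, iteratedDeriv_one]

theorem taylorCoeff_add {f g : ℂ → ℂ} (hf : AnalyticAt ℂ f 0) (hg : AnalyticAt ℂ g 0) (k : ℕ) :
    taylorCoeff k (fun x => f x + g x) = taylorCoeff k f + taylorCoeff k g := by
  unfold taylorCoeff
  rw [show (fun x => f x + g x) = f + g from rfl, iteratedDeriv_add hf.contDiffAt hg.contDiffAt,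
    add_div]

theorem taylorCoeff_sub {f g : ℂ → ℂ} (hf : AnalyticAt ℂ f 0) (hg : AnalyticAt ℂ g 0) (k : ℕ) :
    taylorCoeff k (fun x => f x - g x) = taylorCoeff k f - taylorCoeff k g := by
  unfold taylorCoeff
  rw [show (fun x => f x - g x) = f - g from rfl, iteratedDeriv_sub hf.contDiffAt hg.contDiffAt,
    sub_div]

theorem taylorCoeff_sum {ι : Type*} (s : Finset ι) {f : ι → ℂ → ℂ}
    (hf : ∀ i ∈ s, AnalyticAt ℂ (f i) 0) (k : ℕ) :
    taylorCoeff k (fun x => ∑ i ∈ s, f i x) = ∑ i ∈ s, taylorCoeff k (f i) := by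
  unfold taylorCoeff
  rw [iteratedDeriv_fun_sum fun i hi => (hf i hi).contDiffAt, Finset.sum_div]

theorem taylorCoeff_const_mul (c : ℂ) (f : ℂ → ℂ) (k : ℕ) :
    taylorCoeff k (fun x => c * f x) = c * taylorCoeff k f := by
  unfold taylorCoeff
  rw [iteratedDeriv_const_mul_field, mul_div_assoc]

theorem taylorCoeff_mul {f g : ℂ → ℂ} (hf : AnalyticAt ℂ f 0) (hg : AnalyticAt ℂ g 0) (k : ℕ) :
    taylorCoeff k (fun x => f x * g x) =
      ∑ i ∈ Finset.range (k + 1), taylorCoeff i f * taylorCoeff (k - i) g := by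
  unfold taylorCoeff
  rw [show (fun x => f x * g x) = f * g from rfl, iteratedDeriv_mul hf.contDiffAt hg.contDiffAt,
    Finset.sum_div]
  refine Finset.sum_congr rfl fun i hi => ?_
  have hi : i ≤ k := Nat.lt_succ_iff.mp (Finset.mem_range.mp hi)
  rw [Nat.cast_choose ℂ hi]
  have h1 := Nat.cast_ne_zero (R := ℂ).mpr (Nat.factorial_ne_zero k)
  have h2 := Nat.cast_ne_zero (R := ℂ).mpr (Nat.factorial_ne_zero i)
  have h3 := Nat.cast_ne_zero (R := ℂ).mpr (Nat.factorial_ne_zero (k - i))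
  field_simp

theorem taylorCoeff_pow_self (k n : ℕ) :
    taylorCoeff k (fun x => x ^ n) = if k = n then 1 else 0 := by
  unfold taylorCoeff
  rw [iteratedDeriv_fun_pow_zero]
  split_ifs with h
  · subst h
    rw [div_self (Nat.cast_ne_zero.mpr (Nat.factorial_ne_zero _))]
  · simp

theorem taylorCoeff_pow_mul {f : ℂ → ℂ} (hf : AnalyticAt ℂ f 0) (n k : ℕ) :
    taylorCoeff k (fun x => x ^ n * f x) = if n ≤ k then taylorCoeff (k - n) f else 0 := by
  rw [taylorCoeff_mul (by fun_prop) hf]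
  simp only [taylorCoeff_pow_self, ite_mul, one_mul, zero_mul]
  rw [Finset.sum_ite_eq' (Finset.range (k + 1)) n]
  simp

/-- An analytic function which is `O(xⁿ)` is divisible by `xⁿ`. -/
theorem exists_eq_pow_mul_of_isBigO {f : ℂ → ℂ} (hf : AnalyticAt ℂ f 0) {n : ℕ}
    (h : f =O[𝓝[≠] 0] fun x => x ^ n) :
    ∃ g, AnalyticAt ℂ g 0 ∧ ∀ᶠ x in 𝓝 0, f x = x ^ n * g x := by
  suffices hn : (n : ℕ∞) ≤ analyticOrderAt f 0 by
    obtain ⟨g, hg, hfg⟩ := (natCast_le_analyticOrderAt hf).1 hn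
    exact ⟨g, hg, by simpa using hfg⟩
  -- If the order were some `m < n`, then `f = x ^ m g` with `g 0 ≠ 0`, while the bound gives `g =
  -- O(x ^ (n - m))` and so `g 0 = 0`.
  by_contra! hlt
  obtain ⟨m, hm⟩ := ENat.ne_top_iff_exists.1 hlt.ne_top
  rw [← hm] at hlt
  have hmn : m < n := by exact_mod_cast hlt
  obtain ⟨g, hg, hg0, hfg⟩ := hf.analyticOrderAt_eq_natCast.1 hm.symm
  apply hg0
  have h1 : g =O[𝓝[≠] 0] fun x => x ^ (n - m) := by
    obtain ⟨C, hC⟩ := h.bound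
    refine Asymptotics.IsBigO.of_bound C ?_
    filter_upwards [hC, hfg.filter_mono nhdsWithin_le_nhds, self_mem_nhdsWithin] with x h1 h2 h3
    have hx : 0 < ‖x‖ ^ m := pow_pos (norm_pos_iff.2 h3) _
    rw [h2] at h1
    simp only [sub_zero, smul_eq_mul, norm_mul, norm_pow] at h1 ⊢
    rw [← Nat.add_sub_of_le hmn.le, pow_add] at h1
    refine le_of_mul_le_mul_left ?_ hx
    linarith
  have h2 : Tendsto g (𝓝[≠] 0) (𝓝 0) := by
    refine h1.trans_tendsto ?_
    have : Tendsto (fun x : ℂ => x ^ (n - m)) (𝓝 0) (𝓝 (0 ^ (n - m))) :=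
      (continuous_pow (n - m)).tendsto 0
    rw [zero_pow (by omega)] at this
    exact this.mono_left nhdsWithin_le_nhds
  exact tendsto_nhds_unique (hg.continuousAt.tendsto.mono_left nhdsWithin_le_nhds) h2

theorem taylorCoeff_eq_zero_of_isBigO {f : ℂ → ℂ} (hf : AnalyticAt ℂ f 0) {n : ℕ}
    (h : f =O[𝓝 0] fun x => x ^ n) {j : ℕ} (hj : j < n) : taylorCoeff j f = 0 := by
  obtain ⟨g, hg, hfg⟩ := exists_eq_pow_mul_of_isBigO hf (h.mono nhdsWithin_le_nhds)
  rw [taylorCoeff_congr hfg, taylorCoeff_pow_mul hg, if_neg (by omega)]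

theorem taylorCoeff_eq_of_isBigO {f g : ℂ → ℂ} (hf : AnalyticAt ℂ f 0) (hg : AnalyticAt ℂ g 0)
    {n : ℕ} (h : (fun x => f x - g x) =O[𝓝 0] fun x => x ^ n) {j : ℕ} (hj : j < n) :
    taylorCoeff j f = taylorCoeff j g := by
  have := taylorCoeff_eq_zero_of_isBigO (hf.sub hg) h hj
  rwa [show f - g = fun x => f x - g x from rfl, taylorCoeff_sub hf hg, sub_eq_zero] at this

/-- Taylor's formula at `0`. -/
theorem isBigO_sub_taylor {f : ℂ → ℂ} (hf : AnalyticAt ℂ f 0) (n : ℕ) :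
    (fun x => f x - ∑ j ∈ Finset.range n, taylorCoeff j f * x ^ j) =O[𝓝 0] fun x => x ^ n := by
  have h := hf.hasFPowerSeriesAt.isBigO_sub_partialSum_pow n
  simp only [zero_add, FormalMultilinearSeries.partialSum,
    FormalMultilinearSeries.ofScalars_apply_eq, smul_eq_mul] at h
  refine (h.congr_left fun x => ?_).trans (Asymptotics.IsBigO.of_norm_left ?_)
  · rfl
  · simpa using (Asymptotics.isBigO_refl (fun x : ℂ => ‖x ^ n‖) (𝓝 0)).of_norm_right

theorem taylorCoeff_polynomial (n : ℕ) (c : ℕ → ℂ) (k : ℕ) :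
    taylorCoeff k (fun x => ∑ j ∈ Finset.range n, c j * x ^ j) = if k < n then c k else 0 := by
  rw [taylorCoeff_sum _ (fun i _ => by fun_prop)]
  simp only [taylorCoeff_const_mul, taylorCoeff_pow_self, mul_ite, mul_one, mul_zero]
  rw [Finset.sum_ite_eq]
  simp

/-- Uniqueness of the Taylor coefficients. -/
theorem taylorCoeff_eq_of_expansion {f : ℂ → ℂ} (hf : AnalyticAt ℂ f 0) {n : ℕ} {c : ℕ → ℂ}
    (h : (fun x => f x - ∑ j ∈ Finset.range n, c j * x ^ j) =O[𝓝 0] fun x => x ^ n) {k : ℕ}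
    (hk : k < n) : taylorCoeff k f = c k := by
  rw [taylorCoeff_eq_of_isBigO hf (by fun_prop) h hk, taylorCoeff_polynomial, if_pos hk]

/-- An analytic function whose first `n` Taylor coefficients vanish is `O(xⁿ)`. -/
theorem isBigO_of_taylorCoeff_eq_zero {f : ℂ → ℂ} (hf : AnalyticAt ℂ f 0) {n : ℕ}
    (h : ∀ j < n, taylorCoeff j f = 0) : f =O[𝓝 0] fun x => x ^ n := by
  refine (isBigO_sub_taylor hf n).congr_left fun x => ?_
  rw [Finset.sum_eq_zero fun j hj => by rw [h j (Finset.mem_range.1 hj), zero_mul], sub_zero]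

theorem isBigO_sub_of_taylorCoeff_eq {f g : ℂ → ℂ} (hf : AnalyticAt ℂ f 0)
    (hg : AnalyticAt ℂ g 0) {n : ℕ} (h : ∀ j < n, taylorCoeff j f = taylorCoeff j g) :
    (fun x => f x - g x) =O[𝓝 0] fun x => x ^ n :=
  isBigO_of_taylorCoeff_eq_zero (hf.sub hg) fun j hj => by
    rw [show f - g = fun x => f x - g x from rfl, taylorCoeff_sub hf hg, h j hj, sub_self]

theorem analyticAt_comp_mul {f : ℂ → ℂ} (hf : AnalyticAt ℂ f 0) (c : ℂ) :
    AnalyticAt ℂ (fun x => f (c * x)) 0 :=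
  AnalyticAt.fun_comp (f := fun x => c * x) (by simpa using hf) (by fun_prop)

theorem taylorCoeff_comp_mul {f : ℂ → ℂ} (hf : AnalyticAt ℂ f 0) (c : ℂ) (k : ℕ) :
    taylorCoeff k (fun x => f (c * x)) = c ^ k * taylorCoeff k f := by
  refine taylorCoeff_eq_of_expansion (n := k + 1) (c := fun j => c ^ j * taylorCoeff j f)
    (analyticAt_comp_mul hf c) ?_ (Nat.lt_succ_self k)
  have ht : Tendsto (fun x : ℂ => c * x) (𝓝 0) (𝓝 0) := by
    simpa using (continuous_const_mul c).tendsto (0 : ℂ)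
  have h := (isBigO_sub_taylor hf (k + 1)).comp_tendsto ht
  refine (h.congr_left fun x => ?_).trans ?_
  · simp only [Function.comp, mul_pow]
    congr 1
    exact Finset.sum_congr rfl fun j _ => by ring
  · simp only [Function.comp_def, mul_pow]
    exact (Asymptotics.isBigO_refl _ _).const_mul_left _

/-! ## Division by a coordinate in two variables -/

/-- The projection `(x, u) ↦ (0, u)`. -/
noncomputable def projSnd : ℂ × ℂ →L[ℂ] ℂ × ℂ :=
  (ContinuousLinearMap.inr ℂ ℂ ℂ).comp (ContinuousLinearMap.snd ℂ ℂ ℂ)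

theorem projSnd_apply (z : ℂ × ℂ) : projSnd z = (0, z.2) := rfl

theorem norm_projSnd_le : ‖projSnd‖ ≤ 1 :=
  ContinuousLinearMap.opNorm_le_bound _ zero_le_one fun z => by
    rw [projSnd_apply, one_mul, Prod.norm_def, Prod.norm_def]
    simp

/-- One term of the quotient of a homogeneous polynomial by the first coordinate. -/
noncomputable def divTerm {n : ℕ} (P : ContinuousMultilinearMap ℂ (fun _ : Fin (n + 1) => ℂ × ℂ) ℂ)
    (i : Fin (n + 1)) : ContinuousMultilinearMap ℂ (fun _ : Fin n => ℂ × ℂ) ℂ :=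
  (P.compContinuousLinearMap fun j =>
    if j < i then projSnd else ContinuousLinearMap.id ℂ (ℂ × ℂ)).curryMid i (1, 0)

theorem norm_divTerm_le {n : ℕ}
    (P : ContinuousMultilinearMap ℂ (fun _ : Fin (n + 1) => ℂ × ℂ) ℂ) (i : Fin (n + 1)) :
    ‖divTerm P i‖ ≤ ‖P‖ := by
  unfold divTerm
  refine (ContinuousLinearMap.le_opNorm _ _).trans ?_
  rw [ContinuousMultilinearMap.norm_curryMid]
  have h1 : ‖((1 : ℂ), (0 : ℂ))‖ ≤ 1 := by simp [Prod.norm_def]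
  have h2 : ∏ j, ‖(if j < i then projSnd else ContinuousLinearMap.id ℂ (ℂ × ℂ))‖ ≤ 1 := by
    refine Finset.prod_le_one (fun _ _ => norm_nonneg _) fun j _ => ?_
    split_ifs
    · exact norm_projSnd_le
    · exact ContinuousLinearMap.norm_id_le
  refine (mul_le_of_le_one_right (norm_nonneg _) h1).trans ?_
  exact (ContinuousMultilinearMap.norm_compContinuousLinearMap_le _ _).trans
    (mul_le_of_le_one_right (norm_nonneg _) h2)

/-- The arguments `z` are replaced by `projSnd z` one at a time. The `i`-th replacement changes one
slot by `z - projSnd z = z.1 • (1, 0)`, and multilinearity extracts the factor `z.1`. The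
differences telescope in `mul_divSeries`. -/
theorem mul_divTerm {n : ℕ} (P : ContinuousMultilinearMap ℂ (fun _ : Fin (n + 1) => ℂ × ℂ) ℂ)
    (i : Fin (n + 1)) (z : ℂ × ℂ) :
    z.1 * divTerm P i (fun _ => z) =
      P (fun j => if (j : ℕ) < i then projSnd z else z) -
        P (fun j => if (j : ℕ) < i + 1 then projSnd z else z) := by
  set m : Fin (n + 1) → ℂ × ℂ := fun j => if (j : ℕ) < i then projSnd z else z with hm
  have e1 : divTerm P i (fun _ => z) = P (Function.update m i (1, 0)) := by
    unfold divTerm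
    rw [ContinuousMultilinearMap.curryMid_apply,
      ContinuousMultilinearMap.compContinuousLinearMap_apply]
    congr 1
    funext j
    rcases eq_or_ne j i with rfl | hj
    · simp
    · obtain ⟨l, rfl⟩ := Fin.exists_succAbove_eq hj
      rw [Function.update_of_ne hj, Fin.insertNth_apply_succAbove]
      by_cases hl : i.succAbove l < i
      · simp [hm, hl]
      · simp [hm, hl]
  have e2 : m = Function.update m i z := by
    rw [eq_comm, Function.update_eq_self_iff]
    simp [hm]
  have e3 : (fun j : Fin (n + 1) => if (j : ℕ) < i + 1 then projSnd z else z) =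
      Function.update m i (projSnd z) := by
    funext j
    rcases eq_or_ne j i with rfl | hj
    · simp
    · have hj' : (j : ℕ) ≠ i := fun h => hj (Fin.ext h)
      rw [Function.update_of_ne hj]
      have : (j : ℕ) < i + 1 ↔ (j : ℕ) < i := by omega
      simp [hm, this]
  have e4 : z = projSnd z + z.1 • ((1 : ℂ), (0 : ℂ)) := by
    rw [projSnd_apply]; ext <;> simp
  rw [e1, e3, eq_sub_iff_add_eq', ← smul_eq_mul, ← ContinuousMultilinearMap.map_update_smul,
    ← ContinuousMultilinearMap.map_update_add, ← e4, ← e2]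

/-- The formal quotient of a power series in two variables by the first coordinate. -/
noncomputable def divSeries (P : FormalMultilinearSeries ℂ (ℂ × ℂ) ℂ) :
    FormalMultilinearSeries ℂ (ℂ × ℂ) ℂ := fun n => ∑ i, divTerm (P (n + 1)) i

theorem mul_divSeries (P : FormalMultilinearSeries ℂ (ℂ × ℂ) ℂ) (n : ℕ) (z : ℂ × ℂ) :
    z.1 * divSeries P n (fun _ => z) =
      P (n + 1) (fun _ => z) - P (n + 1) (fun _ => projSnd z) := by
  unfold divSeries
  rw [_root_.sum_apply, Finset.mul_sum]
  simp_rw [mul_divTerm]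
  rw [Fin.sum_univ_eq_sum_range (fun i => P (n + 1) (fun j => if (j : ℕ) < i then projSnd z else z) -
    P (n + 1) (fun j => if (j : ℕ) < i + 1 then projSnd z else z)), Finset.sum_range_sub']
  congr 2
  funext j
  simp [Nat.lt_succ_iff.1 j.isLt]

/-- The term of degree `n` is a sum of `n + 1` maps of norm at most `‖P (n + 1)‖`; the factor `n + 1
≤ 2 ^ n` is absorbed by halving the radius. -/
theorem divSeries_radius_pos {P : FormalMultilinearSeries ℂ (ℂ × ℂ) ℂ} (h : 0 < P.radius) :
    0 < (divSeries P).radius := by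
  obtain ⟨r, hr0, hr⟩ := ENNReal.lt_iff_exists_nnreal_btwn.1 h
  obtain ⟨C, hC0, hC⟩ := P.norm_mul_pow_le_of_lt_radius hr
  have hr0' : 0 < r := by exact_mod_cast hr0
  have hr1 : (0 : ℝ) < r := by exact_mod_cast hr0'
  refine lt_of_lt_of_le ?_ ((divSeries P).le_radius_of_bound (C / r) (r := r / 2) fun n => ?_)
  · exact_mod_cast half_pos hr0'
  have h1 : ‖divSeries P n‖ ≤ (n + 1) * ‖P (n + 1)‖ := by
    unfold divSeries
    refine (norm_sum_le _ _).trans ((Finset.sum_le_sum fun i _ => norm_divTerm_le _ i).trans ?_)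
    simp
  have h2 : ((n : ℝ) + 1) / 2 ^ n ≤ 1 := by
    rw [div_le_one (by positivity)]
    exact_mod_cast (Nat.lt_two_pow_self (n := n))
  have h3 := hC (n + 1)
  rw [le_div_iff₀ hr1]
  push_cast
  calc ‖divSeries P n‖ * ((r : ℝ) / 2) ^ n * r
      ≤ ((n + 1) * ‖P (n + 1)‖) * ((r : ℝ) / 2) ^ n * r := by gcongr
    _ = (((n : ℝ) + 1) / 2 ^ n) * (‖P (n + 1)‖ * r ^ (n + 1)) := by
        rw [div_pow, pow_succ]; ring
    _ ≤ 1 * (‖P (n + 1)‖ * r ^ (n + 1)) := by gcongr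
    _ ≤ C := by rw [one_mul]; exact h3

/-- Hadamard's lemma for analytic functions of two variables. -/
theorem AnalyticAt.exists_sub_eq_mul {f : ℂ × ℂ → ℂ} {a : ℂ × ℂ} (hf : AnalyticAt ℂ f a) :
    ∃ F : ℂ × ℂ → ℂ, AnalyticAt ℂ F a ∧ ∀ᶠ z in 𝓝 a, f z - f (a.1, z.2) = (z.1 - a.1) * F z := by
  obtain ⟨P, r, hP⟩ := hf
  have hQ := (divSeries P).hasFPowerSeriesOnBall (divSeries_radius_pos hP.radius_pos)
  refine ⟨fun z => (divSeries P).sum (z - a), ?_, ?_⟩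
  · have := hQ.hasFPowerSeriesAt.comp_sub a
    rw [zero_add] at this
    exact this.analyticAt
  have h0 : Tendsto (fun z => z - a) (𝓝 a) (𝓝 0) := by
    simpa using (continuous_sub_right a).tendsto a
  have hr := min_le_left r (divSeries P).radius
  have hr' := min_le_right r (divSeries P).radius
  have hpos : 0 < min r (divSeries P).radius := lt_min hP.r_pos hQ.r_pos
  filter_upwards [h0.eventually (Metric.eball_mem_nhds 0 hpos)] with z hz
  have hz1 : z - a ∈ Metric.eball 0 r := Metric.eball_subset_eball hr hz
  have hz2 : z - a ∈ Metric.eball 0 (divSeries P).radius := Metric.eball_subset_eball hr' hz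
  have hz3 : projSnd (z - a) ∈ Metric.eball 0 r := by
    rw [Metric.mem_eball, edist_zero_right] at hz1 ⊢
    refine lt_of_le_of_lt ?_ hz1
    rw [← ofReal_norm, ← ofReal_norm]
    refine ENNReal.ofReal_le_ofReal ?_
    exact (projSnd.le_opNorm _).trans (mul_le_of_le_one_left (norm_nonneg _) norm_projSnd_le)
  have s1 := (hasSum_nat_add_iff' 1).2 (hP.hasSum hz1)
  have s2 := (hasSum_nat_add_iff' 1).2 (hP.hasSum hz3)
  have s3 := (hQ.hasSum hz2).mul_left (z - a).1
  simp_rw [mul_divSeries] at s3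
  have s4 := s3.unique (s1.sub s2)
  rw [zero_add] at s4
  have e1 : a + (z - a) = z := by abel
  have e2 : a + projSnd (z - a) = (a.1, z.2) := by
    rw [projSnd_apply]; ext <;> simp
  rw [e1, e2] at s4
  have e3 : ∀ x y : ℂ × ℂ, P 0 (fun _ => x) = P 0 (fun _ => y) := fun x y => by
    congr 1; funext i; exact i.elim0
  simp only [Finset.range_one, Finset.sum_singleton] at s4
  rw [e3 (projSnd (z - a)) (z - a)] at s4
  rw [show (z.1 - a.1) = (z - a).1 from rfl, s4]
  ring

/-! ## Expansions in powers of the first coordinate -/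

theorem tendsto_mk_zero (c : ℂ) : Tendsto (fun u : ℂ => ((0 : ℂ), u)) (𝓝 c) (𝓝 (0, c)) :=
  (by fun_prop : Continuous fun u : ℂ => ((0 : ℂ), u)).tendsto c

theorem tendsto_mk_right (a u : ℂ) : Tendsto (fun x : ℂ => (x, u)) (𝓝 a) (𝓝 (a, u)) :=
  (by fun_prop : Continuous fun x : ℂ => (x, u)).tendsto a

theorem AnalyticAt.slice {f : ℂ × ℂ → ℂ} {u : ℂ} (hf : AnalyticAt ℂ f (0, u)) :
    AnalyticAt ℂ (fun x => f (x, u)) 0 :=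
  AnalyticAt.fun_comp (f := fun x => (x, u)) hf (by fun_prop)

theorem AnalyticAt.eventually_divisor {f : ℂ × ℂ → ℂ} {c : ℂ} (hf : AnalyticAt ℂ f (0, c)) :
    ∀ᶠ u in 𝓝 c, AnalyticAt ℂ f (0, u) :=
  (tendsto_mk_zero c).eventually hf.eventually_analyticAt

theorem xCoeff_zero (f : ℂ × ℂ → ℂ) (u : ℂ) : xCoeff 0 f u = f (0, u) := by
  simp [xCoeff, taylorCoeff_zero]

theorem xCoeff_succ_of_eventually {f F : ℂ × ℂ → ℂ} {u : ℂ} (hF : AnalyticAt ℂ F (0, u))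
    (h : ∀ᶠ z in 𝓝 (0, u), f z - f (0, z.2) = z.1 * F z) (k : ℕ) :
    xCoeff (k + 1) f u = xCoeff k F u := by
  have h1 : (fun x => f (x, u)) =ᶠ[𝓝 0] fun x => f (0, u) + x * F (x, u) := by
    filter_upwards [(tendsto_mk_right 0 u).eventually h] with x hx
    rw [← hx]; ring
  have h2 : taylorCoeff (k + 1) (fun _ : ℂ => f (0, u)) = 0 := by
    have := taylorCoeff_polynomial 1 (fun _ => f (0, u)) (k + 1)
    simpa using this
  unfold xCoeff
  rw [taylorCoeff_congr h1, taylorCoeff_add analyticAt_const (AnalyticAt.fun_mul (f := fun x => x) analyticAt_id hF.slice), h2,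
    zero_add]
  have := taylorCoeff_pow_mul hF.slice 1 (k + 1)
  simpa using this

/-- The Hadamard quotient by `x` shifts the coefficient functions by one, on all slices near `c` at
once. This is the induction step for analyticity of the coefficients and for Taylor expansions
uniform in `u`. -/
theorem AnalyticAt.exists_xCoeff_succ {f : ℂ × ℂ → ℂ} {c : ℂ} (hf : AnalyticAt ℂ f (0, c)) :
    ∃ F : ℂ × ℂ → ℂ, AnalyticAt ℂ F (0, c) ∧
      (∀ᶠ z in 𝓝 (0, c), f z = f (0, z.2) + z.1 * F z) ∧
      ∀ k, xCoeff (k + 1) f =ᶠ[𝓝 c] xCoeff k F := by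
  obtain ⟨F, hF, h⟩ := hf.exists_sub_eq_mul
  simp only [sub_zero] at h
  refine ⟨F, hF, ?_, fun k => ?_⟩
  · filter_upwards [h] with z hz
    rw [← hz]; ring
  · filter_upwards [hF.eventually_divisor, (tendsto_mk_zero c).eventually h.eventually_nhds]
      with u h1 h2
    exact xCoeff_succ_of_eventually h1 h2 k

theorem AnalyticAt.restrict_divisor {f : ℂ × ℂ → ℂ} {c : ℂ} (hf : AnalyticAt ℂ f (0, c)) :
    AnalyticAt ℂ (fun u => f (0, u)) c :=
  AnalyticAt.fun_comp (f := fun u => (0, u)) hf (by fun_prop)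

theorem analyticAt_xCoeff {f : ℂ × ℂ → ℂ} {c : ℂ} (hf : AnalyticAt ℂ f (0, c)) (k : ℕ) :
    AnalyticAt ℂ (xCoeff k f) c := by
  induction k generalizing f with
  | zero =>
    rw [show xCoeff 0 f = fun u => f (0, u) from funext fun u => xCoeff_zero f u]
    exact hf.restrict_divisor
  | succ k ih =>
    obtain ⟨F, hF, -, h⟩ := hf.exists_xCoeff_succ
    exact (ih hF).congr (h k).symm

/-- Taylor's formula in the first coordinate, locally uniformly in the second one. -/
theorem AnalyticAt.exists_expansion {f : ℂ × ℂ → ℂ} {c : ℂ} (hf : AnalyticAt ℂ f (0, c)) (n : ℕ) :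
    ∃ F : ℂ × ℂ → ℂ, AnalyticAt ℂ F (0, c) ∧
      (∀ᶠ z in 𝓝 (0, c),
        f z = ∑ j ∈ Finset.range n, xCoeff j f z.2 * z.1 ^ j + z.1 ^ n * F z) ∧
      ∀ᶠ u in 𝓝 c, xCoeff n f u = F (0, u) := by
  induction n generalizing f with
  | zero => exact ⟨f, hf, by simp, Eventually.of_forall fun u => xCoeff_zero f u⟩
  | succ n ih =>
    obtain ⟨F, hF, h1, h2⟩ := hf.exists_xCoeff_succ
    obtain ⟨G, hG, h3, h4⟩ := ih hF
    refine ⟨G, hG, ?_, ?_⟩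
    · have h5 : ∀ᶠ z : ℂ × ℂ in 𝓝 (0, c), ∀ j ∈ Finset.range n,
          xCoeff (j + 1) f z.2 = xCoeff j F z.2 := by
        rw [Filter.eventually_all_finset]
        exact fun j _ => (continuous_snd.tendsto ((0 : ℂ), c)).eventually (h2 j)
      filter_upwards [h1, h3, h5] with z e1 e2 e3
      have e4 : ∑ j ∈ Finset.range n, xCoeff (j + 1) f z.2 * z.1 ^ (j + 1) =
          z.1 * ∑ j ∈ Finset.range n, xCoeff j F z.2 * z.1 ^ j := by
        rw [Finset.mul_sum]
        exact Finset.sum_congr rfl fun j hj => by rw [e3 j hj]; ring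
      rw [e1, e2, Finset.sum_range_succ', xCoeff_zero, e4]
      ring
    · filter_upwards [h2 n, h4] with u e1 e2
      rw [e1, e2]

theorem AnalyticAt.isBigO_expansion {f : ℂ × ℂ → ℂ} {c : ℂ} (hf : AnalyticAt ℂ f (0, c)) (n : ℕ) :
    (fun z : ℂ × ℂ => f z - ∑ j ∈ Finset.range n, xCoeff j f z.2 * z.1 ^ j)
      =O[𝓝 (0, c)] fun z => z.1 ^ n := by
  obtain ⟨F, hF, h, -⟩ := hf.exists_expansion n
  have h1 : (fun z : ℂ × ℂ => z.1 ^ n * F z) =O[𝓝 (0, c)] fun z => z.1 ^ n * (1 : ℂ) :=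
    (Asymptotics.isBigO_refl _ _).mul (hF.continuousAt.isBigO_one ℂ)
  simp only [mul_one] at h1
  refine h1.congr' ?_ EventuallyEq.rfl
  filter_upwards [h] with z hz
  rw [hz]; ring

theorem AnalyticAt.exists_eq_pow_mul {f : ℂ × ℂ → ℂ} {c : ℂ} (hf : AnalyticAt ℂ f (0, c)) {n : ℕ}
    (h : ∀ j < n, ∀ᶠ u in 𝓝 c, xCoeff j f u = 0) :
    ∃ F : ℂ × ℂ → ℂ, AnalyticAt ℂ F (0, c) ∧ (∀ᶠ z in 𝓝 (0, c), f z = z.1 ^ n * F z) ∧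
      ∀ᶠ u in 𝓝 c, xCoeff n f u = F (0, u) := by
  obtain ⟨F, hF, h1, h2⟩ := hf.exists_expansion n
  refine ⟨F, hF, ?_, h2⟩
  have h3 : ∀ᶠ z : ℂ × ℂ in 𝓝 (0, c), ∀ j ∈ Finset.range n, xCoeff j f z.2 = 0 := by
    rw [Filter.eventually_all_finset]
    exact fun j hj => (continuous_snd.tendsto ((0 : ℂ), c)).eventually (h j (Finset.mem_range.1 hj))
  filter_upwards [h1, h3] with z e1 e2
  rw [e1, Finset.sum_eq_zero fun j hj => by rw [e2 j hj, zero_mul], zero_add]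

/-! ## Homogeneous parts -/

/-- Along the line `t ↦ t z` the power series becomes one in a single variable, whose coefficients
are unique. -/
theorem homPart_eq_of_hasFPowerSeriesAt {f : ℂ × ℂ → ℂ} {P : FormalMultilinearSeries ℂ (ℂ × ℂ) ℂ}
    (h : HasFPowerSeriesAt f P 0) (k : ℕ) (z : ℂ × ℂ) : homPart k f z = P k fun _ => z := by
  set L : ℂ →L[ℂ] ℂ × ℂ := (ContinuousLinearMap.id ℂ ℂ).smulRight z with hL
  have h1 : HasFPowerSeriesAt (f ∘ L) (P.compContinuousLinearMap L) 0 :=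
    HasFPowerSeriesAt.compContinuousLinearMap (by simpa using h)
  have h2 := h1.analyticAt.hasFPowerSeriesAt
  have h3 := h1.eq_formalMultilinearSeries h2
  have h4 := congrArg (fun Q : FormalMultilinearSeries ℂ ℂ ℂ => Q k fun _ => (1 : ℂ)) h3
  simp only [FormalMultilinearSeries.compContinuousLinearMap_apply,
    FormalMultilinearSeries.ofScalars_apply_eq, one_pow, smul_eq_mul, mul_one] at h4
  have h5 : (⇑L ∘ fun _ : Fin k => (1 : ℂ)) = fun _ => z := by
    funext i; simp [hL]
  rw [h5] at h4
  rw [h4]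
  unfold homPart taylorCoeff
  congr 2

theorem homPart_smul {f : ℂ × ℂ → ℂ} (hf : AnalyticAt ℂ f 0) (k : ℕ) (c : ℂ) (z : ℂ × ℂ) :
    homPart k f (c • z) = c ^ k * homPart k f z := by
  obtain ⟨P, hP⟩ := hf
  rw [homPart_eq_of_hasFPowerSeriesAt hP, homPart_eq_of_hasFPowerSeriesAt hP]
  have := (P k).map_smul_univ (fun _ => c) fun _ => z
  simpa using this

theorem continuous_homPart {f : ℂ × ℂ → ℂ} (hf : AnalyticAt ℂ f 0) (k : ℕ) :
    Continuous (homPart k f) := by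
  obtain ⟨P, hP⟩ := hf
  rw [show homPart k f = fun z => P k fun _ => z from
    funext fun z => homPart_eq_of_hasFPowerSeriesAt hP k z]
  fun_prop

theorem isBigO_sub_homPart {f : ℂ × ℂ → ℂ} (hf : AnalyticAt ℂ f 0) (n : ℕ) :
    (fun z => f z - ∑ j ∈ Finset.range n, homPart j f z) =O[𝓝 0] fun z => ‖z‖ ^ n := by
  obtain ⟨P, hP⟩ := hf
  have := hP.isBigO_sub_partialSum_pow n
  simp only [zero_add] at this
  refine this.congr_left fun z => ?_
  simp only [FormalMultilinearSeries.partialSum, homPart_eq_of_hasFPowerSeriesAt hP]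

theorem analyticAt_comp_smul {f : ℂ × ℂ → ℂ} (hf : AnalyticAt ℂ f 0) (z : ℂ × ℂ) :
    AnalyticAt ℂ (fun t : ℂ => f (t * z.1, t * z.2)) 0 :=
  AnalyticAt.fun_comp (f := fun t : ℂ => (t * z.1, t * z.2))
    (by simpa [Prod.zero_eq_mk] using hf) (by fun_prop)

theorem tendsto_smul_zero (z : ℂ × ℂ) :
    Tendsto (fun t : ℂ => (t * z.1, t * z.2)) (𝓝 0) (𝓝 0) := by
  have : Continuous fun t : ℂ => (t * z.1, t * z.2) := by fun_prop
  simpa [Prod.zero_eq_mk] using this.tendsto 0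

/-! ## Entire functions -/

/-- Liouville's theorem is the case `d = 0`. For the step, `dslope f 0`, that is `(f u - f 0) / u`,
is entire and its growth exponent is smaller by one. -/
theorem exists_polynomial_of_bound (d : ℕ) {f : ℂ → ℂ} (hf : Differentiable ℂ f)
    (hb : ∃ C, ∀ᶠ u in Bornology.cobounded ℂ, ‖f u‖ ≤ C * ‖u‖ ^ d) :
    ∃ P : Polynomial ℂ, P.natDegree ≤ d ∧ ∀ u, f u = P.eval u := by
  induction d generalizing f with
  | zero =>
    obtain ⟨C, hC⟩ := hb
    have hbd : Bornology.IsBounded (Set.range f) := by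
      obtain ⟨K, hK, hK'⟩ := Filter.mem_cocompact.1 (Metric.cobounded_eq_cocompact (α := ℂ) ▸ hC)
      obtain ⟨B, hB⟩ := (hK.image hf.continuous).isBounded.exists_norm_le
      refine isBounded_iff_forall_norm_le.2 ⟨max B C, ?_⟩
      rintro _ ⟨u, rfl⟩
      by_cases hu : u ∈ K
      · exact (hB _ ⟨u, hu, rfl⟩).trans (le_max_left _ _)
      · have := hK' hu
        simp only [Set.mem_ofPred_eq, pow_zero, mul_one] at this
        exact this.trans (le_max_right _ _)
    exact ⟨Polynomial.C (f 0), by simp, fun u => by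
      rw [Polynomial.eval_C]; exact hf.apply_eq_apply_of_bounded hbd u 0⟩
  | succ d ih =>
    obtain ⟨C, hC⟩ := hb
    have hg : Differentiable ℂ (dslope f 0) := by
      rw [← differentiableOn_univ] at hf ⊢
      exact (Complex.differentiableOn_dslope univ_mem).2 hf
    obtain ⟨P, hP, hPf⟩ := ih hg ⟨C + ‖f 0‖, by
      have h1 : ∀ᶠ u : ℂ in Bornology.cobounded ℂ, 1 ≤ ‖u‖ :=
        (tendsto_norm_cobounded_atTop (E := ℂ)).eventually (eventually_ge_atTop 1)
      filter_upwards [hC, h1] with u h1 h2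
      have hu : u ≠ 0 := norm_pos_iff.1 (by linarith)
      rw [dslope_of_ne _ hu, slope_def_field, sub_zero, norm_div, div_le_iff₀ (by linarith)]
      have h3 : (1 : ℝ) ≤ ‖u‖ ^ (d + 1) := one_le_pow₀ h2
      calc ‖f u - f 0‖ ≤ ‖f u‖ + ‖f 0‖ := norm_sub_le _ _
        _ ≤ C * ‖u‖ ^ (d + 1) + ‖f 0‖ * ‖u‖ ^ (d + 1) := by
            gcongr
            exact le_mul_of_one_le_right (norm_nonneg _) h3
        _ = (C + ‖f 0‖) * ‖u‖ ^ d * ‖u‖ := by ring⟩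
    refine ⟨Polynomial.C (f 0) + Polynomial.X * P, ?_, fun u => ?_⟩
    · refine (Polynomial.natDegree_add_le _ _).trans (max_le (by simp) ?_)
      refine Polynomial.natDegree_mul_le.trans ?_
      rw [Polynomial.natDegree_X]
      omega
    · have := sub_smul_dslope f 0 u
      simp only [sub_zero, smul_eq_mul] at this
      simp only [Polynomial.eval_add, Polynomial.eval_C, Polynomial.eval_mul, Polynomial.eval_X,
        ← hPf, this]
      ring

theorem exists_polynomial_of_bound_at_infinity (d : ℕ) {f : ℂ → ℂ} (hf : Differentiable ℂ f)
    (hb : ∃ C, ∀ᶠ t in 𝓝[≠] (0 : ℂ), ‖t ^ d * f t⁻¹‖ ≤ C) :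
    ∃ P : Polynomial ℂ, P.natDegree ≤ d ∧ ∀ u, f u = P.eval u := by
  obtain ⟨C, hC⟩ := hb
  refine exists_polynomial_of_bound d hf ⟨C, ?_⟩
  have h1 : ∀ᶠ u : ℂ in Bornology.cobounded ℂ, 1 ≤ ‖u‖ :=
    (tendsto_norm_cobounded_atTop (E := ℂ)).eventually (eventually_ge_atTop 1)
  filter_upwards [tendsto_inv₀_cobounded'.eventually hC, h1] with u h h1
  rw [inv_inv, norm_mul, norm_pow, norm_inv, inv_pow, inv_mul_le_iff₀ (by positivity)] at h
  linarith

/-- Removal of finitely many singularities. -/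
theorem exists_differentiable_of_removable {S : Set ℂ} (hS : S.Finite) {f : ℂ → ℂ}
    (hf : ∀ u ∉ S, AnalyticAt ℂ f u)
    (hr : ∀ c ∈ S, ∃ g : ℂ → ℂ, AnalyticAt ℂ g c ∧ f =ᶠ[𝓝[≠] c] g) :
    ∃ F : ℂ → ℂ, Differentiable ℂ F ∧ ∀ u ∉ S, F u = f u := by
  classical
  choose! g hg hfg using hr
  refine ⟨fun u => if u ∈ S then g u u else f u, fun c => ?_, fun u hu => if_neg hu⟩
  have hc : ∀ᶠ u in 𝓝[≠] c, u ∉ S := by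
    have h1 : (S \ {c})ᶜ ∈ 𝓝 c := (hS.subset Set.sdiff_subset).isClosed.isOpen_compl.mem_nhds
      (by simp)
    filter_upwards [mem_nhdsWithin_of_mem_nhds h1, self_mem_nhdsWithin] with u h1 h2 h3
    exact h1 ⟨h3, h2⟩
  by_cases hcS : c ∈ S
  · refine ((hg c hcS).congr ?_).differentiableAt
    have h1 : ∀ᶠ u in 𝓝[≠] c, g c u = if u ∈ S then g u u else f u := by
      filter_upwards [hc, hfg c hcS] with u h1 h2
      rw [if_neg h1, h2]
    filter_upwards [eventually_nhdsWithin_iff.1 h1] with u hu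
    by_cases huc : u = c
    · subst huc; exact (if_pos hcS).symm
    · exact hu huc
  · refine ((hf c hcS).congr ?_).differentiableAt
    filter_upwards [hS.isClosed.isOpen_compl.mem_nhds hcS] with u hu
    exact (if_neg hu).symm

/-! ## Families of power series with meromorphic coefficients -/

/-- The Taylor coefficients at `0` of the functions `F u` are meromorphic in `u` at `c`. -/
def MeroFamily (c : ℂ) (F : ℂ → ℂ → ℂ) : Prop :=
  (∀ᶠ u in 𝓝[≠] c, AnalyticAt ℂ (F u) 0) ∧ ∀ k, MeromorphicAt (fun u => taylorCoeff k (F u)) c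

theorem taylorCoeff_const (a : ℂ) (k : ℕ) :
    taylorCoeff k (fun _ => a) = if k = 0 then a else 0 := by
  have := taylorCoeff_polynomial 1 (fun _ => a) k
  simpa using this

/-- The Taylor coefficients of a composition. -/
theorem taylorCoeff_comp {G φ : ℂ → ℂ} (hφ : AnalyticAt ℂ φ 0) (hG : AnalyticAt ℂ G (φ 0)) (k : ℕ) :
    taylorCoeff k (fun x => G (φ x)) = ∑ j ∈ Finset.range (k + 1),
      iteratedDeriv j G (φ 0) / (j.factorial : ℂ) * taylorCoeff k fun x => (φ x - φ 0) ^ j := by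
  have hs : AnalyticAt ℂ (fun t => G (φ 0 + t)) 0 :=
    AnalyticAt.fun_comp (f := fun t => φ 0 + t) (by simpa using hG) (by fun_prop)
  have hc : ∀ j, taylorCoeff j (fun t => G (φ 0 + t)) = iteratedDeriv j G (φ 0) / (j.factorial : ℂ) := by
    intro j
    unfold taylorCoeff
    simp only [iteratedDeriv_comp_const_add, add_zero]
  have h0 : (fun x => φ x - φ 0) =O[𝓝 0] fun x => x := by
    simpa using hφ.differentiableAt.isBigO_sub
  have ht : Tendsto (fun x => φ x - φ 0) (𝓝 0) (𝓝 0) := by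
    simpa using hφ.continuousAt.tendsto.sub_const (φ 0)
  have h1 := ((isBigO_sub_taylor hs (k + 1)).comp_tendsto ht).trans
    (h0.pow (k + 1) : (fun x => (φ x - φ 0) ^ (k + 1)) =O[𝓝 0] fun x => x ^ (k + 1))
  have hp : ∀ j ∈ Finset.range (k + 1), AnalyticAt ℂ (fun x =>
      iteratedDeriv j G (φ 0) / (j.factorial : ℂ) * (φ x - φ 0) ^ j) 0 := fun j _ => by fun_prop
  rw [taylorCoeff_eq_of_isBigO (n := k + 1) (g := fun x => ∑ j ∈ Finset.range (k + 1),
      iteratedDeriv j G (φ 0) / (j.factorial : ℂ) * (φ x - φ 0) ^ j)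
    (AnalyticAt.fun_comp hG hφ) (Finset.analyticAt_fun_sum _ hp) ?_ (Nat.lt_succ_self k),
    taylorCoeff_sum _ hp]
  · simp only [taylorCoeff_const_mul]
  · refine h1.congr_left fun x => ?_
    simp only [Function.comp, hc, add_sub_cancel]

namespace MeroFamily

variable {c : ℂ} {F G : ℂ → ℂ → ℂ}

theorem const {a : ℂ → ℂ} (ha : MeromorphicAt a c) : MeroFamily c fun u _ => a u := by
  refine ⟨Eventually.of_forall fun u => analyticAt_const, fun k => ?_⟩
  simp only [taylorCoeff_const]
  split_ifs
  · exact ha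
  · exact MeromorphicAt.const 0 c

theorem fixed {s : ℂ → ℂ} (hs : AnalyticAt ℂ s 0) : MeroFamily c fun _ => s :=
  ⟨Eventually.of_forall fun _ => hs, fun _ => MeromorphicAt.const _ c⟩

theorem add (hF : MeroFamily c F) (hG : MeroFamily c G) : MeroFamily c fun u x => F u x + G u x := by
  refine ⟨?_, fun k => ((hF.2 k).add (hG.2 k)).congr ?_⟩
  · filter_upwards [hF.1, hG.1] with u h1 h2 using h1.add h2
  · filter_upwards [hF.1, hG.1] with u h1 h2 using (taylorCoeff_add h1 h2 k).symm

theorem mul (hF : MeroFamily c F) (hG : MeroFamily c G) : MeroFamily c fun u x => F u x * G u x := by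
  refine ⟨?_, fun k => ?_⟩
  · filter_upwards [hF.1, hG.1] with u h1 h2 using h1.mul h2
  · refine (MeromorphicAt.fun_sum (s := Finset.range (k + 1))
      fun i _ => (hF.2 i).fun_mul (hG.2 (k - i))).congr ?_
    filter_upwards [hF.1, hG.1] with u h1 h2 using (taylorCoeff_mul h1 h2 k).symm

theorem sum {ι : Type*} (s : Finset ι) {F : ι → ℂ → ℂ → ℂ} (hF : ∀ i ∈ s, MeroFamily c (F i)) :
    MeroFamily c fun u x => ∑ i ∈ s, F i u x := by
  classical
  induction s using Finset.induction_on with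
  | empty => simpa using const (c := c) (MeromorphicAt.const 0 c)
  | insert a s ha ih =>
    simp only [Finset.sum_insert ha]
    exact (hF a (Finset.mem_insert_self _ _)).add
      (ih fun i hi => hF i (Finset.mem_insert_of_mem hi))

theorem pow (hF : MeroFamily c F) (n : ℕ) : MeroFamily c fun u x => F u x ^ n := by
  induction n with
  | zero => simpa using const (c := c) (MeromorphicAt.const 1 c)
  | succ n ih => simpa only [pow_succ] using ih.mul hF

theorem value (hF : MeroFamily c F) : MeromorphicAt (fun u => F u 0) c := by
  simpa only [taylorCoeff_zero] using hF.2 0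

/-- The coefficients of `g (F u x)` are finite sums of derivatives of `g` at `F u 0` times
coefficients of powers of `F u x - F u 0`, so meromorphy of these derivatives in `u` suffices. -/
theorem comp {g : ℂ → ℂ} (hF : MeroFamily c F) (hg : ∀ᶠ u in 𝓝[≠] c, AnalyticAt ℂ g (F u 0))
    (hg' : ∀ j, MeromorphicAt (fun u => iteratedDeriv j g (F u 0)) c) :
    MeroFamily c fun u x => g (F u x) := by
  refine ⟨?_, fun k => ?_⟩
  · filter_upwards [hF.1, hg] with u h1 h2 using AnalyticAt.fun_comp h2 h1
  · have h : ∀ j, MeroFamily c fun u x => (F u x + (-1) * F u 0) ^ j := fun j =>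
      (hF.add ((const (MeromorphicAt.const (-1) c)).mul (const hF.value))).pow j
    refine (MeromorphicAt.fun_sum (s := Finset.range (k + 1)) fun j _ =>
      ((hg' j).fun_div (MeromorphicAt.const (j.factorial : ℂ) c)).fun_mul ((h j).2 k)).congr ?_
    filter_upwards [hF.1, hg] with u h1 h2
    rw [taylorCoeff_comp h1 h2 k]
    simp only [neg_mul, one_mul, sub_eq_add_neg]

/-- Composition with a function which is meromorphic at `c`, for a family with `F u 0 = u`. -/
theorem comp_of_value {g : ℂ → ℂ} (hF : MeroFamily c F) (hF0 : ∀ u, F u 0 = u)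
    (hg : MeromorphicAt g c) : MeroFamily c fun u x => g (F u x) := by
  refine hF.comp ?_ fun j => ?_
  · simpa only [hF0] using hg.eventually_analyticAt
  · simp only [hF0, iteratedDeriv_eq_iterate]
    exact hg.iterated_deriv

end MeroFamily

/-- All operations in the functional preserve families with meromorphic coefficients. The only
non-algebraic one that is not a composition with the data is the power with exponent `lam`; its base
is `1` at `x = 0` for every `u`, so its derivatives there are constants. -/
theorem meromorphicAt_functionalP {k : ℕ} {lam c : ℂ} {s : ℕ → ℂ} {ε A : ℕ → ℂ → ℂ}
    (hε : ∀ l, MeromorphicAt (ε l) c) (hA : ∀ r, MeromorphicAt (A r) c) :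
    MeromorphicAt (functionalP k lam c s ε A) c := by
  set S : ℂ → ℂ := fun t => ∑ r ∈ Finset.Icc 1 k, s r * t ^ r with hS
  have hS0 : S 0 = 0 := by
    refine Finset.sum_eq_zero fun r hr => ?_
    rw [zero_pow (by have := (Finset.mem_Icc.1 hr).1; omega), mul_zero]
  have hSf : MeroFamily c fun _ => S :=
    MeroFamily.fixed (Finset.analyticAt_fun_sum _ fun r _ => by fun_prop)
  have hx : MeroFamily c fun _ x => x := MeroFamily.fixed analyticAt_id
  have hinv : MeromorphicAt (fun u => (u - c)⁻¹) c :=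
    ((analyticAt_id.sub analyticAt_const).meromorphicAt).inv
  have hbase : MeroFamily c fun u x => 1 + S x * (u - c)⁻¹ :=
    (MeroFamily.const (MeromorphicAt.const 1 c)).add (hSf.mul (MeroFamily.const hinv))
  have hpow : MeroFamily c fun u x => (1 + S x * (u - c)⁻¹) ^ lam := by
    refine hbase.comp (g := fun t => t ^ lam) ?_ fun j => ?_
    · simp only [hS0, zero_mul, add_zero]
      exact Eventually.of_forall fun _ =>
        analyticAt_id.cpow analyticAt_const Complex.one_mem_slitPlane
    · simp only [hS0, zero_mul, add_zero]
      exact MeromorphicAt.const _ c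
  have hy1 := hx.mul hpow
  have hy2 : MeroFamily c fun u x => u + S x := (MeroFamily.const (MeromorphicAt.id c)).add hSf
  have hv : ∀ u, u + S 0 = u := fun u => by rw [hS0, add_zero]
  have := MeroFamily.sum (Finset.Icc 1 k) fun r _ =>
    (hy2.comp_of_value hv (hA r)).mul ((MeroFamily.sum (Finset.Icc 1 k) fun l _ =>
      (hy2.comp_of_value hv (hε l)).mul (hy1.pow l)).pow r)
  exact this.2 (k + 1)

theorem phiCoeff_zero (g : ℂ → ℂ) (z : ℕ → ℂ) (u : ℂ) : phiCoeff g z u 0 = u := by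
  rw [phiCoeff]

theorem phiCoeff_succ (g : ℂ → ℂ) (z : ℕ → ℂ) (u : ℂ) (k : ℕ) :
    phiCoeff g z u (k + 1) = (z (k + 1) - taylorCoeff (k + 1) fun x =>
      g (∑ l ∈ Finset.range (k + 1), phiCoeff g z u l * x ^ l)) / deriv g u := by
  rw [phiCoeff]
  simp only [Finset.sum_range]

theorem sum_phiCoeff_zero (g : ℂ → ℂ) (z : ℕ → ℂ) (k : ℕ) (u : ℂ) :
    ∑ l ∈ Finset.range (k + 1), phiCoeff g z u l * (0 : ℂ) ^ l = u := by
  rw [Finset.sum_range_succ']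
  simp [phiCoeff_zero]

theorem meroFamily_sum_phiCoeff {g : ℂ → ℂ} {z : ℕ → ℂ} {c : ℂ} {k : ℕ}
    (h : ∀ l < k + 1, MeromorphicAt (fun u => phiCoeff g z u l) c) :
    MeroFamily c fun u x => ∑ l ∈ Finset.range (k + 1), phiCoeff g z u l * x ^ l :=
  MeroFamily.sum _ fun l hl => (MeroFamily.const (h l (Finset.mem_range.1 hl))).mul
    (MeroFamily.fixed (by fun_prop))

/-- The recursion composes `g` with a polynomial formed from the preceding coefficients and divides
by `deriv g u`; both operations preserve meromorphy. -/
theorem meromorphicAt_phiCoeff {g : ℂ → ℂ} {z : ℕ → ℂ} {c : ℂ} (hg : MeromorphicAt g c) (k : ℕ) :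
    MeromorphicAt (fun u => phiCoeff g z u k) c := by
  induction k using Nat.strong_induction_on with
  | _ k ih =>
    cases k with
    | zero =>
      simp only [phiCoeff_zero]
      exact MeromorphicAt.id c
    | succ k =>
      simp only [phiCoeff_succ]
      exact ((MeromorphicAt.const _ c).fun_sub (((meroFamily_sum_phiCoeff ih).comp_of_value
        (fun u => sum_phiCoeff_zero g z k u) hg).2 (k + 1))).fun_div hg.deriv

theorem meromorphicAt_functionalAQ {k : ℕ} {g : ℂ → ℂ} {c : ℂ} {z : ℕ → ℂ} {ς A : ℕ → ℂ → ℂ}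
    (hg : MeromorphicAt g c) (hς : ∀ l, MeromorphicAt (ς l) c) (hA : ∀ r, MeromorphicAt (A r) c) :
    MeromorphicAt (functionalAQ k g z ς A) c := by
  have hy := meroFamily_sum_phiCoeff (z := z) (k := k) fun l _ =>
    meromorphicAt_phiCoeff (z := z) hg l
  have hv := fun u => sum_phiCoeff_zero g z k u
  have := MeroFamily.sum (Finset.Icc 1 k) fun r _ =>
    (hy.comp_of_value hv (hA r)).mul ((MeroFamily.sum (Finset.Icc 1 k) fun l _ =>
      (hy.comp_of_value hv (hς l)).mul
        (MeroFamily.fixed (s := fun x => x ^ l) (by fun_prop))).pow r)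
  exact this.2 (k + 1)

theorem meromorphicAt_functionalBQ {k : ℕ} {g : ℂ → ℂ} {c : ℂ} {z : ℕ → ℂ} {ς B : ℕ → ℂ → ℂ}
    (hg : MeromorphicAt g c) (hς : ∀ l, MeromorphicAt (ς l) c) (hB : ∀ r, MeromorphicAt (B r) c) :
    MeromorphicAt (functionalBQ k g z ς B) c :=
  ((meromorphicAt_phiCoeff hg (k + 1)).fun_sub
    ((MeromorphicAt.const _ c).fun_div hg.deriv)).fun_add (meromorphicAt_functionalAQ hg hς hB)

/-- Only the indices `1 ≤ r ≤ k` are read. This allows the truncated sequences in the recursive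
definitions to be replaced by the full sequences `aN` and `bN`. -/
theorem functionalP_congr {k : ℕ} {lam c : ℂ} {s : ℕ → ℂ} {ε A A' : ℕ → ℂ → ℂ}
    (h : ∀ r ∈ Finset.Icc 1 k, A r = A' r) :
    functionalP k lam c s ε A = functionalP k lam c s ε A' := by
  funext u
  unfold functionalP
  congr 1
  funext x
  exact Finset.sum_congr rfl fun r hr => by rw [h r hr]

theorem functionalAQ_congr {k : ℕ} {g : ℂ → ℂ} {z : ℕ → ℂ} {ς A A' : ℕ → ℂ → ℂ}
    (h : ∀ r ∈ Finset.Icc 1 k, A r = A' r) :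
    functionalAQ k g z ς A = functionalAQ k g z ς A' := by
  funext u
  unfold functionalAQ
  congr 1
  funext x
  exact Finset.sum_congr rfl fun r hr => by rw [h r hr]

theorem functionalBQ_congr {k : ℕ} {g : ℂ → ℂ} {z : ℕ → ℂ} {ς A A' : ℕ → ℂ → ℂ}
    (h : ∀ r ∈ Finset.Icc 1 k, A r = A' r) :
    functionalBQ k g z ς A = functionalBQ k g z ς A' := by
  funext u
  unfold functionalBQ
  rw [functionalAQ_congr h]

/-! ## Principal parts -/

/-- After multiplication by `(u - c) ^ N` the function is analytic (up to its value at `c`). Its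
Taylor polynomial of degree `< N`, divided by `(u - c) ^ N`, has only negative powers, and the
remainder is divisible by `(u - c) ^ N`. -/
theorem exists_isPrincipalPart {f : ℂ → ℂ} {c : ℂ} (hf : MeromorphicAt f c) :
    ∃ P, IsPrincipalPart f c P := by
  obtain ⟨N, hN⟩ := hf
  set h : ℂ → ℂ := fun t => (c + t - c) ^ N • f (c + t) with hh
  have hh0 : AnalyticAt ℂ h 0 :=
    AnalyticAt.fun_comp (f := fun t => c + t) (g := fun z => (z - c) ^ N • f z)
      (by simpa using hN) (by fun_prop)
  obtain ⟨r, hr, hhr⟩ := exists_eq_pow_mul_of_isBigO (hh0.fun_sub (by fun_prop))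
    ((isBigO_sub_taylor hh0 N).mono nhdsWithin_le_nhds)
  refine ⟨∑ j ∈ Finset.range N, Polynomial.C (taylorCoeff j h) * Polynomial.X ^ (N - j), ?_,
    fun u => r (u - c), ?_, ?_⟩
  · rw [Polynomial.finsetSum_coeff]
    refine Finset.sum_eq_zero fun j hj => ?_
    have := Finset.mem_range.1 hj
    rw [Polynomial.coeff_C_mul, Polynomial.coeff_X_pow, if_neg (by omega), mul_zero]
  · exact AnalyticAt.fun_comp (f := fun u => u - c) (by simpa using hr) (by fun_prop)
  · have ht : Tendsto (fun u => u - c) (𝓝 c) (𝓝 0) := by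
      simpa using (continuous_sub_right c).tendsto c
    filter_upwards [nhdsWithin_le_nhds (ht.eventually hhr), self_mem_nhdsWithin] with u h1 h2
    have hu : u - c ≠ 0 := sub_ne_zero.2 h2
    have hu' : (u - c) ^ N ≠ 0 := pow_ne_zero _ hu
    have h3 : h (u - c) = (u - c) ^ N * f u := by simp [hh]
    rw [h3] at h1
    rw [Polynomial.eval_finsetSum]
    apply mul_left_cancel₀ hu'
    rw [mul_add, ← h1, Finset.mul_sum, ← sub_eq_iff_eq_add']
    congr 1
    refine Finset.sum_congr rfl fun j hj => ?_
    have hj := (Finset.mem_range.1 hj).le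
    rw [Polynomial.eval_mul, Polynomial.eval_C, Polynomial.eval_pow, Polynomial.eval_X, inv_pow]
    have e : (u - c) ^ N = (u - c) ^ (N - j) * (u - c) ^ j := by
      rw [← pow_add, Nat.sub_add_cancel hj]
    rw [e]
    field_simp

/-- Both branches of the definition have this shape, so the behaviour away from `c` and at infinity
is known without assuming meromorphy. -/
theorem principalPart_eq_eval (f : ℂ → ℂ) (c : ℂ) :
    ∃ P : Polynomial ℂ, P.coeff 0 = 0 ∧ ∀ u, principalPart f c u = P.eval ((u - c)⁻¹) := by
  classical
  by_cases h : ∃ P, IsPrincipalPart f c P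
  · exact ⟨Classical.choose h, (Classical.choose_spec h).1, fun u => by
      unfold principalPart; rw [dif_pos h]⟩
  · exact ⟨0, by simp, fun u => by unfold principalPart; rw [dif_neg h]; simp⟩

theorem sub_principalPart {f : ℂ → ℂ} {c : ℂ} (hf : MeromorphicAt f c) :
    ∃ r, AnalyticAt ℂ r c ∧ ∀ᶠ u in 𝓝[≠] c, f u = principalPart f c u + r u := by
  classical
  have h := exists_isPrincipalPart hf
  obtain ⟨r, hr, h1⟩ := (Classical.choose_spec h).2
  refine ⟨r, hr, ?_⟩
  filter_upwards [h1] with u hu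
  unfold principalPart
  rw [dif_pos h, hu]

theorem AnalyticAt.polynomial_eval {f : ℂ → ℂ} {c : ℂ} (hf : AnalyticAt ℂ f c) (P : Polynomial ℂ) :
    AnalyticAt ℂ (fun u => P.eval (f u)) c := by
  simpa [Polynomial.aeval_def, Polynomial.eval₂_eq_eval_map] using hf.aeval_polynomial P

/-- Analytic off `S`, meromorphic on `ℂ` and vanishing at infinity. -/
structure IsPrincipalSum (f : ℂ → ℂ) (S : Set ℂ) : Prop where
  analytic : ∀ u ∉ S, AnalyticAt ℂ f u
  mero : ∀ u, MeromorphicAt f u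
  infinity : ∃ G : ℂ → ℂ, AnalyticAt ℂ G 0 ∧ G 0 = 0 ∧ ∀ᶠ t in 𝓝[≠] (0 : ℂ), f t⁻¹ = G t

/-- With `t = 1 / u` one has `1 / (u - c) = t / (1 - c t)`, which is analytic and zero at `t = 0`;
the polynomial in it vanishes there too, having no constant term. -/
theorem isPrincipalSum_principalPart (f : ℂ → ℂ) {c : ℂ} {S : Set ℂ} (hc : c ∈ S) :
    IsPrincipalSum (principalPart f c) S := by
  obtain ⟨P, hP0, hP⟩ := principalPart_eq_eval f c
  rw [show principalPart f c = fun u => P.eval ((u - c)⁻¹) from funext hP]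
  refine ⟨fun u hu => ?_, fun u => ?_, fun t => P.eval (t * (1 - c * t)⁻¹), ?_, ?_, ?_⟩
  · have : u - c ≠ 0 := sub_ne_zero.2 fun h => hu (h ▸ hc)
    exact ((analyticAt_id.sub analyticAt_const).inv this).polynomial_eval P
  · have : MeromorphicAt (fun u => (u - c)⁻¹) u :=
      ((analyticAt_id.sub analyticAt_const).meromorphicAt).inv
    simp only [Polynomial.eval_eq_sum_range]
    exact MeromorphicAt.fun_sum fun i _ => (MeromorphicAt.const _ u).fun_mul (this.fun_pow i)
  · refine AnalyticAt.polynomial_eval ?_ P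
    exact analyticAt_id.mul ((by fun_prop : AnalyticAt ℂ (fun t => 1 - c * t) 0).inv (by simp))
  · simp [← Polynomial.coeff_zero_eq_eval_zero, hP0]
  · filter_upwards [self_mem_nhdsWithin] with t ht
    have ht : t ≠ 0 := ht
    congr 1
    rw [show t⁻¹ - c = (1 - c * t) * t⁻¹ by field_simp, mul_inv, inv_inv, mul_comm]

theorem IsPrincipalSum.neg_sum {ι : Type*} (s : Finset ι) {f : ι → ℂ → ℂ} {S : Set ℂ}
    (h : ∀ i ∈ s, IsPrincipalSum (f i) S) : IsPrincipalSum (fun u => -∑ i ∈ s, f i u) S := by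
  refine ⟨fun u hu => (Finset.analyticAt_fun_sum _ fun i hi => (h i hi).analytic u hu).neg,
    fun u => ?_, ?_⟩
  · exact (MeromorphicAt.fun_sum fun i hi => (h i hi).mero u).neg
  · choose! G hG hG0 hGf using fun i hi => (h i hi).infinity
    refine ⟨fun t => -∑ i ∈ s, G i t, (Finset.analyticAt_fun_sum _ fun i hi => hG i hi).neg, ?_, ?_⟩
    · simp only [Finset.sum_eq_zero fun i hi => hG0 i hi, neg_zero]
    · have := (Filter.eventually_all_finset s).2 hGf
      filter_upwards [this] with t ht
      rw [Finset.sum_congr rfl ht]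

theorem IsPrincipalSum.holomorphicOffInSphere {f : ℂ → ℂ} {S : Set ℂ} (h : IsPrincipalSum f S) :
    HolomorphicOffInSphere f S :=
  ⟨h.analytic, h.infinity.imp fun _ hG => ⟨hG.1, hG.2.2⟩⟩

/-- A sum of principal parts cancels each of the poles. -/
theorem neg_sum_principalPart_add {ι : Type*} [Fintype ι] {c : ι → ℂ} (hc : Function.Injective c)
    (f : ι → ℂ → ℂ) (i : ι) (hf : MeromorphicAt (f i) (c i)) :
    ∃ r, AnalyticAt ℂ r (c i) ∧
      ∀ᶠ u in 𝓝[≠] (c i), -∑ j, principalPart (f j) (c j) u + f i u = r u := by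
  classical
  obtain ⟨r, hr, h⟩ := sub_principalPart hf
  have h1 : AnalyticAt ℂ (fun u => ∑ j ∈ Finset.univ.erase i, principalPart (f j) (c j) u) (c i) :=
    Finset.analyticAt_fun_sum _ fun j hj =>
      (isPrincipalSum_principalPart (f j) (Set.mem_singleton (c j))).analytic _ fun h =>
        (Finset.ne_of_mem_erase hj) (hc h).symm
  refine ⟨_, hr.sub h1, ?_⟩
  filter_upwards [h] with u hu
  rw [hu, ← Finset.add_sum_erase _ _ (Finset.mem_univ i), Pi.sub_apply]
  ring

theorem extendAt_eventuallyEq {f r : ℂ → ℂ} {c : ℂ} (hr : AnalyticAt ℂ r c)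
    (h : f =ᶠ[𝓝[≠] c] r) : extendAt f c =ᶠ[𝓝 c] r := by
  have h1 : Tendsto f (𝓝[≠] c) (𝓝 (r c)) :=
    (hr.continuousAt.tendsto.mono_left nhdsWithin_le_nhds).congr' h.symm
  filter_upwards [eventually_nhdsWithin_iff.1 h] with u hu
  unfold extendAt
  by_cases huc : u = c
  · subst huc
    rw [Function.update_self, h1.limUnder_eq]
  · rw [Function.update_of_ne huc, hu huc]

/-! ## Holomorphy of the canonical coefficients -/

theorem AnalyticAt.exists_eq_sub_mul {f : ℂ → ℂ} {c : ℂ} (hf : AnalyticAt ℂ f c) (h0 : f c = 0) :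
    ∃ r, AnalyticAt ℂ r c ∧ r c = deriv f c ∧ ∀ u, f u = (u - c) * r u := by
  obtain ⟨P, hP⟩ := hf
  refine ⟨dslope f c, hP.has_fpower_series_dslope_fslope.analyticAt, dslope_same _ _, fun u => ?_⟩
  rw [← smul_eq_mul, sub_smul_dslope, h0, sub_zero]

theorem exists_analyticAt_div_eq {f h : ℂ → ℂ} {c : ℂ} (hf : AnalyticAt ℂ f c) (hf0 : f c = 0)
    (hh : AnalyticAt ℂ h c) (hh0 : h c = 0) (hh1 : deriv h c ≠ 0) :
    ∃ r, AnalyticAt ℂ r c ∧ ∀ᶠ u in 𝓝[≠] c, f u / h u = r u := by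
  obtain ⟨f₁, hf₁, -, hf₂⟩ := hf.exists_eq_sub_mul hf0
  obtain ⟨h₁, hh₁, hh₃, hh₂⟩ := hh.exists_eq_sub_mul hh0
  rw [← hh₃] at hh1
  refine ⟨fun u => f₁ u / h₁ u, hf₁.fun_div hh₁ hh1, ?_⟩
  filter_upwards [self_mem_nhdsWithin] with u hu
  rw [hf₂, hh₂, mul_div_mul_left _ _ (sub_ne_zero.2 hu)]

namespace ModelData

variable {n m : ℕ} (D : ModelData n m)

/-- The regularity of the data needed for the canonical coefficients to be holomorphic. -/
structure Regular : Prop where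
  inj_p : Function.Injective D.p
  inj_q : Function.Injective D.q
  ne : ∀ i j, D.p i ≠ D.q j
  eps : ∀ i r, AnalyticAt ℂ (D.eps i r) (D.p i)
  eps_one : ∀ i, D.eps i 1 (D.p i) = 1
  sig : ∀ j r, AnalyticAt ℂ (D.sig j r) (D.q j)
  sig_one : ∀ j, D.sig j 1 (D.q j) = 1
  sig_vanish : ∀ j r, 1 < r → D.sig j r (D.q j) = 0
  g : ∀ j, AnalyticAt ℂ (D.g j) (D.q j)
  g_deriv : ∀ j, deriv (D.g j) (D.q j) = 0
  g_deriv_two : ∀ j, deriv (deriv (D.g j)) (D.q j) ≠ 0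

/-- The set of singular and tangency points. -/
def pts : Set ℂ := Set.range D.p ∪ Set.range D.q

/-- The singular and tangency points, as one family. -/
noncomputable def center : Fin (n + 1) ⊕ Fin m → ℂ := Sum.elim D.p D.q

/-- The functions whose principal parts are cancelled by `a_{n,k+2}`. -/
noncomputable def aTerm (k : ℕ) : Fin (n + 1) ⊕ Fin m → ℂ → ℂ :=
  Sum.elim
    (fun i t => functionalP (k + 1) (D.lam i) (D.p i) (D.s i) (D.eps i) D.aN t
      / (D.eps i 1 t) ^ (k + 2))
    (fun j t => functionalAQ (k + 1) (D.g j) (D.z j) (D.sig j) D.aN t / (D.sig j 1 t) ^ (k + 2))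

/-- The functions whose principal parts are cancelled by `b_{n,k+2}`. -/
noncomputable def bTerm (k : ℕ) : Fin (n + 1) ⊕ Fin m → ℂ → ℂ :=
  Sum.elim
    (fun i t => functionalP (k + 1) (D.lam i) (D.p i) (D.s i) (D.eps i) D.bN t
      / (D.eps i 1 t) ^ (k + 2))
    (fun j t => D.z j (k + 2) / ((D.sig j 1 t) ^ (k + 2) * deriv (D.g j) t)
      + functionalBQ (k + 1) (D.g j) (D.z j) (D.sig j) D.bN t / (D.sig j 1 t) ^ (k + 2))

theorem aN_add_two (k : ℕ) :
    D.aN (k + 2) = fun u => -∑ x, principalPart (D.aTerm k x) (D.center x) u := by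
  funext u
  rw [aN, Fintype.sum_sum_type, neg_add']
  have h : ∀ r ∈ Finset.Icc 1 (k + 1),
      (if _h : r < k + 2 then D.aN r else fun _ => 0) = D.aN r := fun r hr =>
    dif_pos (by have := (Finset.mem_Icc.1 hr).2; omega)
  simp only [aTerm, center, Sum.elim_inl, Sum.elim_inr, functionalP_congr h, functionalAQ_congr h]

theorem bN_add_two (k : ℕ) :
    D.bN (k + 2) = fun u => -∑ x, principalPart (D.bTerm k x) (D.center x) u := by
  funext u
  rw [bN, Fintype.sum_sum_type, neg_add']
  have h : ∀ r ∈ Finset.Icc 1 (k + 1),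
      (if _h : r < k + 2 then D.bN r else fun _ => 0) = D.bN r := fun r hr =>
    dif_pos (by have := (Finset.mem_Icc.1 hr).2; omega)
  simp only [bTerm, center, Sum.elim_inl, Sum.elim_inr, functionalP_congr h, functionalBQ_congr h]

theorem center_mem_pts (x : Fin (n + 1) ⊕ Fin m) : D.center x ∈ D.pts := by
  rcases x with i | j
  · exact Or.inl ⟨i, rfl⟩
  · exact Or.inr ⟨j, rfl⟩

theorem isPrincipalSum_aN (k : ℕ) : IsPrincipalSum (D.aN (k + 2)) D.pts := by
  rw [aN_add_two]
  exact IsPrincipalSum.neg_sum _ fun x _ => isPrincipalSum_principalPart _ (D.center_mem_pts x)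

theorem isPrincipalSum_bN (k : ℕ) : IsPrincipalSum (D.bN (k + 1)) D.pts := by
  cases k with
  | zero =>
    rw [show D.bN (0 + 1) = _ from funext fun u => by rw [bN]]
    exact IsPrincipalSum.neg_sum _ fun j _ =>
      isPrincipalSum_principalPart _ (D.center_mem_pts (Sum.inr j))
  | succ k =>
    rw [bN_add_two]
    exact IsPrincipalSum.neg_sum _ fun x _ => isPrincipalSum_principalPart _ (D.center_mem_pts x)

theorem aN_zero : D.aN 0 = fun _ => 0 := by rw [aN]

theorem aN_one : D.aN 1 = fun _ => 1 := by rw [aN]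

theorem bN_zero : D.bN 0 = fun _ => 0 := by rw [bN]

theorem meromorphicAt_aN (k : ℕ) (c : ℂ) : MeromorphicAt (D.aN k) c := by
  match k with
  | 0 => rw [aN_zero]; exact MeromorphicAt.const 0 c
  | 1 => rw [aN_one]; exact MeromorphicAt.const 1 c
  | k + 2 => exact (D.isPrincipalSum_aN k).mero c

theorem meromorphicAt_bN (k : ℕ) (c : ℂ) : MeromorphicAt (D.bN k) c := by
  match k with
  | 0 => rw [bN_zero]; exact MeromorphicAt.const 0 c
  | k + 1 => exact (D.isPrincipalSum_bN k).mero c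

theorem holomorphicOffInSphere_aN (k : ℕ) : HolomorphicOffInSphere (D.aN (k + 1)) D.pts := by
  cases k with
  | zero =>
    rw [aN_one]
    exact ⟨fun _ _ => analyticAt_const, fun _ => 1, analyticAt_const, by simp⟩
  | succ k => exact (D.isPrincipalSum_aN k).holomorphicOffInSphere

theorem holomorphicOffInSphere_bN (k : ℕ) : HolomorphicOffInSphere (D.bN (k + 1)) D.pts :=
  (D.isPrincipalSum_bN k).holomorphicOffInSphere

namespace Regular

variable {D}

theorem center_injective (hD : D.Regular) : Function.Injective D.center := by
  rintro (i | i) (j | j) h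
  · exact congrArg _ (hD.inj_p h)
  · exact absurd h (hD.ne i j)
  · exact absurd h.symm (hD.ne j i)
  · exact congrArg _ (hD.inj_q h)

theorem meromorphicAt_functionalP (hD : D.Regular) (k : ℕ) {A : ℕ → ℂ → ℂ} (i : Fin (n + 1))
    (hA : ∀ r, MeromorphicAt (A r) (D.p i)) :
    MeromorphicAt (functionalP k (D.lam i) (D.p i) (D.s i) (D.eps i) A) (D.p i) :=
  _root_.meromorphicAt_functionalP (fun l => (hD.eps i l).meromorphicAt) hA

theorem meromorphicAt_aTerm (hD : D.Regular) (k : ℕ) (x : Fin (n + 1) ⊕ Fin m) :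
    MeromorphicAt (D.aTerm k x) (D.center x) := by
  rcases x with i | j
  · exact (hD.meromorphicAt_functionalP _ i fun r => D.meromorphicAt_aN r _).fun_div
      ((hD.eps i 1).meromorphicAt.fun_pow _)
  · exact (meromorphicAt_functionalAQ (hD.g j).meromorphicAt
      (fun l => (hD.sig j l).meromorphicAt) fun r => D.meromorphicAt_aN r _).fun_div
      ((hD.sig j 1).meromorphicAt.fun_pow _)

theorem meromorphicAt_bTerm (hD : D.Regular) (k : ℕ) (x : Fin (n + 1) ⊕ Fin m) :
    MeromorphicAt (D.bTerm k x) (D.center x) := by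
  rcases x with i | j
  · exact (hD.meromorphicAt_functionalP _ i fun r => D.meromorphicAt_bN r _).fun_div
      ((hD.eps i 1).meromorphicAt.fun_pow _)
  · have hg := (hD.g j).meromorphicAt
    have hs := (hD.sig j 1).meromorphicAt.fun_pow (k + 2)
    exact ((MeromorphicAt.const _ _).fun_div (hs.fun_mul hg.deriv)).fun_add
      ((meromorphicAt_functionalBQ hg (fun l => (hD.sig j l).meromorphicAt)
        fun r => D.meromorphicAt_bN r _).fun_div hs)

/-- The reason for the shape of the recursion: the centres are distinct, so near one of them all
other principal parts are analytic, and the remaining one is the polar part of the term added. -/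
theorem aN_add_aTerm (hD : D.Regular) (k : ℕ) (x : Fin (n + 1) ⊕ Fin m) :
    ∃ r, AnalyticAt ℂ r (D.center x) ∧
      ∀ᶠ u in 𝓝[≠] (D.center x), D.aN (k + 2) u + D.aTerm k x u = r u := by
  rw [aN_add_two]
  exact neg_sum_principalPart_add hD.center_injective _ x (hD.meromorphicAt_aTerm k x)

theorem bN_add_bTerm (hD : D.Regular) (k : ℕ) (x : Fin (n + 1) ⊕ Fin m) :
    ∃ r, AnalyticAt ℂ r (D.center x) ∧
      ∀ᶠ u in 𝓝[≠] (D.center x), D.bN (k + 2) u + D.bTerm k x u = r u := by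
  rw [bN_add_two]
  exact neg_sum_principalPart_add hD.center_injective _ x (hD.meromorphicAt_bTerm k x)

theorem bN_one_add (hD : D.Regular) (j : Fin m) :
    ∃ r, AnalyticAt ℂ r (D.q j) ∧
      ∀ᶠ u in 𝓝[≠] (D.q j), D.bN 1 u + D.z j 1 / (D.sig j 1 u * deriv (D.g j) u) = r u := by
  rw [show D.bN 1 = _ from funext fun u => by rw [bN]]
  exact neg_sum_principalPart_add hD.inj_q
    (fun j t => D.z j 1 / (D.sig j 1 t * deriv (D.g j) t)) j
    ((MeromorphicAt.const _ _).fun_div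
      ((hD.sig j 1).meromorphicAt.fun_mul (hD.g j).meromorphicAt.deriv))

theorem analyticAt_bN_one (hD : D.Regular) (i : Fin (n + 1)) : AnalyticAt ℂ (D.bN 1) (D.p i) := by
  rw [show D.bN 1 = _ from funext fun u => by rw [bN]]
  refine AnalyticAt.neg (Finset.analyticAt_fun_sum _ fun j _ => ?_)
  exact (isPrincipalSum_principalPart _ (Set.mem_singleton (D.q j))).analytic _ (hD.ne i j)

theorem eps_ne_zero (hD : D.Regular) (i : Fin (n + 1)) : ∀ᶠ u in 𝓝 (D.p i), D.eps i 1 u ≠ 0 :=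
  (hD.eps i 1).continuousAt.eventually_ne (by rw [hD.eps_one]; exact one_ne_zero)

theorem sig_ne_zero (hD : D.Regular) (j : Fin m) : ∀ᶠ u in 𝓝 (D.q j), D.sig j 1 u ≠ 0 :=
  (hD.sig j 1).continuousAt.eventually_ne (by rw [hD.sig_one]; exact one_ne_zero)

/-- For order `k + 2`, the function to be extended is `eps_{k+2} + eps_1 ^ (k+2) * (aN_{k+2} +
aTerm)` off `p i`, where `eps_1 ≠ 0` clears the denominator of `aTerm`; the bracket has no pole by
`aN_add_aTerm`. The other families are treated in the same way. -/
theorem analyticAt_aP (hD : D.Regular) (i : Fin (n + 1)) (k : ℕ) : AnalyticAt ℂ (D.aP i k) (D.p i) := by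
  match k with
  | 0 => rw [show D.aP i 0 = _ by rw [aP]]; exact analyticAt_const
  | 1 => rw [show D.aP i 1 = _ by rw [aP]]; exact hD.eps i 1
  | k + 2 =>
    obtain ⟨r, hr, h⟩ := hD.aN_add_aTerm k (Sum.inl i)
    rw [show D.aP i (k + 2) = _ by rw [aP]]
    have hr' : AnalyticAt ℂ (fun u => D.eps i (k + 2) u + D.eps i 1 u ^ (k + 2) * r u) (D.p i) :=
      (hD.eps i _).fun_add (((hD.eps i 1).fun_pow _).fun_mul hr)
    refine hr'.congr (extendAt_eventuallyEq hr' ?_).symm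
    filter_upwards [h, nhdsWithin_le_nhds (hD.eps_ne_zero i)] with u h1 h2
    rw [← h1]
    simp only [aTerm, Sum.elim_inl]
    field_simp
    ring

theorem analyticAt_bP (hD : D.Regular) (i : Fin (n + 1)) (k : ℕ) : AnalyticAt ℂ (D.bP i k) (D.p i) := by
  match k with
  | 0 => rw [show D.bP i 0 = _ by rw [bP]]; exact analyticAt_const
  | 1 =>
    rw [show D.bP i 1 = _ by rw [bP]]
    exact analyticAt_const.fun_add ((hD.eps i 1).fun_mul (hD.analyticAt_bN_one i))
  | k + 2 =>
    obtain ⟨r, hr, h⟩ := hD.bN_add_bTerm k (Sum.inl i)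
    rw [show D.bP i (k + 2) = _ by rw [bP]]
    have hr' : AnalyticAt ℂ (fun u => D.s i (k + 2) + D.eps i (k + 2) u * D.bN 1 u +
        D.eps i 1 u ^ (k + 2) * r u) (D.p i) :=
      (analyticAt_const.fun_add ((hD.eps i _).fun_mul (hD.analyticAt_bN_one i))).fun_add
        (((hD.eps i 1).fun_pow _).fun_mul hr)
    refine hr'.congr (extendAt_eventuallyEq hr' ?_).symm
    filter_upwards [h, nhdsWithin_le_nhds (hD.eps_ne_zero i)] with u h1 h2
    rw [← h1]
    simp only [bTerm, Sum.elim_inl]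
    field_simp
    ring

theorem analyticAt_aQ (hD : D.Regular) (j : Fin m) (k : ℕ) : AnalyticAt ℂ (D.aQ j k) (D.q j) := by
  match k with
  | 0 => rw [show D.aQ j 0 = _ by rw [aQ]]; exact analyticAt_const
  | 1 => rw [show D.aQ j 1 = _ by rw [aQ]]; exact hD.sig j 1
  | k + 2 =>
    obtain ⟨r, hr, h⟩ := hD.aN_add_aTerm k (Sum.inr j)
    rw [show D.aQ j (k + 2) = _ by rw [aQ]]
    have hr' : AnalyticAt ℂ (fun u => D.sig j (k + 2) u + D.sig j 1 u ^ (k + 2) * r u) (D.q j) :=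
      (hD.sig j _).fun_add (((hD.sig j 1).fun_pow _).fun_mul hr)
    refine hr'.congr (extendAt_eventuallyEq hr' ?_).symm
    filter_upwards [h, nhdsWithin_le_nhds (hD.sig_ne_zero j)] with u h1 h2
    rw [← h1]
    simp only [aTerm, Sum.elim_inr]
    field_simp
    ring

theorem deriv_g_ne_zero (hD : D.Regular) (j : Fin m) : ∀ᶠ u in 𝓝[≠] (D.q j), deriv (D.g j) u ≠ 0 := by
  obtain ⟨r, hr, hr1, hr2⟩ := (hD.g j).deriv.exists_eq_sub_mul (hD.g_deriv j)
  have hr3 : ∀ᶠ u in 𝓝 (D.q j), r u ≠ 0 :=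
    hr.continuousAt.eventually_ne (hr1 ▸ hD.g_deriv_two j)
  filter_upwards [nhdsWithin_le_nhds hr3, self_mem_nhdsWithin] with u h1 h2
  rw [hr2]
  exact mul_ne_zero (sub_ne_zero.2 h2) h1

/-- Near `q j` the function `bN 1` is `-z_1 / (sig_1 g')` up to an analytic function, and `g'` has a
simple zero there. The normalization that `sig r` vanishes at `q j` for `r > 1` cancels this simple
pole, which is why the recursion for `bN` does not have to compensate `sig_r * bN_1`. -/
theorem sig_mul_bN_one (hD : D.Regular) (j : Fin m) {r : ℕ} (hr : 1 < r) :
    ∃ f, AnalyticAt ℂ f (D.q j) ∧ ∀ᶠ u in 𝓝[≠] (D.q j), D.sig j r u * D.bN 1 u = f u := by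
  obtain ⟨f, hf, h⟩ := hD.bN_one_add j
  obtain ⟨f', hf', h'⟩ := exists_analyticAt_div_eq (hD.sig j r) (hD.sig_vanish j r hr)
    (hD.g j).deriv (hD.g_deriv j) (hD.g_deriv_two j)
  refine ⟨fun u => D.sig j r u * f u - D.z j 1 * f' u / D.sig j 1 u,
    ((hD.sig j r).fun_mul hf).fun_sub ((analyticAt_const.fun_mul hf').fun_div (hD.sig j 1)
      (by rw [hD.sig_one]; exact one_ne_zero)), ?_⟩
  filter_upwards [h, h', nhdsWithin_le_nhds (hD.sig_ne_zero j), hD.deriv_g_ne_zero j]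
    with u h1 h2 h3 h4
  rw [← h1, ← h2]
  field_simp
  ring

theorem analyticAt_bQ (hD : D.Regular) (j : Fin m) (k : ℕ) : AnalyticAt ℂ (D.bQ j k) (D.q j) := by
  match k with
  | 0 => rw [show D.bQ j 0 = _ by rw [bQ]]; exact analyticAt_const
  | 1 =>
    obtain ⟨r, hr, h⟩ := hD.bN_one_add j
    rw [show D.bQ j 1 = _ by rw [bQ]]
    have hr' : AnalyticAt ℂ (fun u => D.sig j 1 u * r u) (D.q j) := (hD.sig j 1).fun_mul hr
    refine hr'.congr (extendAt_eventuallyEq hr' ?_).symm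
    filter_upwards [h, nhdsWithin_le_nhds (hD.sig_ne_zero j), hD.deriv_g_ne_zero j] with u h1 h2 h3
    rw [← h1]
    field_simp
    ring
  | k + 2 =>
    obtain ⟨r, hr, h⟩ := hD.bN_add_bTerm k (Sum.inr j)
    obtain ⟨f, hf, hf'⟩ := hD.sig_mul_bN_one j (r := k + 2) (by omega)
    rw [show D.bQ j (k + 2) = _ by rw [bQ]]
    have hr' : AnalyticAt ℂ (fun u => f u + D.sig j 1 u ^ (k + 2) * r u) (D.q j) :=
      hf.fun_add (((hD.sig j 1).fun_pow _).fun_mul hr)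
    refine hr'.congr (extendAt_eventuallyEq hr' ?_).symm
    filter_upwards [h, hf', nhdsWithin_le_nhds (hD.sig_ne_zero j), hD.deriv_g_ne_zero j]
      with u h1 h2 h3 h4
    rw [← h1, ← h2]
    simp only [bTerm, Sum.elim_inr]
    field_simp
    ring

end Regular

end ModelData

/-! ## Taylor coefficients of compositions with a map vanishing on the divisor -/

theorem analyticAt_comp_pair {X : ℂ × ℂ → ℂ} {u : ℂ} {e y : ℂ → ℂ} (hX : AnalyticAt ℂ X (0, u))
    (he : AnalyticAt ℂ e 0) (he0 : e 0 = 0) (hy : AnalyticAt ℂ y 0) (hy0 : y 0 = u) :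
    AnalyticAt ℂ (fun x => X (e x, y x)) 0 :=
  AnalyticAt.fun_comp (f := fun x => (e x, y x)) (by simpa [he0, hy0] using hX) (he.prod hy)

theorem tendsto_pair {u : ℂ} {e y : ℂ → ℂ} (he : AnalyticAt ℂ e 0) (he0 : e 0 = 0)
    (hy : AnalyticAt ℂ y 0) (hy0 : y 0 = u) :
    Tendsto (fun x => (e x, y x)) (𝓝 0) (𝓝 ((0 : ℂ), u)) := by
  simpa [he0, hy0] using (he.continuousAt.prodMk hy.continuousAt).tendsto

theorem isBigO_id_of_zero {e : ℂ → ℂ} (he : AnalyticAt ℂ e 0) (he0 : e 0 = 0) :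
    e =O[𝓝 0] fun x => x := by
  simpa [he0] using he.differentiableAt.isBigO_sub

theorem taylorCoeff_eq_zero_of_isLittleO {f : ℂ → ℂ} (hf : AnalyticAt ℂ f 0) {n : ℕ}
    (h : f =o[𝓝 0] fun x => x ^ n) : taylorCoeff n f = 0 := by
  obtain ⟨g, hg, hfg⟩ := exists_eq_pow_mul_of_isBigO hf (h.isBigO.mono nhdsWithin_le_nhds)
  rw [taylorCoeff_congr hfg, taylorCoeff_pow_mul hg, if_pos le_rfl, Nat.sub_self, taylorCoeff_zero]
  have h1 := (h.mono nhdsWithin_le_nhds : f =o[𝓝[≠] 0] fun x => x ^ n).tendsto_div_nhds_zero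
  refine tendsto_nhds_unique (hg.continuousAt.tendsto.mono_left nhdsWithin_le_nhds)
    (h1.congr' ?_)
  filter_upwards [nhdsWithin_le_nhds hfg, self_mem_nhdsWithin] with x h2 h3
  rw [h2, mul_div_cancel_left₀ _ (pow_ne_zero _ h3)]

theorem taylorCoeff_pow_mul_pow {e a : ℂ → ℂ} (he : AnalyticAt ℂ e 0) (he0 : e 0 = 0)
    (ha : AnalyticAt ℂ a 0) (n : ℕ) :
    taylorCoeff n (fun x => a x * e x ^ n) = a 0 * deriv e 0 ^ n := by
  obtain ⟨r, hr, hr1, hr2⟩ := he.exists_eq_sub_mul he0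
  have h : (fun x => a x * e x ^ n) = fun x => x ^ n * (a x * r x ^ n) := by
    funext x
    rw [hr2, sub_zero, mul_pow]; ring
  rw [h, taylorCoeff_pow_mul (ha.fun_mul (hr.fun_pow n)), if_pos le_rfl, Nat.sub_self,
    taylorCoeff_zero, hr1]

/-- The effect on the Taylor coefficients of a composition of a perturbation of order `k + 1`. -/
theorem taylorCoeff_comp_perturb {X : ℂ × ℂ → ℂ} {u : ℂ} (hX : AnalyticAt ℂ X (0, u))
    (hX0 : ∀ᶠ t in 𝓝 u, X (0, t) = 0) {e y e' y' : ℂ → ℂ} (he : AnalyticAt ℂ e 0) (he0 : e 0 = 0)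
    (hy : AnalyticAt ℂ y 0) (hy0 : y 0 = u) (he' : AnalyticAt ℂ e' 0) (he0' : e' 0 = 0)
    (hy' : AnalyticAt ℂ y' 0) (hy0' : y' 0 = u) {k : ℕ}
    (hee : ∀ j ≤ k, taylorCoeff j e = taylorCoeff j e')
    (hyy : ∀ j ≤ k, taylorCoeff j y = taylorCoeff j y') :
    (∀ j ≤ k, taylorCoeff j (fun x => X (e x, y x)) = taylorCoeff j fun x => X (e' x, y' x)) ∧
    taylorCoeff (k + 1) (fun x => X (e x, y x)) = taylorCoeff (k + 1) (fun x => X (e' x, y' x)) +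
      xCoeff 1 X u * (taylorCoeff (k + 1) e - taylorCoeff (k + 1) e') := by
  have hc := analyticAt_comp_pair hX he he0 hy hy0
  have hc' := analyticAt_comp_pair hX he' he0' hy' hy0'
  have h1 : (fun x => e x - e' x) =O[𝓝 0] fun x => x ^ (k + 1) :=
    isBigO_sub_of_taylorCoeff_eq he he' fun j hj => hee j (Nat.lt_succ_iff.1 hj)
  have h2 : (fun x => y x - y' x) =O[𝓝 0] fun x => x ^ (k + 1) :=
    isBigO_sub_of_taylorCoeff_eq hy hy' fun j hj => hyy j (Nat.lt_succ_iff.1 hj)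
  have h3 : (fun x => (e x, y x) - (e' x, y' x)) =O[𝓝 0] fun x => x ^ (k + 1) := by
    simpa using h1.prod_left h2
  have ht := (tendsto_pair he he0 hy hy0).prodMk_nhds (tendsto_pair he' he0' hy' hy0')
  have hs := hX.hasStrictFDerivAt.isLittleO.comp_tendsto ht
  have hs' := hs.trans_isBigO h3
  set L := fderiv ℂ X (0, u) with hL
  -- `X` vanishes on the divisor, so its differential kills the direction of `u`: at order `k + 1` a
  -- perturbation of `y` is invisible and only that of `e` counts.
  have hL1 : L (0, 1) = 0 := by
    have h4 : HasDerivAt (fun t : ℂ => ((0 : ℂ), t)) ((0 : ℂ), (1 : ℂ)) u :=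
      (hasDerivAt_const u (0 : ℂ)).prodMk (hasDerivAt_id u)
    have h5 := hX.differentiableAt.hasFDerivAt.comp_hasDerivAt u h4
    have h6 : HasDerivAt (X ∘ fun t : ℂ => ((0 : ℂ), t)) 0 u :=
      (hasDerivAt_const u (0 : ℂ)).congr_of_eventuallyEq hX0
    exact h5.unique h6
  have hL2 : L (1, 0) = xCoeff 1 X u := by
    have h4 : HasDerivAt (fun t : ℂ => (t, u)) ((1 : ℂ), (0 : ℂ)) 0 :=
      (hasDerivAt_id (0 : ℂ)).prodMk (hasDerivAt_const _ u)
    have h5 := hX.differentiableAt.hasFDerivAt.comp_hasDerivAt (0 : ℂ) h4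
    unfold xCoeff
    rw [taylorCoeff_one]
    exact h5.deriv.symm
  have hLa : ∀ a b : ℂ, L (a, b) = xCoeff 1 X u * a := fun a b => by
    have : ((a, b) : ℂ × ℂ) = a • ((1 : ℂ), (0 : ℂ)) + b • ((0 : ℂ), (1 : ℂ)) := by ext <;> simp
    rw [this, map_add, map_smul, map_smul, hL1, hL2]
    simp [mul_comm]
  refine ⟨fun j hj => ?_, ?_⟩
  · refine taylorCoeff_eq_of_isBigO (n := k + 1) hc hc' ?_ (Nat.lt_succ_iff.2 hj)
    have h4 := (hX.hasStrictFDerivAt.isBigO_sub.comp_tendsto ht).trans h3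
    exact h4
  · have h4 : (fun x => X (e x, y x) - X (e' x, y' x) - xCoeff 1 X u * (e x - e' x))
        =o[𝓝 0] fun x => x ^ (k + 1) := by
      refine hs'.congr_left fun x => ?_
      simp only [Function.comp, Prod.mk_sub_mk, hLa]
    have h5 := taylorCoeff_eq_zero_of_isLittleO
      ((hc.fun_sub hc').fun_sub (analyticAt_const.fun_mul (he.fun_sub he'))) h4
    rw [taylorCoeff_sub (hc.fun_sub hc') (analyticAt_const.fun_mul (he.fun_sub he')),
      taylorCoeff_sub hc hc', taylorCoeff_const_mul, taylorCoeff_sub he he'] at h5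
    rw [← sub_eq_iff_eq_add', ← sub_eq_zero, h5]

/-- The Taylor coefficients of order `≤ k + 1` of a composition, in terms of the expansion. -/
theorem taylorCoeff_comp_expansion {X : ℂ × ℂ → ℂ} {u : ℂ} (hX : AnalyticAt ℂ X (0, u))
    (hX0 : ∀ᶠ t in 𝓝 u, X (0, t) = 0) {e y : ℂ → ℂ} (he : AnalyticAt ℂ e 0) (he0 : e 0 = 0)
    (hy : AnalyticAt ℂ y 0) (hy0 : y 0 = u) {k : ℕ} {a : ℕ → ℂ → ℂ}
    (ha : ∀ r ∈ Finset.Icc 1 k, xCoeff r X =ᶠ[𝓝 u] a r) :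
    (∀ j ≤ k, taylorCoeff j (fun x => X (e x, y x)) =
      taylorCoeff j fun x => ∑ r ∈ Finset.Icc 1 k, a r (y x) * e x ^ r) ∧
    taylorCoeff (k + 1) (fun x => X (e x, y x)) =
      taylorCoeff (k + 1) (fun x => ∑ r ∈ Finset.Icc 1 k, a r (y x) * e x ^ r) +
      xCoeff (k + 1) X u * deriv e 0 ^ (k + 1) := by
  have hc := analyticAt_comp_pair hX he he0 hy hy0
  have haa : ∀ r ∈ Finset.Icc 1 k, AnalyticAt ℂ (fun x => a r (y x)) 0 := fun r hr =>
    AnalyticAt.fun_comp (by rw [hy0]; exact (analyticAt_xCoeff hX r).congr (ha r hr)) hy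
  have hsum : AnalyticAt ℂ (fun x => ∑ r ∈ Finset.Icc 1 k, a r (y x) * e x ^ r) 0 :=
    Finset.analyticAt_fun_sum _ fun r hr => (haa r hr).fun_mul (he.fun_pow r)
  have hα : AnalyticAt ℂ (fun x => xCoeff (k + 1) X (y x)) 0 :=
    AnalyticAt.fun_comp (by rw [hy0]; exact analyticAt_xCoeff hX (k + 1)) hy
  have hαe : AnalyticAt ℂ (fun x => xCoeff (k + 1) X (y x) * e x ^ (k + 1)) 0 :=
    hα.fun_mul (he.fun_pow _)
  have hexp := ((hX.isBigO_expansion (k + 2)).comp_tendsto (tendsto_pair he he0 hy hy0)).trans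
    ((isBigO_id_of_zero he he0).pow (k + 2) : (fun x => e x ^ (k + 2)) =O[𝓝 0] _)
  have hev : ∀ᶠ x in 𝓝 (0 : ℂ), xCoeff 0 X (y x) = 0 ∧
      ∀ r ∈ Finset.Icc 1 k, xCoeff r X (y x) = a r (y x) := by
    have ht : Tendsto y (𝓝 0) (𝓝 u) := by simpa [hy0] using hy.continuousAt.tendsto
    have h0 : ∀ᶠ t in 𝓝 u, xCoeff 0 X t = 0 := by
      filter_upwards [hX0] with t h
      rw [xCoeff_zero, h]
    exact ht.eventually (h0.and ((Filter.eventually_all_finset _).2 ha))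
  have hmain : (fun x => X (e x, y x) - ((∑ r ∈ Finset.Icc 1 k, a r (y x) * e x ^ r) +
      xCoeff (k + 1) X (y x) * e x ^ (k + 1))) =O[𝓝 0] fun x => x ^ (k + 2) := by
    refine hexp.congr' ?_ EventuallyEq.rfl
    filter_upwards [hev] with x hx
    simp only [Function.comp]
    rw [Finset.sum_range_succ, Finset.range_eq_Ico, Finset.sum_eq_sum_Ico_succ_bot (Nat.succ_pos k),
      hx.1, zero_mul, zero_add, zero_add, show Finset.Ico 1 (k + 1) = Finset.Icc 1 k from rfl,
      Finset.sum_congr rfl fun r hr => by rw [hx.2 r hr]]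
  have key : ∀ j ≤ k + 1, taylorCoeff j (fun x => X (e x, y x)) =
      taylorCoeff j (fun x => ∑ r ∈ Finset.Icc 1 k, a r (y x) * e x ^ r) +
        taylorCoeff j fun x => xCoeff (k + 1) X (y x) * e x ^ (k + 1) := fun j hj => by
    rw [taylorCoeff_eq_of_isBigO hc (hsum.fun_add hαe) hmain (by omega), taylorCoeff_add hsum hαe]
  refine ⟨fun j hj => ?_, ?_⟩
  · rw [key j (by omega), taylorCoeff_eq_zero_of_isBigO hαe (n := k + 1) ?_ (by omega), add_zero]
    have h1 := (hα.continuousAt.isBigO_one ℂ).mul ((isBigO_id_of_zero he he0).pow (k + 1))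
    simpa using h1
  · rw [key _ le_rfl, taylorCoeff_pow_mul_pow he he0 hα, hy0]

theorem taylorCoeff_one_comp {X : ℂ × ℂ → ℂ} {u : ℂ} (hX : AnalyticAt ℂ X (0, u))
    (hX0 : ∀ᶠ t in 𝓝 u, X (0, t) = 0) {e y : ℂ → ℂ} (he : AnalyticAt ℂ e 0) (he0 : e 0 = 0)
    (hy : AnalyticAt ℂ y 0) (hy0 : y 0 = u) :
    taylorCoeff 1 (fun x => X (e x, y x)) = xCoeff 1 X u * taylorCoeff 1 e := by
  have := (taylorCoeff_comp_expansion hX hX0 he he0 hy hy0 (k := 0) (a := fun _ _ => 0)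
    (by simp)).2
  have h0 : taylorCoeff (0 + 1) (fun x => ∑ r ∈ Finset.Icc 1 0, (0 : ℂ) * e x ^ r) = 0 := by
    simp [taylorCoeff_one]
  rw [h0] at this
  simpa [taylorCoeff_one] using this

/-- The coefficient of order `k + 1` of `X ∘ (ε ∘ ψ, ψ₂)`, `k ≥ 1`, where `ψ'` is a truncation
of `ψ`. -/
theorem taylorCoeff_comp_comp {X ε : ℂ × ℂ → ℂ} {u : ℂ} (hX : AnalyticAt ℂ X (0, u))
    (hX0 : ∀ᶠ t in 𝓝 u, X (0, t) = 0) (hε : AnalyticAt ℂ ε (0, u))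
    (hε0 : ∀ᶠ t in 𝓝 u, ε (0, t) = 0) {e y e' y' : ℂ → ℂ} (he : AnalyticAt ℂ e 0) (he0 : e 0 = 0)
    (he1 : taylorCoeff 1 e = 1)
    (hy : AnalyticAt ℂ y 0) (hy0 : y 0 = u) (he' : AnalyticAt ℂ e' 0) (he0' : e' 0 = 0)
    (hy' : AnalyticAt ℂ y' 0) (hy0' : y' 0 = u) {k : ℕ} (hk : 1 ≤ k)
    (hee : ∀ j ≤ k + 1, taylorCoeff j e = taylorCoeff j e')
    (hyy : ∀ j ≤ k, taylorCoeff j y = taylorCoeff j y') {a : ℕ → ℂ → ℂ}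
    (ha : ∀ r ∈ Finset.Icc 1 k, xCoeff r X =ᶠ[𝓝 u] a r) :
    taylorCoeff (k + 1) (fun x => X (ε (e x, y x), y x)) =
      taylorCoeff (k + 1) (fun x => ∑ r ∈ Finset.Icc 1 k, a r (y' x) *
        (∑ l ∈ Finset.Icc 1 k, xCoeff l ε (y' x) * e' x ^ l) ^ r) +
      a 1 u * xCoeff (k + 1) ε u + xCoeff (k + 1) X u * xCoeff 1 ε u ^ (k + 1) := by
  set E : ℂ → ℂ := fun x => ε (e x, y x) with hE
  set E' : ℂ → ℂ := fun x => ∑ l ∈ Finset.Icc 1 k, xCoeff l ε (y' x) * e' x ^ l with hE'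
  have hEa : AnalyticAt ℂ E 0 := analyticAt_comp_pair hε he he0 hy hy0
  have hE0 : E 0 = 0 := by simp only [hE, he0, hy0]; exact hε0.self_of_nhds
  have hEa' : AnalyticAt ℂ E' 0 := Finset.analyticAt_fun_sum _ fun l _ =>
    (AnalyticAt.fun_comp (by rw [hy0']; exact analyticAt_xCoeff hε l) hy').fun_mul (he'.fun_pow l)
  have hE0' : E' 0 = 0 := Finset.sum_eq_zero fun l hl => by
    rw [he0', zero_pow (by have := (Finset.mem_Icc.1 hl).1; omega), mul_zero]
  -- `ε ∘ ψ` and the truncated expansion `E'` agree up to order `k`. At order `k + 1` they differ by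
  -- `ε_{k+1}(u)` alone, since `e` and `e'` agree one order further than `y` and `y'` and have
  -- linear coefficient `1`.
  have hp := taylorCoeff_comp_perturb hε hε0 he he0 hy hy0 he' he0' hy' hy0' (k := k)
    (fun j hj => hee j (by omega)) hyy
  have hx := taylorCoeff_comp_expansion hε hε0 he' he0' hy' hy0' (k := k)
    (a := fun l => xCoeff l ε) fun _ _ => EventuallyEq.rfl
  have he1' : deriv e' 0 = 1 := by rw [← taylorCoeff_one, ← hee 1 (by omega), he1]
  have hEE : ∀ j ≤ k, taylorCoeff j E = taylorCoeff j E' := fun j hj => by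
    rw [hp.1 j hj, hx.1 j hj]
  have hEk : taylorCoeff (k + 1) E - taylorCoeff (k + 1) E' = xCoeff (k + 1) ε u := by
    rw [hp.2, hx.2, he1', hee (k + 1) le_rfl]
    ring
  -- Seen through `X`, the discrepancy between `E` and `E'` contributes `a_1 ε_{k+1}`, and the first
  -- coefficient of `X` omitted from the sum contributes itself times `ε_1 ^ (k + 1)`.
  have hp2 := (taylorCoeff_comp_perturb hX hX0 hEa hE0 hy hy0 hEa' hE0' hy' hy0' (k := k) hEE
    hyy).2
  have hx2 := (taylorCoeff_comp_expansion hX hX0 hEa' hE0' hy' hy0' ha).2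
  have hE1 : deriv E' 0 = xCoeff 1 ε u := by
    rw [← taylorCoeff_one, ← hEE 1 hk, taylorCoeff_one_comp hε hε0 he he0 hy hy0, he1, mul_one]
  rw [hp2, hx2, hE1, hEk, (ha 1 (Finset.mem_Icc.2 ⟨le_rfl, hk⟩)).self_of_nhds]
  ring

/-! ## The coefficients of the normalizing transformations at `p_i` and `q_j` -/

theorem taylorCoeff_truncation {s : ℂ → ℂ} (hs0 : s 0 = 0) (k j : ℕ) :
    taylorCoeff j (fun t => ∑ r ∈ Finset.Icc 1 k, taylorCoeff r s * t ^ r) =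
      if j ≤ k then taylorCoeff j s else 0 := by
  have h : (fun t : ℂ => ∑ r ∈ Finset.Icc 1 k, taylorCoeff r s * t ^ r) =
      fun t => ∑ r ∈ Finset.range (k + 1), taylorCoeff r s * t ^ r := by
    funext t
    rw [Finset.range_eq_Ico, Finset.sum_eq_sum_Ico_succ_bot (Nat.succ_pos k), taylorCoeff_zero, hs0,
      zero_mul, zero_add, zero_add]
    rfl
  rw [h, taylorCoeff_polynomial]
  simp only [Nat.lt_succ_iff]

theorem truncation_zero (s : ℕ → ℂ) (k : ℕ) : ∑ r ∈ Finset.Icc 1 k, s r * (0 : ℂ) ^ r = 0 :=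
  Finset.sum_eq_zero fun r hr => by
    rw [zero_pow (by have := (Finset.mem_Icc.1 hr).1; omega), mul_zero]

theorem analyticAt_psi_base {s : ℂ → ℂ} (hs : AnalyticAt ℂ s 0) (hs0 : s 0 = 0) (lam d : ℂ) :
    AnalyticAt ℂ (fun x => (1 + s x / d) ^ lam) 0 :=
  (analyticAt_const.fun_add (hs.div_const (c := d))).cpow analyticAt_const
    (by simp [hs0, Complex.one_mem_slitPlane])

theorem analyticAt_psi_fst {s : ℂ → ℂ} (hs : AnalyticAt ℂ s 0) (hs0 : s 0 = 0) (lam d : ℂ) :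
    AnalyticAt ℂ (fun x => x * (1 + s x / d) ^ lam) 0 :=
  AnalyticAt.fun_mul (f := fun x => x) analyticAt_id (analyticAt_psi_base hs hs0 lam d)

theorem taylorCoeff_psi_fst {s : ℂ → ℂ} (hs : AnalyticAt ℂ s 0) (hs0 : s 0 = 0) (lam d : ℂ) :
    taylorCoeff 1 (fun x => x * (1 + s x / d) ^ lam) = 1 := by
  have := taylorCoeff_pow_mul (analyticAt_psi_base hs hs0 lam d) 1 1
  simpa [taylorCoeff_zero, hs0] using this

/-- The factor `x` gains one order: changing `s` beyond order `k` changes the product only from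
order `k + 2` on. -/
theorem taylorCoeff_psi_fst_congr {s S : ℂ → ℂ} (hs : AnalyticAt ℂ s 0) (hs0 : s 0 = 0)
    (hS : AnalyticAt ℂ S 0) (hS0 : S 0 = 0) {k : ℕ}
    (h : ∀ j ≤ k, taylorCoeff j s = taylorCoeff j S) (lam d : ℂ) {j : ℕ} (hj : j ≤ k + 1) :
    taylorCoeff j (fun x => x * (1 + s x / d) ^ lam) =
      taylorCoeff j fun x => x * (1 + S x / d) ^ lam := by
  refine taylorCoeff_eq_of_isBigO (n := k + 2) (analyticAt_psi_fst hs hs0 lam d)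
    (analyticAt_psi_fst hS hS0 lam d) ?_ (by omega)
  have hG : AnalyticAt ℂ (fun t : ℂ => (1 + t / d) ^ lam) 0 :=
    analyticAt_psi_base analyticAt_id rfl lam d
  have ht : Tendsto (fun x => (s x, S x)) (𝓝 0) (𝓝 ((0 : ℂ), (0 : ℂ))) := by
    simpa [hs0, hS0] using (hs.continuousAt.prodMk hS.continuousAt).tendsto
  have h1 := hG.hasStrictFDerivAt.isBigO_sub.comp_tendsto ht
  have h2 := h1.trans (isBigO_sub_of_taylorCoeff_eq hs hS (n := k + 1)
    fun j hj => h j (Nat.lt_succ_iff.1 hj))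
  have h3 := (Asymptotics.isBigO_refl (fun x : ℂ => x) (𝓝 0)).mul h2
  refine (h3.congr_left fun x => ?_).congr_right fun x => ?_
  · simp only [Function.comp]; ring
  · ring

/-- The coefficient of order `k + 1` of `X ∘ ξ ∘ Ψ`. -/
theorem taylorCoeff_comp_psi {X ε : ℂ × ℂ → ℂ} {u c lam : ℂ} {s : ℂ → ℂ}
    (hX : AnalyticAt ℂ X (0, u)) (hX0 : ∀ᶠ t in 𝓝 u, X (0, t) = 0) (hε : AnalyticAt ℂ ε (0, u))
    (hε0 : ∀ᶠ t in 𝓝 u, ε (0, t) = 0) (hs : AnalyticAt ℂ s 0) (hs0 : s 0 = 0) {k : ℕ}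
    (hk : 1 ≤ k) {a : ℕ → ℂ → ℂ} (ha : ∀ r ∈ Finset.Icc 1 k, xCoeff r X =ᶠ[𝓝 u] a r) :
    taylorCoeff (k + 1) (fun x => X (ε (Psi lam c s (x, u)), (Psi lam c s (x, u)).2)) =
      functionalP k lam c (fun r => taylorCoeff r s) (fun l => xCoeff l ε) a u +
      a 1 u * xCoeff (k + 1) ε u + xCoeff (k + 1) X u * xCoeff 1 ε u ^ (k + 1) := by
  have hS : AnalyticAt ℂ (fun t : ℂ => ∑ r ∈ Finset.Icc 1 k, taylorCoeff r s * t ^ r) 0 :=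
    Finset.analyticAt_fun_sum _ fun r _ => by fun_prop
  have hS0 := truncation_zero (fun r => taylorCoeff r s) k
  have hsS : ∀ j ≤ k, taylorCoeff j s =
      taylorCoeff j fun t => ∑ r ∈ Finset.Icc 1 k, taylorCoeff r s * t ^ r := fun j hj => by
    rw [taylorCoeff_truncation hs0, if_pos hj]
  refine taylorCoeff_comp_comp hX hX0 hε hε0 (analyticAt_psi_fst hs hs0 lam (u - c)) (by simp)
    (taylorCoeff_psi_fst hs hs0 lam (u - c)) (y := fun x => u + s x)
    (analyticAt_const.fun_add hs) (by simp [hs0])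
    (analyticAt_psi_fst hS hS0 lam (u - c)) (by simp) (y' := fun x => u + _)
    (analyticAt_const.fun_add hS) (by simp [hS0]) hk
    (fun j hj => taylorCoeff_psi_fst_congr hs hs0 hS hS0 hsS lam _ hj) (fun j hj => ?_) ha
  rw [taylorCoeff_add analyticAt_const hs, taylorCoeff_add analyticAt_const hS, hsS j hj]

theorem taylorCoeff_one_comp_psi {X ε : ℂ × ℂ → ℂ} {u c lam : ℂ} {s : ℂ → ℂ}
    (hX : AnalyticAt ℂ X (0, u)) (hX0 : ∀ᶠ t in 𝓝 u, X (0, t) = 0) (hε : AnalyticAt ℂ ε (0, u))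
    (hε0 : ∀ᶠ t in 𝓝 u, ε (0, t) = 0) (hs : AnalyticAt ℂ s 0) (hs0 : s 0 = 0) :
    taylorCoeff 1 (fun x => X (ε (Psi lam c s (x, u)), (Psi lam c s (x, u)).2)) =
      xCoeff 1 X u * xCoeff 1 ε u := by
  have hy : AnalyticAt ℂ (fun x => u + s x) 0 := analyticAt_const.fun_add hs
  have h1 := taylorCoeff_one_comp hε hε0 (analyticAt_psi_fst hs hs0 lam (u - c)) (by simp) hy
    (by simp [hs0])
  rw [taylorCoeff_psi_fst hs hs0, mul_one] at h1
  rw [← h1]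
  refine taylorCoeff_one_comp hX hX0 (e := fun x => ε (x * (1 + s x / (u - c)) ^ lam, u + s x))
    (y := fun x => u + s x) (analyticAt_comp_pair hε (analyticAt_psi_fst hs hs0 lam (u - c))
    (by simp) hy (by simp [hs0])) ?_ hy (by simp [hs0])
  simpa [hs0] using hε0.self_of_nhds

/-- The Taylor coefficients of the solution of `g ∘ φ = g(u) + z`. -/
theorem taylorCoeff_eq_phiCoeff {g z φ : ℂ → ℂ} {u : ℂ} (hg : AnalyticAt ℂ g u)
    (hg' : deriv g u ≠ 0) (hz : AnalyticAt ℂ z 0) (hφ : AnalyticAt ℂ φ 0) (hφ0 : φ 0 = u)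
    (h : ∀ᶠ x in 𝓝 0, g (φ x) = g u + z x) (k : ℕ) :
    taylorCoeff k φ = phiCoeff g (fun r => taylorCoeff r z) u k := by
  induction k using Nat.strong_induction_on with
  | _ k ih =>
    cases k with
    | zero => rw [taylorCoeff_zero, hφ0, phiCoeff_zero]
    | succ k =>
      set T : ℂ → ℂ := fun x => ∑ l ∈ Finset.range (k + 1),
        phiCoeff g (fun r => taylorCoeff r z) u l * x ^ l with hT
      have hTa : AnalyticAt ℂ T 0 := Finset.analyticAt_fun_sum _ fun l _ => by fun_prop
      have hT0 : T 0 = u := sum_phiCoeff_zero g _ k u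
      have hTj : ∀ j, taylorCoeff j T =
          if j < k + 1 then phiCoeff g (fun r => taylorCoeff r z) u j else 0 :=
        taylorCoeff_polynomial (k + 1) _
      have h1 : (fun x => φ x - T x) =O[𝓝 0] fun x => x ^ (k + 1) :=
        isBigO_sub_of_taylorCoeff_eq hφ hTa fun j hj => by rw [ih j hj, hTj, if_pos hj]
      have ht : Tendsto (fun x => (φ x, T x)) (𝓝 0) (𝓝 (u, u)) := by
        simpa [hφ0, hT0] using (hφ.continuousAt.prodMk hTa.continuousAt).tendsto
      -- Linearization at `u`: since `φ` and its truncation `T` differ by `O(x ^ (k + 1))`, the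
      -- difference `g ∘ φ - g ∘ T` is `g'(u) (φ - T)` up to `o(x ^ (k + 1))`. As `T` has no term of
      -- order `k + 1`, this determines the next coefficient of `φ`.
      have h2 := (hg.hasStrictDerivAt.isLittleO.comp_tendsto ht).trans_isBigO h1
      have hgT : AnalyticAt ℂ (fun x => g (T x)) 0 :=
        AnalyticAt.fun_comp (by rw [hT0]; exact hg) hTa
      have hzz : AnalyticAt ℂ (fun x => g u + z x) 0 := analyticAt_const.fun_add hz
      have h3 : (fun x => g u + z x - g (T x) - deriv g u * (φ x - T x))
          =o[𝓝 0] fun x => x ^ (k + 1) := by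
        refine h2.congr' ?_ EventuallyEq.rfl
        filter_upwards [h] with x hx
        simp only [Function.comp, ContinuousLinearMap.toSpanSingleton_apply, smul_eq_mul, hx]
        ring
      have h4 := taylorCoeff_eq_zero_of_isLittleO
        ((hzz.fun_sub hgT).fun_sub (analyticAt_const.fun_mul (hφ.fun_sub hTa))) h3
      rw [taylorCoeff_sub (hzz.fun_sub hgT) (analyticAt_const.fun_mul (hφ.fun_sub hTa)),
        taylorCoeff_sub hzz hgT, taylorCoeff_const_mul, taylorCoeff_sub hφ hTa, hTj,
        if_neg (lt_irrefl _), taylorCoeff_add analyticAt_const hz, taylorCoeff_const,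
        if_neg (Nat.succ_ne_zero k), zero_add, sub_zero, sub_eq_zero] at h4
      rw [phiCoeff_succ, h4]
      field_simp

/-- The coefficient of order `k + 1` of `X ∘ ζ ∘ Φ`. -/
theorem taylorCoeff_comp_phi {X ς : ℂ × ℂ → ℂ} {u : ℂ} {g z φ : ℂ → ℂ}
    (hX : AnalyticAt ℂ X (0, u)) (hX0 : ∀ᶠ t in 𝓝 u, X (0, t) = 0) (hς : AnalyticAt ℂ ς (0, u))
    (hς0 : ∀ᶠ t in 𝓝 u, ς (0, t) = 0) (hg : AnalyticAt ℂ g u)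
    (hg' : deriv g u ≠ 0) (hz : AnalyticAt ℂ z 0) (hφ : AnalyticAt ℂ φ 0) (hφ0 : φ 0 = u)
    (h : ∀ᶠ x in 𝓝 0, g (φ x) = g u + z x) {k : ℕ}
    (hk : 1 ≤ k) {a : ℕ → ℂ → ℂ} (ha : ∀ r ∈ Finset.Icc 1 k, xCoeff r X =ᶠ[𝓝 u] a r) :
    taylorCoeff (k + 1) (fun x => X (ς (x, φ x), φ x)) =
      functionalAQ k g (fun r => taylorCoeff r z) (fun l => xCoeff l ς) a u +
      a 1 u * xCoeff (k + 1) ς u + xCoeff (k + 1) X u * xCoeff 1 ς u ^ (k + 1) := by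
  refine taylorCoeff_comp_comp hX hX0 hς hς0 (e := fun x => x) (e' := fun x => x) analyticAt_id rfl
    (by simpa using taylorCoeff_pow_self 1 1) hφ hφ0 analyticAt_id rfl
    (y' := fun x => ∑ l ∈ Finset.range (k + 1), phiCoeff g (fun r => taylorCoeff r z) u l * x ^ l)
    (Finset.analyticAt_fun_sum _ fun l _ => by fun_prop) (sum_phiCoeff_zero g _ k u) hk
    (fun _ _ => rfl) (fun j hj => ?_) ha
  rw [taylorCoeff_polynomial, if_pos (Nat.lt_succ_iff.2 hj),
    taylorCoeff_eq_phiCoeff hg hg' hz hφ hφ0 h]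

theorem taylorCoeff_one_comp_phi {X ς : ℂ × ℂ → ℂ} {u : ℂ} {φ : ℂ → ℂ}
    (hX : AnalyticAt ℂ X (0, u)) (hX0 : ∀ᶠ t in 𝓝 u, X (0, t) = 0) (hς : AnalyticAt ℂ ς (0, u))
    (hς0 : ∀ᶠ t in 𝓝 u, ς (0, t) = 0) (hφ : AnalyticAt ℂ φ 0) (hφ0 : φ 0 = u) :
    taylorCoeff 1 (fun x => X (ς (x, φ x), φ x)) = xCoeff 1 X u * xCoeff 1 ς u := by
  have h1 := taylorCoeff_one_comp hς hς0 (e := fun x => x) analyticAt_id rfl hφ hφ0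
  rw [show taylorCoeff 1 (fun x : ℂ => x) = 1 by simpa using taylorCoeff_pow_self 1 1,
    mul_one] at h1
  rw [← h1]
  refine taylorCoeff_one_comp hX hX0 (e := fun x => ς (x, φ x))
    (analyticAt_comp_pair hς analyticAt_id rfl hφ hφ0) ?_ hφ hφ0
  simpa [hφ0] using hς0.self_of_nhds

open Blowup

@[fun_prop]
theorem AnalyticAt.prod_fst {E : Type*} [NormedAddCommGroup E] [NormedSpace ℂ E] {f : E → ℂ × ℂ}
    {z : E} (hf : AnalyticAt ℂ f z) : AnalyticAt ℂ (fun w => (f w).1) z :=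
  AnalyticAt.fun_comp (g := Prod.fst) analyticAt_fst hf

@[fun_prop]
theorem AnalyticAt.prod_snd {E : Type*} [NormedAddCommGroup E] [NormedSpace ℂ E] {f : E → ℂ × ℂ}
    {z : E} (hf : AnalyticAt ℂ f z) : AnalyticAt ℂ (fun w => (f w).2) z :=
  AnalyticAt.fun_comp (g := Prod.snd) analyticAt_snd hf

/-! ## Determinants and local biholomorphisms of `ℂ²` -/

theorem det_eq_det2 (L : ℂ × ℂ →L[ℂ] ℂ × ℂ) : L.det = det2 (L (1, 0)) (L (0, 1)) := by
  have h := LinearMap.det_toMatrix (Module.Basis.finTwoProd ℂ) (L : ℂ × ℂ →ₗ[ℂ] ℂ × ℂ)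
  rw [ContinuousLinearMap.det, ← h, Matrix.det_fin_two]
  simp [LinearMap.toMatrix_apply, det2]
  ring

theorem map_eq_of_prod (L : ℂ × ℂ →L[ℂ] ℂ × ℂ) (a : ℂ × ℂ) :
    L a = a.1 • L (1, 0) + a.2 • L (0, 1) := by
  rw [← map_smul, ← map_smul, ← map_add]
  congr 1
  ext <;> simp

theorem det2_map (L : ℂ × ℂ →L[ℂ] ℂ × ℂ) (a b : ℂ × ℂ) :
    det2 (L a) (L b) = L.det * det2 a b := by
  rw [det_eq_det2, map_eq_of_prod L a, map_eq_of_prod L b]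
  simp only [det2, Prod.fst_add, Prod.snd_add, Prod.smul_fst, Prod.smul_snd, smul_eq_mul]
  ring

theorem eq_zero_of_map_eq_zero {L : ℂ × ℂ →L[ℂ] ℂ × ℂ} (hL : L.det ≠ 0) {a : ℂ × ℂ} (h : L a = 0) :
    a = 0 := by
  have h1 := det2_map L a (1, 0)
  have h2 := det2_map L a (0, 1)
  rw [h] at h1 h2
  simp only [det2, Prod.fst_zero, Prod.snd_zero, zero_mul, sub_zero, mul_zero, mul_one,
    zero_sub] at h1 h2
  ext
  · simpa [hL] using h2.symm
  · simpa [hL] using h1.symm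

/-- `N` is analytic with invertible derivative at `z`. -/
def IsLocalBihol (N : ℂ × ℂ → ℂ × ℂ) (z : ℂ × ℂ) : Prop :=
  AnalyticAt ℂ N z ∧ (fderiv ℂ N z).det ≠ 0

theorem det_comp_clm (A B : ℂ × ℂ →L[ℂ] ℂ × ℂ) : (A.comp B).det = A.det * B.det := by
  rw [det_eq_det2 (A.comp B), ContinuousLinearMap.comp_apply, ContinuousLinearMap.comp_apply,
    det2_map, ← det_eq_det2]

theorem IsLocalBihol.comp {K N : ℂ × ℂ → ℂ × ℂ} {z : ℂ × ℂ} (hK : IsLocalBihol K (N z))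
    (hN : IsLocalBihol N z) : IsLocalBihol (fun w => K (N w)) z := by
  refine ⟨AnalyticAt.fun_comp hK.1 hN.1, ?_⟩
  rw [show (fun w => K (N w)) = K ∘ N from rfl,
    fderiv_comp z hK.1.differentiableAt hN.1.differentiableAt, det_comp_clm]
  exact mul_ne_zero hK.2 hN.2

theorem IsLocalBihol.congr {K N : ℂ × ℂ → ℂ × ℂ} {z : ℂ × ℂ} (hK : IsLocalBihol K z)
    (h : K =ᶠ[𝓝 z] N) : IsLocalBihol N z :=
  ⟨hK.1.congr h, by rw [← h.fderiv_eq]; exact hK.2⟩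

/-- The chain rule for `A ∘ B = id` gives Jacobian determinants with product `1`. -/
theorem IsLocalBihol.of_leftInverse {A B : ℂ × ℂ → ℂ × ℂ} {z : ℂ × ℂ} (hA : AnalyticAt ℂ A (B z))
    (hB : AnalyticAt ℂ B z) (h : ∀ᶠ w in 𝓝 z, A (B w) = w) :
    IsLocalBihol B z ∧ IsLocalBihol A (B z) := by
  have h1 : fderiv ℂ (A ∘ B) z = ContinuousLinearMap.id ℂ (ℂ × ℂ) := by
    exact (EventuallyEq.fderiv_eq (h : A ∘ B =ᶠ[𝓝 z] id)).trans fderiv_id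
  have h2 : (fderiv ℂ A (B z)).det * (fderiv ℂ B z).det = 1 := by
    rw [← det_comp_clm, ← fderiv_comp z hA.differentiableAt hB.differentiableAt, h1, det_eq_det2]
    simp [det2]
  exact ⟨⟨hB, right_ne_zero_of_mul_eq_one h2⟩, ⟨hA, left_ne_zero_of_mul_eq_one h2⟩⟩

theorem IsLocalBihol.exists_inverse {N : ℂ × ℂ → ℂ × ℂ} {z : ℂ × ℂ} (h : IsLocalBihol N z) :
    ∃ M : ℂ × ℂ → ℂ × ℂ, AnalyticAt ℂ M (N z) ∧ M (N z) = z ∧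
      (∀ᶠ w in 𝓝 z, M (N w) = w) ∧ ∀ᶠ w in 𝓝 (N z), N (M w) = w := by
  set i := (fderiv ℂ N z).toContinuousLinearEquivOfDetNeZero h.2 with hi
  have hi' : (i : ℂ × ℂ →L[ℂ] ℂ × ℂ) = fderiv ℂ N z :=
    ContinuousLinearMap.coe_toContinuousLinearEquivOfDetNeZero _ _
  have hs : HasStrictFDerivAt N (i : ℂ × ℂ →L[ℂ] ℂ × ℂ) z := by
    rw [hi']; exact h.1.hasStrictFDerivAt
  refine ⟨hs.localInverse N i z, ?_, hs.localInverse_apply_image, hs.eventually_left_inverse,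
    hs.eventually_right_inverse⟩
  exact (hs.toOpenPartialHomeomorph N).analyticAt_symm' hs.mem_toOpenPartialHomeomorph_source h.1
    hi'.symm

/-! ## The charts of the blow-up -/

theorem chartY_eq_chartX {z : ℂ × ℂ} (h : z.1 ≠ 0) : chartY z = chartX (z.1 * z.2, z.1⁻¹) := by
  ext
  · rfl
  · simp only [chartX, chartY]; field_simp
  · simp only [chartX, chartY, if_neg h]

theorem chartX_eq_chartY {z : ℂ × ℂ} (h : z.2 ≠ 0) : chartX z = chartY (z.2⁻¹, z.2 * z.1) := by
  rw [chartY_eq_chartX (inv_ne_zero h)]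
  congr 1
  ext
  · simp only; field_simp
  · simp

@[simp] theorem coordX_chartX (z : ℂ × ℂ) : coordX (chartX z) = z := rfl

theorem chartY_slope_ne {z : ℂ × ℂ} (h : (chartY z).slope ≠ OnePoint.infty) : z.1 ≠ 0 := by
  intro h0
  apply h
  simp [chartY, h0]

/-- Outside the divisor the slope is forced by the point, so equalities in the blow-up reduce to
equalities in `ℂ²`. -/
theorem Blowup.ext_of_pt {a b : Blowup} (h : a.pt = b.pt) (h0 : a.pt ≠ 0) : a = b := by
  refine Blowup.ext h ?_
  have key : ∀ c : Blowup, c.pt ≠ 0 → c.slope = slopeOf c.pt := fun c hc => by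
    unfold slopeOf
    induction hs : c.slope using OnePoint.rec with
    | infty => rw [if_pos (c.mem.1 hs)]
    | coe u =>
      have h2 := c.mem.2 u hs
      have h1 : c.pt.1 ≠ 0 := fun h1 => hc (by ext <;> simp [h1, h2])
      rw [if_neg h1, h2, mul_div_cancel_right₀ _ h1]
  rw [key a h0, key b (h ▸ h0), h]

theorem ofPoint_eq_chartX {z : ℂ × ℂ} (h : z.1 ≠ 0) : ofPoint z = chartX (z.1, z.2 / z.1) :=
  Blowup.ext_of_pt (by simp [ofPoint, chartX, h]) fun h0 => h (congrArg Prod.fst h0)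

theorem ofPoint_eq_chartY {z : ℂ × ℂ} (h : z.2 ≠ 0) : ofPoint z = chartY (z.1 / z.2, z.2) :=
  Blowup.ext_of_pt (by simp [ofPoint, chartY, h]) fun h0 => h (congrArg Prod.snd h0)

theorem ofPoint_pt {a : Blowup} (h : a.pt ≠ 0) : ofPoint a.pt = a :=
  Blowup.ext_of_pt rfl h

theorem isLocalBihol_transition {z : ℂ × ℂ} (h : z.1 ≠ 0) :
    IsLocalBihol (fun w : ℂ × ℂ => (w.1 * w.2, w.1⁻¹)) z := by
  refine (IsLocalBihol.of_leftInverse (A := fun w => (w.2⁻¹, w.2 * w.1)) ?_ ?_ ?_).1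
  · have : AnalyticAt ℂ (fun w : ℂ × ℂ => w.2⁻¹) (z.1 * z.2, z.1⁻¹) :=
      analyticAt_snd.inv (inv_ne_zero h)
    exact this.prod (by fun_prop)
  · exact AnalyticAt.prod (by fun_prop) (analyticAt_fst.inv h)
  · filter_upwards [continuous_fst.continuousAt.eventually_ne h] with w hw
    ext
    · simp
    · simp only; field_simp

theorem isLocalBihol_divX {z : ℂ × ℂ} (h : z.1 ≠ 0) :
    IsLocalBihol (fun w : ℂ × ℂ => (w.1, w.2 / w.1)) z := by
  refine (IsLocalBihol.of_leftInverse (A := fun w => (w.1, w.2 * w.1)) (by fun_prop) ?_ ?_).1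
  · exact analyticAt_fst.prod (analyticAt_snd.fun_div analyticAt_fst h)
  · filter_upwards [continuous_fst.continuousAt.eventually_ne h] with w hw
    ext
    · rfl
    · simp only; field_simp

theorem isLocalBihol_divY {z : ℂ × ℂ} (h : z.2 ≠ 0) :
    IsLocalBihol (fun w : ℂ × ℂ => (w.1 / w.2, w.2)) z := by
  refine (IsLocalBihol.of_leftInverse (A := fun w => (w.1 * w.2, w.2)) (by fun_prop) ?_ ?_).1
  · exact (analyticAt_fst.fun_div analyticAt_snd h).prod analyticAt_snd
  · filter_upwards [continuous_snd.continuousAt.eventually_ne h] with w hw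
    ext
    · simp only; field_simp
    · rfl

theorem isLocalBihol_mulX {z : ℂ × ℂ} (h : z.1 ≠ 0) :
    IsLocalBihol (fun w : ℂ × ℂ => (w.1, w.2 * w.1)) z := by
  refine (IsLocalBihol.of_leftInverse (A := fun w => (w.1, w.2 / w.1)) ?_ (by fun_prop) ?_).1
  · exact analyticAt_fst.prod (analyticAt_snd.fun_div analyticAt_fst h)
  · filter_upwards [continuous_fst.continuousAt.eventually_ne h] with w hw
    ext
    · rfl
    · simp only; field_simp

theorem isLocalBihol_mulY {z : ℂ × ℂ} (h : z.2 ≠ 0) :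
    IsLocalBihol (fun w : ℂ × ℂ => (w.1 * w.2, w.2)) z := by
  refine (IsLocalBihol.of_leftInverse (A := fun w => (w.1 / w.2, w.2)) ?_ (by fun_prop) ?_).1
  · have : AnalyticAt ℂ (fun w : ℂ × ℂ => w.1 / w.2) (z.1 * z.2, z.2) :=
      analyticAt_fst.fun_div analyticAt_snd h
    exact this.prod analyticAt_snd
  · filter_upwards [continuous_snd.continuousAt.eventually_ne h] with w hw
    ext
    · simp only; field_simp
    · rfl

/-! ## Biholomorphisms into the blow-up -/

theorem isBiholAt_iff {F : ℂ × ℂ → Blowup} {z : ℂ × ℂ} :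
    IsBiholAt F z ↔ (∃ N, IsLocalBihol N z ∧ ∀ᶠ w in 𝓝 z, F w = chartX (N w)) ∨
      ∃ N, IsLocalBihol N z ∧ ∀ᶠ w in 𝓝 z, F w = chartY (N w) := by
  constructor
  · rintro ⟨c, rfl | rfl, N, h1, h2, h3⟩
    · exact Or.inl ⟨N, ⟨h1, h2⟩, h3⟩
    · exact Or.inr ⟨N, ⟨h1, h2⟩, h3⟩
  · rintro (⟨N, h1, h2⟩ | ⟨N, h1, h2⟩)
    · exact ⟨_, Or.inl rfl, N, h1.1, h1.2, h2⟩
    · exact ⟨_, Or.inr rfl, N, h1.1, h1.2, h2⟩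

theorem Blowup.IsBiholAt.congr {F G : ℂ × ℂ → Blowup} {z : ℂ × ℂ} (h : IsBiholAt F z)
    (hFG : F =ᶠ[𝓝 z] G) : IsBiholAt G z := by
  obtain ⟨c, hc, N, h1, h2, h3⟩ := h
  refine ⟨c, hc, N, h1, h2, ?_⟩
  filter_upwards [h3, hFG] with w e1 e2
  rw [← e2, e1]

theorem isBiholAt_chartX {N : ℂ × ℂ → ℂ × ℂ} {z : ℂ × ℂ} (h : IsLocalBihol N z) :
    IsBiholAt (fun w => chartX (N w)) z :=
  isBiholAt_iff.2 (Or.inl ⟨N, h, Eventually.of_forall fun _ => rfl⟩)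

theorem isBiholAt_chartY {N : ℂ × ℂ → ℂ × ℂ} {z : ℂ × ℂ} (h : IsLocalBihol N z) :
    IsBiholAt (fun w => chartY (N w)) z :=
  isBiholAt_iff.2 (Or.inr ⟨N, h, Eventually.of_forall fun _ => rfl⟩)

/-- If the map was given in the chart `(v, y)`, finiteness of the slope means `v ≠ 0` at the image,
where the change of charts is biholomorphic. -/
theorem Blowup.IsBiholAt.exists_chartX {F : ℂ × ℂ → Blowup} {z : ℂ × ℂ} (h : IsBiholAt F z)
    (hs : (F z).slope ≠ OnePoint.infty) :
    IsLocalBihol (fun w => coordX (F w)) z ∧ ∀ᶠ w in 𝓝 z, F w = chartX (coordX (F w)) := by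
  suffices ∃ N, IsLocalBihol N z ∧ ∀ᶠ w in 𝓝 z, F w = chartX (N w) by
    obtain ⟨N, hN, hF⟩ := this
    refine ⟨hN.congr ?_, ?_⟩
    · filter_upwards [hF] with w hw
      rw [hw, coordX_chartX]
    · filter_upwards [hF] with w hw
      rw [hw, coordX_chartX]
  rcases isBiholAt_iff.1 h with h | ⟨N, hN, hF⟩
  · exact h
  · rw [hF.self_of_nhds] at hs
    have h0 := chartY_slope_ne hs
    refine ⟨_, (isLocalBihol_transition h0).comp hN, ?_⟩
    have h1 : ∀ᶠ w in 𝓝 z, (N w).1 ≠ 0 :=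
      (continuous_fst.continuousAt.comp hN.1.continuousAt).eventually_ne h0
    filter_upwards [hF, h1] with w h2 h3
    rw [h2, chartY_eq_chartX h3]

theorem Blowup.IsBiholAt.exists_chartY {F : ℂ × ℂ → Blowup} {z : ℂ × ℂ} (h : IsBiholAt F z)
    (hs : (F z).slope = OnePoint.infty) :
    ∃ N, IsLocalBihol N z ∧ ∀ᶠ w in 𝓝 z, F w = chartY (N w) := by
  rcases isBiholAt_iff.1 h with ⟨N, hN, hF⟩ | h
  · rw [hF.self_of_nhds] at hs
    exact absurd hs (OnePoint.coe_ne_infty _)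
  · exact h

theorem Blowup.IsBiholAt.analyticAt_pt {F : ℂ × ℂ → Blowup} {z : ℂ × ℂ} (h : IsBiholAt F z) :
    AnalyticAt ℂ (fun w => (F w).pt) z := by
  rcases isBiholAt_iff.1 h with ⟨N, hN, hF⟩ | ⟨N, hN, hF⟩
  · have h1 : AnalyticAt ℂ (fun w => ((N w).1, (N w).2 * (N w).1)) z := by
      have := hN.1; fun_prop
    refine h1.congr ?_
    filter_upwards [hF] with w hw
    rw [hw]; rfl
  · have h1 : AnalyticAt ℂ (fun w => ((N w).1 * (N w).2, (N w).2)) z := by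
      have := hN.1; fun_prop
    refine h1.congr ?_
    filter_upwards [hF] with w hw
    rw [hw]; rfl

theorem Blowup.IsBiholAt.isLocalBihol_pt {F : ℂ × ℂ → Blowup} {z : ℂ × ℂ} (h : IsBiholAt F z)
    (h0 : (F z).pt ≠ 0) : IsLocalBihol (fun w => (F w).pt) z := by
  rcases isBiholAt_iff.1 h with ⟨N, hN, hF⟩ | ⟨N, hN, hF⟩
  · rw [hF.self_of_nhds] at h0
    have h1 : (N z).1 ≠ 0 := fun h1 => h0 (by simp [chartX, h1])
    refine ((isLocalBihol_mulX h1).comp hN).congr ?_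
    filter_upwards [hF] with w hw
    rw [hw]; rfl
  · rw [hF.self_of_nhds] at h0
    have h1 : (N z).2 ≠ 0 := fun h1 => h0 (by simp [chartY, h1])
    refine ((isLocalBihol_mulY h1).comp hN).congr ?_
    filter_upwards [hF] with w hw
    rw [hw]; rfl

theorem isBiholAt_ofPoint {h : ℂ × ℂ → ℂ × ℂ} {z : ℂ × ℂ} (hh : IsLocalBihol h z) (h0 : h z ≠ 0) :
    IsBiholAt (fun w => ofPoint (h w)) z := by
  by_cases h1 : (h z).1 = 0
  · have h2 : (h z).2 ≠ 0 := fun h2 => h0 (Prod.ext h1 h2)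
    refine (isBiholAt_chartY ((isLocalBihol_divY h2).comp hh)).congr ?_
    filter_upwards [(continuous_snd.continuousAt.comp hh.1.continuousAt).eventually_ne h2] with w hw
    exact (ofPoint_eq_chartY hw).symm
  · refine (isBiholAt_chartX ((isLocalBihol_divX h1).comp hh)).congr ?_
    filter_upwards [(continuous_fst.continuousAt.comp hh.1.continuousAt).eventually_ne h1] with w hw
    exact (ofPoint_eq_chartX hw).symm

/-! ## The lift of a germ tangent to the identity -/

theorem IsTangentToId.isLocalBihol {H : ℂ × ℂ → ℂ × ℂ} (hH : IsTangentToId H) :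
    IsLocalBihol H 0 :=
  ⟨hH.1, by rw [hH.2.2, det_eq_det2]; simp [det2]⟩

theorem IsTangentToId.exists_inverse {H : ℂ × ℂ → ℂ × ℂ} (hH : IsTangentToId H) :
    ∃ G, IsTangentToId G ∧ (∀ᶠ z in 𝓝 0, G (H z) = z) ∧ ∀ᶠ z in 𝓝 0, H (G z) = z := by
  obtain ⟨G, hG, hG0, h1, h2⟩ := hH.isLocalBihol.exists_inverse
  rw [hH.2.1] at hG hG0 h2
  refine ⟨G, ⟨hG, hG0, ?_⟩, h1, h2⟩
  have h3 : fderiv ℂ (G ∘ H) 0 = ContinuousLinearMap.id ℂ (ℂ × ℂ) :=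
    (EventuallyEq.fderiv_eq (h1 : G ∘ H =ᶠ[𝓝 0] id)).trans fderiv_id
  rw [fderiv_comp 0 (by rw [hH.2.1]; exact hG.differentiableAt) hH.1.differentiableAt, hH.2.2,
    hH.2.1, ContinuousLinearMap.comp_id] at h3
  exact h3

theorem tendsto_blowup (u : ℂ) :
    Tendsto (fun z : ℂ × ℂ => (z.1, z.2 * z.1)) (𝓝 (0, u)) (𝓝 0) := by
  have : Continuous fun z : ℂ × ℂ => (z.1, z.2 * z.1) := by fun_prop
  simpa [Prod.zero_eq_mk] using this.tendsto (0, u)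

theorem analyticAt_comp_blowup {f : ℂ × ℂ → ℂ} (hf : AnalyticAt ℂ f 0) (u : ℂ) :
    AnalyticAt ℂ (fun z : ℂ × ℂ => f (z.1, z.2 * z.1)) (0, u) :=
  AnalyticAt.fun_comp (f := fun z : ℂ × ℂ => (z.1, z.2 * z.1))
    (by simpa [Prod.zero_eq_mk] using hf) (by fun_prop)

theorem xCoeff_one_comp_blowup {f : ℂ × ℂ → ℂ} (hf : AnalyticAt ℂ f 0) (t : ℂ) :
    xCoeff 1 (fun z => f (z.1, z.2 * z.1)) t = fderiv ℂ f 0 (1, t) := by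
  unfold xCoeff
  rw [taylorCoeff_one]
  have h1 : HasDerivAt (fun x : ℂ => (x, t * x)) ((1 : ℂ), t) 0 :=
    (hasDerivAt_id (0 : ℂ)).prodMk (by simpa using (hasDerivAt_id (0 : ℂ)).const_mul t)
  have h2 : HasFDerivAt f (fderiv ℂ f 0) ((fun x : ℂ => (x, t * x)) 0) := by
    simpa [Prod.zero_eq_mk] using hf.differentiableAt.hasFDerivAt
  exact (h2.comp_hasDerivAt (0 : ℂ) h1).deriv

/-- `f (x, u x)` vanishes on the divisor, so a factor `x` splits off; the quotient on the divisor is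
the derivative along the line of slope `t`. -/
theorem exists_div_blowup {f : ℂ × ℂ → ℂ} (hf : AnalyticAt ℂ f 0) (hf0 : f 0 = 0) (u : ℂ) :
    ∃ F : ℂ × ℂ → ℂ, AnalyticAt ℂ F (0, u) ∧
      (∀ᶠ z in 𝓝 (0, u), f (z.1, z.2 * z.1) = z.1 * F z) ∧
      ∀ᶠ t in 𝓝 u, F (0, t) = fderiv ℂ f 0 (1, t) := by
  have ha := analyticAt_comp_blowup hf u
  obtain ⟨F, hF, h1, h2⟩ := ha.exists_eq_pow_mul (n := 1) fun j hj => by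
    refine Eventually.of_forall fun t => ?_
    rw [Nat.lt_one_iff.1 hj, xCoeff_zero]
    simpa [Prod.zero_eq_mk] using hf0
  refine ⟨F, hF, by simpa using h1, ?_⟩
  filter_upwards [h2] with t ht
  rw [← ht, xCoeff_one_comp_blowup hf]

theorem lift_pt (H : ℂ × ℂ → ℂ × ℂ) (a : Blowup) : (lift H a).pt = H a.pt := by
  unfold lift
  split_ifs with h
  · exact h.symm
  · rfl

theorem lift_of_ne {H : ℂ × ℂ → ℂ × ℂ} {a : Blowup} (h : H a.pt ≠ 0) :
    lift H a = ofPoint (H a.pt) := if_neg h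

theorem lift_of_eq {H : ℂ × ℂ → ℂ × ℂ} {a : Blowup} (h : H a.pt = 0) :
    lift H a = ⟨0, a.slope, onLine_zero _⟩ := if_pos h

theorem lift_of_pt_eq_zero {H : ℂ × ℂ → ℂ × ℂ} (hH : H 0 = 0) {a : Blowup} (h : a.pt = 0) :
    lift H a = a := by
  rw [lift_of_eq (by rw [h, hH])]
  exact Blowup.ext h.symm rfl

theorem lift_lift_of_leftInverse {G H : ℂ × ℂ → ℂ × ℂ} (hG : G 0 = 0) (hH : H 0 = 0) {a : Blowup}
    (h : G (H a.pt) = a.pt) : lift G (lift H a) = a := by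
  by_cases h0 : H a.pt = 0
  · have h1 : a.pt = 0 := by rw [← h, h0, hG]
    rw [lift_of_pt_eq_zero hH h1, lift_of_pt_eq_zero hG h1]
  · have h1 : a.pt ≠ 0 := fun h1 => h0 (by rw [h1, hH])
    rw [lift_of_ne h0, lift_of_ne (by change G (H a.pt) ≠ 0; rw [h]; exact h1)]
    change ofPoint (G (H a.pt)) = a
    rw [h, ofPoint_pt h1]

/-- The lift in the chart `(x, u)`, near a point of the divisor. -/
theorem IsTangentToId.exists_lift_chartX {H : ℂ × ℂ → ℂ × ℂ} (hH : IsTangentToId H) (u : ℂ) :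
    ∃ K : ℂ × ℂ → ℂ × ℂ, AnalyticAt ℂ K (0, u) ∧
      (∀ᶠ z in 𝓝 (0, u), lift H (chartX z) = chartX (K z)) ∧ (∀ᶠ t in 𝓝 u, K (0, t) = (0, t)) ∧
      ∃ h : ℂ × ℂ → ℂ, AnalyticAt ℂ h (0, u) ∧ (∀ᶠ z in 𝓝 (0, u), (K z).1 = z.1 * h z) ∧
        ∀ᶠ t in 𝓝 u, h (0, t) = 1 := by
  have hd := hH.1.differentiableAt
  obtain ⟨h₁, ha₁, he₁, hv₁⟩ := exists_div_blowup (f := fun z => (H z).1) (hH.1.prod_fst)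
    (by simp [hH.2.1]) u
  obtain ⟨h₂, ha₂, he₂, hv₂⟩ := exists_div_blowup (f := fun z => (H z).2) (hH.1.prod_snd)
    (by simp [hH.2.1]) u
  rw [fderiv.fst hd, hH.2.2] at hv₁
  rw [fderiv.snd hd, hH.2.2] at hv₂
  simp only [ContinuousLinearMap.comp_id, ContinuousLinearMap.coe_fst',
    ContinuousLinearMap.coe_snd'] at hv₁ hv₂
  have hne : ∀ᶠ z in 𝓝 ((0 : ℂ), u), h₁ z ≠ 0 :=
    ha₁.continuousAt.eventually_ne (by rw [hv₁.self_of_nhds]; exact one_ne_zero)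
  -- `H (x, u x) = (x h₁, x h₂)`, so the image has slope `h₂ / h₁`; tangency to the identity gives
  -- `h₁ = 1` and `h₂ = t` on the divisor.
  refine ⟨fun z => (z.1 * h₁ z, h₂ z / h₁ z), ?_, ?_, ?_, h₁, ha₁, ?_, hv₁⟩
  · exact (analyticAt_fst.fun_mul ha₁).prod (ha₂.fun_div ha₁ hne.self_of_nhds)
  · have hv₂' : ∀ᶠ z in 𝓝 ((0 : ℂ), u), h₂ (0, z.2) = z.2 :=
      (continuous_snd.tendsto ((0 : ℂ), u)).eventually hv₂
    have hv₁' : ∀ᶠ z in 𝓝 ((0 : ℂ), u), h₁ (0, z.2) = 1 :=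
      (continuous_snd.tendsto ((0 : ℂ), u)).eventually hv₁
    filter_upwards [he₁, he₂, hne, hv₁', hv₂'] with z e1 e2 e3 e4 e5
    by_cases hz : z.1 = 0
    · obtain ⟨x, t⟩ := z
      simp only at hz
      subst hz
      rw [lift_of_pt_eq_zero hH.2.1 (by simp [chartX])]
      simp only [e4, e5, div_one, zero_mul]
    · have h3 : H (chartX z).pt = (z.1 * h₁ z, z.1 * h₂ z) := Prod.ext e1 e2
      have h4 : (H (chartX z).pt).1 ≠ 0 := by rw [h3]; exact mul_ne_zero hz e3
      rw [lift_of_ne fun h0 => h4 (congrArg Prod.fst h0), ofPoint_eq_chartX h4, h3]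
      simp only [mul_div_mul_left _ _ hz]
  · filter_upwards [hv₁, hv₂] with t e1 e2
    simp [e1, e2]
  · exact Eventually.of_forall fun _ => rfl

/-- The lift in the chart `(v, y)`, near a point of the divisor. -/
theorem IsTangentToId.exists_lift_chartY {H : ℂ × ℂ → ℂ × ℂ} (hH : IsTangentToId H) (v : ℂ) :
    ∃ K : ℂ × ℂ → ℂ × ℂ, AnalyticAt ℂ K (v, 0) ∧
      (∀ᶠ z in 𝓝 (v, 0), lift H (chartY z) = chartY (K z)) ∧ K (v, 0) = (v, 0) := by
  -- Exchanging the source coordinates makes `y` the first one, so that `exists_div_blowup` applies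
  -- in this chart too.
  have hsw : AnalyticAt ℂ (fun z : ℂ × ℂ => H (z.2, z.1)) 0 :=
    AnalyticAt.fun_comp (f := fun z : ℂ × ℂ => (z.2, z.1))
      (by simpa [Prod.zero_eq_mk] using hH.1) (by fun_prop)
  have hd := hsw.differentiableAt
  have hder : ∀ t : ℂ, fderiv ℂ (fun z : ℂ × ℂ => H (z.2, z.1)) 0 (1, t) = (t, 1) := fun t => by
    have h1 : HasFDerivAt (fun z : ℂ × ℂ => (z.2, z.1))
        ((ContinuousLinearMap.snd ℂ ℂ ℂ).prod (ContinuousLinearMap.fst ℂ ℂ ℂ)) 0 :=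
      hasFDerivAt_snd.prodMk hasFDerivAt_fst
    have h2 : HasFDerivAt H (ContinuousLinearMap.id ℂ (ℂ × ℂ))
        ((fun z : ℂ × ℂ => (z.2, z.1)) 0) := by
      rw [← hH.2.2]
      simpa [Prod.zero_eq_mk] using hH.1.differentiableAt.hasFDerivAt
    have h3 := (h2.comp (0 : ℂ × ℂ) h1).fderiv
    rw [show (H ∘ fun z : ℂ × ℂ => (z.2, z.1)) = fun z : ℂ × ℂ => H (z.2, z.1) from rfl] at h3
    rw [h3]
    simp
  obtain ⟨h₁, ha₁, he₁, hv₁⟩ := exists_div_blowup (f := fun z => (H (z.2, z.1)).1) hsw.prod_fst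
    (by simpa [Prod.zero_eq_mk] using congrArg Prod.fst hH.2.1) v
  obtain ⟨h₂, ha₂, he₂, hv₂⟩ := exists_div_blowup (f := fun z => (H (z.2, z.1)).2) hsw.prod_snd
    (by simpa [Prod.zero_eq_mk] using congrArg Prod.snd hH.2.1) v
  rw [fderiv.fst hd] at hv₁
  rw [fderiv.snd hd] at hv₂
  simp only [ContinuousLinearMap.comp_apply, hder, ContinuousLinearMap.coe_fst',
    ContinuousLinearMap.coe_snd'] at hv₁ hv₂
  have hne : ∀ᶠ z in 𝓝 ((0 : ℂ), v), h₂ z ≠ 0 :=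
    ha₂.continuousAt.eventually_ne (by rw [hv₂.self_of_nhds]; exact one_ne_zero)
  have hs : Tendsto (fun z : ℂ × ℂ => (z.2, z.1)) (𝓝 (v, 0)) (𝓝 (0, v)) :=
    (by fun_prop : Continuous fun z : ℂ × ℂ => (z.2, z.1)).tendsto (v, 0)
  refine ⟨fun z => (h₁ (z.2, z.1) / h₂ (z.2, z.1), z.2 * h₂ (z.2, z.1)), ?_, ?_, ?_⟩
  · have b₁ : AnalyticAt ℂ (fun z : ℂ × ℂ => h₁ (z.2, z.1)) (v, 0) :=
      AnalyticAt.fun_comp (f := fun z : ℂ × ℂ => (z.2, z.1)) ha₁ (by fun_prop)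
    have b₂ : AnalyticAt ℂ (fun z : ℂ × ℂ => h₂ (z.2, z.1)) (v, 0) :=
      AnalyticAt.fun_comp (f := fun z : ℂ × ℂ => (z.2, z.1)) ha₂ (by fun_prop)
    exact (b₁.fun_div b₂ hne.self_of_nhds).prod (analyticAt_snd.fun_mul b₂)
  · have hv₂' : ∀ᶠ z in 𝓝 (v, (0 : ℂ)), h₂ (0, z.1) = 1 :=
      (continuous_fst.tendsto (v, (0 : ℂ))).eventually hv₂
    have hv₁' : ∀ᶠ z in 𝓝 (v, (0 : ℂ)), h₁ (0, z.1) = z.1 :=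
      (continuous_fst.tendsto (v, (0 : ℂ))).eventually hv₁
    filter_upwards [hs.eventually he₁, hs.eventually he₂, hs.eventually hne, hv₁', hv₂']
      with z e1 e2 e3 e4 e5
    by_cases hz : z.2 = 0
    · obtain ⟨x, t⟩ := z
      simp only at hz
      subst hz
      rw [lift_of_pt_eq_zero hH.2.1 (by simp [chartY])]
      simp only [e4, e5, div_one, zero_mul]
    · have h3 : H (chartY z).pt = (z.2 * h₁ (z.2, z.1), z.2 * h₂ (z.2, z.1)) := Prod.ext e1 e2
      have h4 : (H (chartY z).pt).2 ≠ 0 := by rw [h3]; exact mul_ne_zero hz e3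
      rw [lift_of_ne fun h0 => h4 (congrArg Prod.snd h0), ofPoint_eq_chartY h4, h3]
      simp only [mul_div_mul_left _ _ hz]
  · simp [hv₁.self_of_nhds, hv₂.self_of_nhds]

/-! ### Biholomorphy and injectivity of the lift -/

theorem chartX_injective : Function.Injective chartX := fun a b h => by
  rw [← coordX_chartX a, h, coordX_chartX]

theorem chartY_injective : Function.Injective chartY := fun a b h => by
  have h2 : a.2 = b.2 := congrArg (fun c : Blowup => c.pt.2) h
  have h3 : (chartY a).slope = (chartY b).slope := by rw [h]
  refine Prod.ext ?_ h2
  simp only [chartY] at h3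
  split_ifs at h3 with h4 h5 h5
  · rw [h4, h5]
  · exact absurd h3 (OnePoint.infty_ne_coe _)
  · exact absurd h3 (OnePoint.coe_ne_infty _)
  · exact inv_injective (OnePoint.coe_injective h3)

theorem continuous_chartX_pt : Continuous fun z : ℂ × ℂ => (chartX z).pt := by
  simp only [chartX]; fun_prop

theorem continuous_chartY_pt : Continuous fun z : ℂ × ℂ => (chartY z).pt := by
  simp only [chartY]; fun_prop

/-- The lift of the inverse germ, analytic in the same chart, is a left inverse. -/
theorem IsTangentToId.isBiholAt_lift_chartX {H : ℂ × ℂ → ℂ × ℂ} (hH : IsTangentToId H) (u : ℂ) :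
    IsBiholAt (fun z => lift H (chartX z)) (0, u) := by
  obtain ⟨G, hG, hGH, -⟩ := hH.exists_inverse
  obtain ⟨K, hK, h1, h2, -⟩ := hH.exists_lift_chartX u
  obtain ⟨M, hM, h3, -⟩ := hG.exists_lift_chartX u
  have hK0 := h2.self_of_nhds
  have hKt : Tendsto K (𝓝 (0, u)) (𝓝 (0, u)) := by
    simpa [hK0] using hK.continuousAt.tendsto
  refine (isBiholAt_chartX (N := K) ?_).congr (EventuallyEq.symm h1)
  refine (IsLocalBihol.of_leftInverse (A := M) (by rw [hK0]; exact hM) hK ?_).1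
  have ht : Tendsto (fun z => (chartX z).pt) (𝓝 (0, u)) (𝓝 0) := by
    simpa [chartX, Prod.zero_eq_mk] using continuous_chartX_pt.tendsto (0, u)
  filter_upwards [h1, hKt.eventually h3, ht.eventually hGH] with z e1 e2 e3
  apply chartX_injective
  rw [← e2, ← e1, lift_lift_of_leftInverse hG.2.1 hH.2.1 e3]

theorem IsTangentToId.isBiholAt_lift_chartY {H : ℂ × ℂ → ℂ × ℂ} (hH : IsTangentToId H) (v : ℂ) :
    IsBiholAt (fun z => lift H (chartY z)) (v, 0) := by
  obtain ⟨G, hG, hGH, -⟩ := hH.exists_inverse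
  obtain ⟨K, hK, h1, hK0⟩ := hH.exists_lift_chartY v
  obtain ⟨M, hM, h3, -⟩ := hG.exists_lift_chartY v
  have hKt : Tendsto K (𝓝 (v, 0)) (𝓝 (v, 0)) := by
    simpa [hK0] using hK.continuousAt.tendsto
  refine (isBiholAt_chartY (N := K) ?_).congr (EventuallyEq.symm h1)
  refine (IsLocalBihol.of_leftInverse (A := M) (by rw [hK0]; exact hM) hK ?_).1
  have ht : Tendsto (fun z => (chartY z).pt) (𝓝 (v, 0)) (𝓝 0) := by
    simpa [chartY, Prod.zero_eq_mk] using continuous_chartY_pt.tendsto (v, 0)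
  filter_upwards [h1, hKt.eventually h3, ht.eventually hGH] with z e1 e2 e3
  apply chartY_injective
  rw [← e2, ← e1, lift_lift_of_leftInverse hG.2.1 hH.2.1 e3]

theorem Blowup.IsBiholAt.comp {F : ℂ × ℂ → Blowup} {N : ℂ × ℂ → ℂ × ℂ} {z : ℂ × ℂ}
    (hF : IsBiholAt F (N z)) (hN : IsLocalBihol N z) : IsBiholAt (fun w => F (N w)) z := by
  rcases isBiholAt_iff.1 hF with ⟨M, hM, h⟩ | ⟨M, hM, h⟩
  · exact (isBiholAt_chartX (hM.comp hN)).congr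
      (EventuallyEq.symm (hN.1.continuousAt.eventually h))
  · exact (isBiholAt_chartY (hM.comp hN)).congr
      (EventuallyEq.symm (hN.1.continuousAt.eventually h))

/-- The lift of a germ tangent to the identity is biholomorphic near the divisor. -/
theorem IsTangentToId.isBiholAt_lift {H : ℂ × ℂ → ℂ × ℂ} (hH : IsTangentToId H) :
    ∀ᶠ y in 𝓝 (0 : ℂ × ℂ), ∀ (F : ℂ × ℂ → Blowup) (z : ℂ × ℂ), (F z).pt = y → IsBiholAt F z →
      IsBiholAt (fun w => lift H (F w)) z := by
  obtain ⟨G, hG, hGH, -⟩ := hH.exists_inverse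
  have ht : Tendsto H (𝓝 0) (𝓝 0) := by simpa [hH.2.1] using hH.1.continuousAt.tendsto
  filter_upwards [hH.1.eventually_analyticAt, ht.eventually hG.1.eventually_analyticAt,
    hGH.eventually_nhds] with y h1 h2 h3 F z hy hF
  -- On the divisor the explicit form of the lift in the two charts is used; off it the lift is just
  -- `H` read in `ℂ²`.
  by_cases h0 : y = 0
  · subst h0
    rcases isBiholAt_iff.1 hF with ⟨N, hN, h⟩ | ⟨N, hN, h⟩
    · rw [h.self_of_nhds] at hy
      have h4 : (N z).1 = 0 := congrArg Prod.fst hy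
      refine Blowup.IsBiholAt.congr (F := fun w => lift H (chartX (N w))) ?_ ?_
      · refine Blowup.IsBiholAt.comp (F := fun w => lift H (chartX w)) ?_ hN
        rw [show N z = (0, (N z).2) from Prod.ext h4 rfl]
        exact hH.isBiholAt_lift_chartX _
      · filter_upwards [h] with w hw
        rw [hw]
    · rw [h.self_of_nhds] at hy
      have h4 : (N z).2 = 0 := congrArg Prod.snd hy
      refine Blowup.IsBiholAt.congr (F := fun w => lift H (chartY (N w))) ?_ ?_
      · refine Blowup.IsBiholAt.comp (F := fun w => lift H (chartY w)) ?_ hN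
        rw [show N z = ((N z).1, 0) from Prod.ext rfl h4]
        exact hH.isBiholAt_lift_chartY _
      · filter_upwards [h] with w hw
        rw [hw]
  · have h4 : H y ≠ 0 := fun h4 => h0 (by rw [← h3.self_of_nhds, h4, hG.2.1])
    have hL : IsLocalBihol H y := (IsLocalBihol.of_leftInverse h2 h1 h3).1
    have hp := hF.isLocalBihol_pt (by rw [hy]; exact h0)
    have hHp : IsLocalBihol (fun w => H (F w).pt) z :=
      IsLocalBihol.comp (K := H) (N := fun w => (F w).pt) (by simpa only [hy] using hL) hp
    refine (isBiholAt_ofPoint hHp (by rw [hy]; exact h4)).congr ?_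
    filter_upwards [hHp.1.continuousAt.eventually_ne (show H (F z).pt ≠ 0 by rw [hy]; exact h4)]
      with w hw
    exact (lift_of_ne hw).symm

theorem lift_injOn {H : ℂ × ℂ → ℂ × ℂ} {B : Set (ℂ × ℂ)} (hH : Set.InjOn H B)
    (hH0 : H 0 = 0) : Set.InjOn (lift H) {a | a.pt ∈ B} := fun a ha b hb h => by
  have h1 : a.pt = b.pt := hH ha hb (by rw [← lift_pt H a, h, lift_pt])
  by_cases h0 : a.pt = 0
  · rwa [lift_of_pt_eq_zero hH0 h0, lift_of_pt_eq_zero hH0 (h1 ▸ h0)] at h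
  · exact Blowup.ext_of_pt h1 h0

/-! ## The direct image of a vector field -/

/-- The homogeneous part of degree `k` of a vector field. -/
noncomputable def homVec (k : ℕ) (v : ℂ × ℂ → ℂ × ℂ) (z : ℂ × ℂ) : ℂ × ℂ :=
  (homPart k (fun w => (v w).1) z, homPart k (fun w => (v w).2) z)

/-- By homogeneity the leading part of `f (y t)` divided by `t ^ n` is its value at `t⁻¹ • y t`,
while the remainder `O(‖w‖ ^ (n + 1))` is negligible. A curve tangent to `t z` therefore sees only
the leading part. -/
theorem tendsto_homPart {f : ℂ × ℂ → ℂ} (hf : AnalyticAt ℂ f 0) {n : ℕ}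
    (h0 : ∀ j < n, ∀ z, homPart j f z = 0) {y : ℂ → ℂ × ℂ} {z : ℂ × ℂ}
    (hy : Tendsto (fun t => t⁻¹ • y t) (𝓝[≠] 0) (𝓝 z)) :
    Tendsto (fun t => (t ^ n)⁻¹ * f (y t)) (𝓝[≠] 0) (𝓝 (homPart n f z)) := by
  have hid : Tendsto (fun t : ℂ => t) (𝓝[≠] 0) (𝓝 0) := tendsto_id.mono_left nhdsWithin_le_nhds
  have hy0 : Tendsto y (𝓝[≠] 0) (𝓝 0) := by
    have := hid.smul hy
    rw [zero_smul] at this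
    refine this.congr' ?_
    filter_upwards [self_mem_nhdsWithin] with t ht
    exact smul_inv_smul₀ ht _
  have h1 : Tendsto (fun t => homPart n f (t⁻¹ • y t)) (𝓝[≠] 0) (𝓝 (homPart n f z)) :=
    ((continuous_homPart hf n).tendsto z).comp hy
  have h2 : (fun w => f w - homPart n f w) =O[𝓝 0] fun w => ‖w‖ ^ (n + 1) := by
    refine (isBigO_sub_homPart hf (n + 1)).congr_left fun w => ?_
    rw [Finset.sum_range_succ, Finset.sum_eq_zero fun j hj => h0 j (Finset.mem_range.1 hj) w,
      zero_add]
  have h3 : Tendsto (fun t => (t ^ n)⁻¹ * (f (y t) - homPart n f (y t))) (𝓝[≠] 0) (𝓝 0) := by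
    have h4 := (Asymptotics.isBigO_refl (fun t : ℂ => ‖(t ^ n)⁻¹‖) (𝓝[≠] 0)).mul
      (h2.comp_tendsto hy0).norm_left
    rw [tendsto_zero_iff_norm_tendsto_zero]
    simp only [norm_mul]
    refine h4.trans_tendsto ?_
    have h5 : Tendsto (fun t : ℂ => ‖t‖ * ‖t⁻¹ • y t‖ ^ (n + 1)) (𝓝[≠] 0) (𝓝 0) := by
      simpa using hid.norm.mul (hy.norm.pow (n + 1))
    refine h5.congr' ?_
    filter_upwards [self_mem_nhdsWithin] with t ht
    have ht' : ‖t‖ ≠ 0 := norm_ne_zero_iff.2 ht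
    simp only [Function.comp, norm_smul, norm_inv, norm_pow, mul_pow, inv_pow]
    field_simp
    ring
  have h6 := h1.add h3
  rw [add_zero] at h6
  refine h6.congr' ?_
  filter_upwards [self_mem_nhdsWithin] with t ht
  rw [homPart_smul hf, inv_pow]
  ring

theorem taylorCoeff_of_tendsto {f : ℂ → ℂ} (hf : AnalyticAt ℂ f 0) {n : ℕ} {L : ℂ}
    (h : Tendsto (fun t => (t ^ n)⁻¹ * f t) (𝓝[≠] 0) (𝓝 L)) :
    (∀ j < n, taylorCoeff j f = 0) ∧ taylorCoeff n f = L := by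
  have h1 : f =O[𝓝[≠] 0] fun t => t ^ n := by
    have := (Asymptotics.isBigO_refl (fun t : ℂ => t ^ n) (𝓝[≠] 0)).mul (h.isBigO_one ℂ)
    simp only [mul_one] at this
    refine this.congr' ?_ EventuallyEq.rfl
    filter_upwards [self_mem_nhdsWithin] with t ht
    exact mul_inv_cancel_left₀ (pow_ne_zero n ht) _
  obtain ⟨g, hg, hfg⟩ := exists_eq_pow_mul_of_isBigO hf h1
  have h2 : g 0 = L := by
    refine tendsto_nhds_unique (hg.continuousAt.tendsto.mono_left nhdsWithin_le_nhds)
      (h.congr' ?_)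
    filter_upwards [nhdsWithin_le_nhds hfg, self_mem_nhdsWithin] with t h2 h3
    rw [h2, inv_mul_cancel_left₀ (pow_ne_zero n h3)]
  refine ⟨fun j hj => ?_, ?_⟩
  · rw [taylorCoeff_congr hfg, taylorCoeff_pow_mul hg, if_neg (by omega)]
  · rw [taylorCoeff_congr hfg, taylorCoeff_pow_mul hg, if_pos le_rfl, Nat.sub_self,
      taylorCoeff_zero, h2]

theorem tendsto_homVec {v : ℂ × ℂ → ℂ × ℂ} (hv : AnalyticAt ℂ v 0) {n : ℕ}
    (h0 : VanishesToOrder n v) {y : ℂ → ℂ × ℂ} {z : ℂ × ℂ}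
    (hy : Tendsto (fun t => t⁻¹ • y t) (𝓝[≠] 0) (𝓝 z)) :
    Tendsto (fun t => (t ^ n)⁻¹ • v (y t)) (𝓝[≠] 0) (𝓝 (homVec n v z)) :=
  (tendsto_homPart hv.prod_fst (fun j hj z => (h0 j hj z).1) hy).prodMk_nhds
    (tendsto_homPart hv.prod_snd (fun j hj z => (h0 j hj z).2) hy)

/-- A converse of `tendsto_homVec`: limits along lines determine the order of vanishing and the
principal part. -/
theorem vanishesToOrder_of_tendsto {v : ℂ × ℂ → ℂ × ℂ} (hv : AnalyticAt ℂ v 0) {n : ℕ}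
    {W : ℂ × ℂ → ℂ × ℂ}
    (h : ∀ z, Tendsto (fun t : ℂ => (t ^ n)⁻¹ • v (t * z.1, t * z.2)) (𝓝[≠] 0) (𝓝 (W z))) :
    VanishesToOrder n v ∧ homVec n v = W := by
  have h1 := fun z => taylorCoeff_of_tendsto (analyticAt_comp_smul hv.prod_fst z)
    ((continuous_fst.tendsto _).comp (h z))
  have h2 := fun z => taylorCoeff_of_tendsto (analyticAt_comp_smul hv.prod_snd z)
    ((continuous_snd.tendsto _).comp (h z))
  exact ⟨fun j hj z => ⟨(h1 z).1 j hj, (h2 z).1 j hj⟩,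
    funext fun z => Prod.ext (h1 z).2 (h2 z).2⟩

theorem radialPoly_eq (k : ℕ) (v : ℂ × ℂ → ℂ × ℂ) (u : ℂ) :
    radialPoly k v u = (homVec k v (1, u)).1 := rfl

theorem tangentPoly_eq (k : ℕ) (v : ℂ × ℂ → ℂ × ℂ) (u : ℂ) :
    tangentPoly k v u = (homVec k v (1, u)).2 - u * (homVec k v (1, u)).1 := rfl

/-- `v'` is the direct image of `v` by the germ `H`. -/
def IsPush (H v v' : ℂ × ℂ → ℂ × ℂ) : Prop := ∀ᶠ y in 𝓝 0, v' (H y) = fderiv ℂ H y (v y)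

/-- The direct image of a vector field by a germ `H` with inverse `G`. -/
noncomputable def pushField (H G v : ℂ × ℂ → ℂ × ℂ) (z : ℂ × ℂ) : ℂ × ℂ :=
  fderiv ℂ H (G z) (v (G z))

theorem IsTangentToId.tendsto {H : ℂ × ℂ → ℂ × ℂ} (hH : IsTangentToId H) :
    Tendsto H (𝓝 0) (𝓝 0) := by
  simpa [hH.2.1] using hH.1.continuousAt.tendsto

theorem analyticAt_pushField {H G v : ℂ × ℂ → ℂ × ℂ} (hH : IsTangentToId H) (hG : IsTangentToId G)
    (hv : AnalyticAt ℂ v 0) : AnalyticAt ℂ (pushField H G v) 0 := by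
  have h1 : AnalyticAt ℂ (fun z => fderiv ℂ H (G z)) 0 :=
    AnalyticAt.fun_comp (by rw [hG.2.1]; exact hH.1.fderiv) hG.1
  have h2 : AnalyticAt ℂ (fun z => v (G z)) 0 :=
    AnalyticAt.fun_comp (by rw [hG.2.1]; exact hv) hG.1
  exact AnalyticAt.fun_comp (g := fun p : (ℂ × ℂ →L[ℂ] ℂ × ℂ) × (ℂ × ℂ) => p.1 p.2)
    ((ContinuousLinearMap.id ℂ (ℂ × ℂ →L[ℂ] ℂ × ℂ)).analyticAt_bilinear _) (h1.prod h2)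

theorem isPush_pushField {H G : ℂ × ℂ → ℂ × ℂ} (hGH : ∀ᶠ z in 𝓝 0, G (H z) = z)
    (v : ℂ × ℂ → ℂ × ℂ) : IsPush H v (pushField H G v) := by
  filter_upwards [hGH] with z hz
  simp only [pushField, hz]

theorem isPush_symm {H G : ℂ × ℂ → ℂ × ℂ} (hH : IsTangentToId H) (hG : IsTangentToId G)
    (hGH : ∀ᶠ z in 𝓝 0, G (H z) = z) (hHG : ∀ᶠ z in 𝓝 0, H (G z) = z) {v v' : ℂ × ℂ → ℂ × ℂ}
    (h : IsPush H v v') : IsPush G v' v := by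
  filter_upwards [hG.tendsto.eventually h, hHG, hG.tendsto.eventually hGH.eventually_nhds,
    hG.tendsto.eventually hH.1.eventually_analyticAt, hG.1.eventually_analyticAt]
    with z h1 h2 h3 h4 h5
  rw [h2] at h1
  rw [h1]
  have h6 : fderiv ℂ (G ∘ H) (G z) = ContinuousLinearMap.id ℂ (ℂ × ℂ) :=
    (EventuallyEq.fderiv_eq (h3 : G ∘ H =ᶠ[𝓝 (G z)] id)).trans fderiv_id
  rw [fderiv_comp _ (by rw [h2]; exact h5.differentiableAt) h4.differentiableAt, h2] at h6
  have h7 := congrArg (fun L : ℂ × ℂ →L[ℂ] ℂ × ℂ => L (v (G z))) h6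
  exact h7.symm

theorem carriesAt_of_isPush {H v v' : ℂ × ℂ → ℂ × ℂ} (h : IsPush H v v') : CarriesAt H v v' 0 := by
  filter_upwards [h] with z hz
  rw [hz]
  simp [det2, mul_comm]

theorem IsTangentToId.eventually_det_ne {H : ℂ × ℂ → ℂ × ℂ} (hH : IsTangentToId H) :
    ∀ᶠ z in 𝓝 0, (fderiv ℂ H z).det ≠ 0 := by
  have h1 : ContinuousAt (fun z => det2 (fderiv ℂ H z (1, 0)) (fderiv ℂ H z (0, 1))) 0 := by
    have := hH.1.fderiv.continuousAt
    unfold det2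
    fun_prop
  have h2 := h1.eventually_ne (y := 0) (by rw [← det_eq_det2]; exact hH.isLocalBihol.2)
  simpa only [← det_eq_det2] using h2

theorem isFoliationGerm_of_isPush {H G v v' : ℂ × ℂ → ℂ × ℂ} (hH : IsTangentToId H)
    (hG : IsTangentToId G) (hHG : ∀ᶠ z in 𝓝 0, H (G z) = z) (hv : IsFoliationGerm v)
    (hv' : AnalyticAt ℂ v' 0) (h : IsPush H v v') : IsFoliationGerm v' := by
  refine ⟨hv', ?_⟩
  have h1 := eventually_nhdsWithin_iff.1 hv.2
  rw [eventually_nhdsWithin_iff]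
  filter_upwards [hG.tendsto.eventually h, hG.tendsto.eventually h1, hHG,
    hG.tendsto.eventually hH.eventually_det_ne] with z e1 e2 e3 e4 hz h0
  rw [e3] at e1
  refine e2 (fun hGz => hz ?_) (eq_zero_of_map_eq_zero e4 (e1 ▸ h0))
  have : G z = 0 := hGz
  rw [Set.mem_singleton_iff, ← e3, this, hH.2.1]

theorem tendsto_inv_smul_tangent {G : ℂ × ℂ → ℂ × ℂ} (hG : IsTangentToId G) (z : ℂ × ℂ) :
    Tendsto (fun t : ℂ => t⁻¹ • G (t * z.1, t * z.2)) (𝓝[≠] 0) (𝓝 z) := by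
  have h1 : HasDerivAt (fun t : ℂ => (t * z.1, t * z.2)) z 0 := by
    have := ((hasDerivAt_id (0 : ℂ)).mul_const z.1).prodMk ((hasDerivAt_id (0 : ℂ)).mul_const z.2)
    simpa using this
  have h2 : HasFDerivAt G (ContinuousLinearMap.id ℂ (ℂ × ℂ))
      ((fun t : ℂ => (t * z.1, t * z.2)) 0) := by
    rw [← hG.2.2]
    simpa [Prod.zero_eq_mk] using hG.1.differentiableAt.hasFDerivAt
  have h3 := (h2.comp_hasDerivAt (0 : ℂ) h1).tendsto_slope_zero
  have h4 : G (0, 0) = 0 := hG.2.1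
  simpa [h4] using h3

/-- The direct image by a germ tangent to the identity has the same principal part. -/
theorem homVec_of_isPush {H G v v' : ℂ × ℂ → ℂ × ℂ} (hH : IsTangentToId H)
    (hG : IsTangentToId G) (hHG : ∀ᶠ z in 𝓝 0, H (G z) = z) (hv : AnalyticAt ℂ v 0)
    (hv' : AnalyticAt ℂ v' 0) (h : IsPush H v v') {n : ℕ} (h0 : VanishesToOrder n v) :
    VanishesToOrder n v' ∧ homVec n v' = homVec n v := by
  refine vanishesToOrder_of_tendsto hv' fun z => ?_
  -- At `t z` the direct image is `dH_y (v y)` with `y = G (t z)`. This curve is tangent to `t z`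
  -- and `dH_y` tends to the identity, so the limit after division by `t ^ n` is that of `v`.
  have h1 := tendsto_homVec hv h0 (tendsto_inv_smul_tangent hG z)
  have hs := (tendsto_smul_zero z).mono_left (nhdsWithin_le_nhds (s := {0}ᶜ))
  have h2 : Tendsto (fun t : ℂ => fderiv ℂ H (G (t * z.1, t * z.2))) (𝓝[≠] 0)
      (𝓝 (ContinuousLinearMap.id ℂ (ℂ × ℂ))) := by
    rw [← hH.2.2]
    exact hH.1.fderiv.continuousAt.tendsto.comp (hG.tendsto.comp hs)
  have h3 := ((isBoundedBilinearMap_apply (𝕜 := ℂ) (E := ℂ × ℂ) (F := ℂ × ℂ)).continuous.tendsto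
    (ContinuousLinearMap.id ℂ (ℂ × ℂ), homVec n v z)).comp (h2.prodMk_nhds h1)
  refine h3.congr' ?_
  filter_upwards [hs.eventually (hG.tendsto.eventually h), hs.eventually hHG] with t e1 e2
  rw [e2] at e1
  rw [e1]
  exact map_smul _ _ _

/-! ## The lifted vector field -/

theorem fderiv_blowup_apply (z a : ℂ × ℂ) :
    fderiv ℂ (fun w : ℂ × ℂ => (w.1, w.2 * w.1)) z a = (a.1, z.2 * a.1 + z.1 * a.2) := by
  have h : HasFDerivAt (fun w : ℂ × ℂ => (w.1, w.2 * w.1))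
      ((ContinuousLinearMap.fst ℂ ℂ ℂ).prod
        (z.2 • ContinuousLinearMap.fst ℂ ℂ ℂ + z.1 • ContinuousLinearMap.snd ℂ ℂ ℂ)) z :=
    hasFDerivAt_fst.prodMk (hasFDerivAt_snd.mul hasFDerivAt_fst)
  rw [h.fderiv]
  simp

theorem fderiv_blowup_liftField (v : ℂ × ℂ → ℂ × ℂ) (z : ℂ × ℂ) :
    fderiv ℂ (fun w : ℂ × ℂ => (w.1, w.2 * w.1)) z (liftField v z) =
      z.1 • v (z.1, z.2 * z.1) := by
  rw [fderiv_blowup_apply]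
  ext
  · simp [liftField]
  · simp [liftField]; ring

/-- The lift `K` of `H` in the chart `(x, u)` takes the blow-up of the foliation of `v` to that of
its direct image. -/
theorem liftField_of_isPush {H v v' K : ℂ × ℂ → ℂ × ℂ} {u : ℂ} (hH : IsTangentToId H)
    (h : IsPush H v v') (hK : AnalyticAt ℂ K (0, u))
    (hlift : ∀ᶠ z in 𝓝 (0, u), lift H (chartX z) = chartX (K z)) :
    ∀ᶠ z in 𝓝 ((0 : ℂ), u), (K z).1 ≠ 0 →
      z.1 • liftField v' (K z) = (K z).1 • fderiv ℂ K z (liftField v z) := by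
  filter_upwards [hlift.eventually_nhds, hK.eventually_analyticAt, (tendsto_blowup u).eventually h,
    (tendsto_blowup u).eventually hH.1.eventually_analyticAt] with z h1 h2 h3 h4 h5
  set π : ℂ × ℂ → ℂ × ℂ := fun w => (w.1, w.2 * w.1) with hπ
  have hπd : ∀ w, DifferentiableAt ℂ π w := fun w => by simp only [hπ]; fun_prop
  have e1 : π ∘ K =ᶠ[𝓝 z] H ∘ π := by
    filter_upwards [h1] with w hw
    have := congrArg Blowup.pt hw
    rw [lift_pt] at this
    exact this.symm
  have e2 := e1.fderiv_eq (𝕜 := ℂ)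
  rw [fderiv_comp z (hπd _) h2.differentiableAt, fderiv_comp z h4.differentiableAt (hπd _)] at e2
  -- Both terms have the same image under `dπ`, by `π ∘ K = H ∘ π`, and `dπ` is injective off the
  -- divisor.
  have e3 : fderiv ℂ π (K z) (z.1 • liftField v' (K z) -
      (K z).1 • fderiv ℂ K z (liftField v z)) = 0 := by
    have e4 := congrArg (fun L : ℂ × ℂ →L[ℂ] ℂ × ℂ => L (liftField v z)) e2
    simp only [ContinuousLinearMap.comp_apply] at e4
    rw [map_sub, map_smul, map_smul, e4, fderiv_blowup_liftField, fderiv_blowup_liftField,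
      map_smul, ← h3, show ((K z).1, (K z).2 * (K z).1) = H (z.1, z.2 * z.1) from
        e1.self_of_nhds, smul_comm, sub_self]
  rw [fderiv_blowup_apply] at e3
  have e5 := congrArg Prod.fst e3
  have e6 := congrArg Prod.snd e3
  simp only [Prod.fst_zero, Prod.snd_zero] at e5 e6
  rw [e5, mul_zero, zero_add] at e6
  exact sub_eq_zero.1 (Prod.ext e5 ((mul_eq_zero.1 e6).resolve_left h5))

theorem xCoeff_liftField_snd {w : ℂ × ℂ → ℂ × ℂ} (hw : AnalyticAt ℂ w 0) (j : ℕ) (t : ℂ) :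
    xCoeff j (fun z => (liftField w z).2) t = tangentPoly j w t := by
  have h1 := (analyticAt_comp_blowup hw.prod_fst t).slice
  have h2 := (analyticAt_comp_blowup hw.prod_snd t).slice
  unfold xCoeff liftField tangentPoly homPart
  rw [taylorCoeff_sub (f := fun x => (w (x, t * x)).2) (g := fun x => t * (w (x, t * x)).1) h2
    (analyticAt_const.fun_mul h1), taylorCoeff_const_mul]
  simp only [mul_one, mul_comm t]

theorem analyticAt_liftField {w : ℂ × ℂ → ℂ × ℂ} (hw : AnalyticAt ℂ w 0) (u : ℂ) :
    AnalyticAt ℂ (liftField w) (0, u) := by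
  have h1 := analyticAt_comp_blowup hw.prod_fst u
  have h2 := analyticAt_comp_blowup hw.prod_snd u
  exact (analyticAt_fst.fun_mul h1).prod (h2.fun_sub (analyticAt_snd.fun_mul h1))

/-- The complement of the divisor is dense: each point is reached by moving `x` alone. Identities
obtained by cancelling powers of `x` are extended to the divisor in this way. -/
theorem eventually_of_fst_ne_zero {E : Type*} [NormedAddCommGroup E] {f : ℂ × ℂ → E} {u : ℂ}
    (hf : ∀ᶠ z in 𝓝 ((0 : ℂ), u), ContinuousAt f z)
    (h : ∀ᶠ z in 𝓝 ((0 : ℂ), u), z.1 ≠ 0 → f z = 0) : ∀ᶠ z in 𝓝 ((0 : ℂ), u), f z = 0 := by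
  filter_upwards [hf, h.eventually_nhds] with z h1 h2
  have ht : Tendsto (fun t : ℂ => (z.1 + t, z.2)) (𝓝[≠] 0) (𝓝 z) := by
    have : Continuous fun t : ℂ => (z.1 + t, z.2) := by fun_prop
    simpa using (this.tendsto 0).mono_left (nhdsWithin_le_nhds (s := {0}ᶜ))
  refine tendsto_nhds_unique (h1.tendsto.comp ht) ?_
  refine (tendsto_congr' ?_).2 tendsto_const_nhds
  have h3 : ∀ᶠ t : ℂ in 𝓝[≠] 0, z.1 + t ≠ 0 := by
    by_cases hz : z.1 = 0
    · filter_upwards [self_mem_nhdsWithin] with t ht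
      simpa [hz] using ht
    · have : ContinuousAt (fun t : ℂ => z.1 + t) 0 := by fun_prop
      exact nhdsWithin_le_nhds (this.eventually_ne (by simpa using hz))
  filter_upwards [ht.eventually h2, h3] with t e1 e2
  exact e1 e2

/-- The form of the lift in the chart `(x, u)` that is used below. -/
structure IsLiftX (H K : ℂ × ℂ → ℂ × ℂ) (u : ℂ) : Prop where
  bihol : IsLocalBihol K (0, u)
  eq : ∀ᶠ z in 𝓝 (0, u), lift H (chartX z) = chartX (K z)
  divisor : ∀ᶠ t in 𝓝 u, K (0, t) = (0, t)
  fst : ∃ h : ℂ × ℂ → ℂ, AnalyticAt ℂ h (0, u) ∧ (∀ᶠ z in 𝓝 (0, u), (K z).1 = z.1 * h z) ∧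
    ∀ᶠ t in 𝓝 u, h (0, t) = 1

theorem IsTangentToId.exists_isLiftX {H : ℂ × ℂ → ℂ × ℂ} (hH : IsTangentToId H) (u : ℂ) :
    ∃ K, IsLiftX H K u := by
  obtain ⟨K, hK, h1, h2, h3⟩ := hH.exists_lift_chartX u
  refine ⟨K, ?_, h1, h2, h3⟩
  have h4 := ((hH.isBiholAt_lift_chartX u).exists_chartX ?_).1
  · refine h4.congr ?_
    filter_upwards [h1] with z hz
    rw [hz, coordX_chartX]
  · rw [h1.self_of_nhds]
    exact OnePoint.coe_ne_infty _

theorem IsLiftX.tendsto {H K : ℂ × ℂ → ℂ × ℂ} {u : ℂ} (h : IsLiftX H K u) :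
    Tendsto K (𝓝 (0, u)) (𝓝 (0, u)) := by
  simpa [h.divisor.self_of_nhds] using h.bihol.1.continuousAt.tendsto

theorem IsLiftX.fst_ne {H K : ℂ × ℂ → ℂ × ℂ} {u : ℂ} (h : IsLiftX H K u) :
    ∀ᶠ z in 𝓝 (0, u), z.1 ≠ 0 → (K z).1 ≠ 0 := by
  obtain ⟨g, hg, h1, h2⟩ := h.fst
  filter_upwards [h1, hg.continuousAt.eventually_ne
    (by rw [h2.self_of_nhds]; exact one_ne_zero)] with z e1 e2 e3
  rw [e1]
  exact mul_ne_zero e3 e2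

theorem IsLiftX.fderiv_snd {H K : ℂ × ℂ → ℂ × ℂ} {u : ℂ} (h : IsLiftX H K u) :
    fderiv ℂ K (0, u) (0, 1) = (0, 1) := by
  have h1 : HasDerivAt (fun t : ℂ => ((0 : ℂ), t)) ((0 : ℂ), (1 : ℂ)) u :=
    (hasDerivAt_const u (0 : ℂ)).prodMk (hasDerivAt_id u)
  have h2 := h.bihol.1.differentiableAt.hasFDerivAt.comp_hasDerivAt u h1
  exact h2.unique (h1.congr_of_eventuallyEq h.divisor)

/-- First integrals are transported by the lift of the inverse germ. -/
theorem IsFirstIntegralAt.comp_lift {G v v' M : ℂ × ℂ → ℂ × ℂ} {f : ℂ × ℂ → ℂ} {u : ℂ}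
    (hf : IsFirstIntegralAt v f (0, u)) (hG : IsTangentToId G) (h : IsPush G v' v)
    (hv' : AnalyticAt ℂ v' 0) (hM : IsLiftX G M u) :
    IsFirstIntegralAt v' (fun z => f (M z)) (0, u) := by
  have hM0 : M (0, u) = (0, u) := hM.divisor.self_of_nhds
  have hfa : AnalyticAt ℂ (fun z => f (M z)) (0, u) :=
    AnalyticAt.fun_comp (by rw [hM0]; exact hf.1) hM.bihol.1
  have hcomp : ∀ᶠ z in 𝓝 ((0 : ℂ), u), ∀ a, fderiv ℂ (fun z => f (M z)) z a =
      fderiv ℂ f (M z) (fderiv ℂ M z a) := by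
    filter_upwards [hM.tendsto.eventually hf.1.eventually_analyticAt,
      hM.bihol.1.eventually_analyticAt] with z h1 h2 a
    rw [show (fun z => f (M z)) = f ∘ M from rfl,
      fderiv_comp z h1.differentiableAt h2.differentiableAt]
    rfl
  refine ⟨hfa, fun h0 => hf.2.1 ?_, ?_⟩
  · refine ContinuousLinearMap.ext fun a => ?_
    set e := (fderiv ℂ M (0, u)).toContinuousLinearEquivOfDetNeZero hM.bihol.2
    have h1 := hcomp.self_of_nhds (e.symm a)
    have h2 : fderiv ℂ M (0, u) (e.symm a) = a := e.apply_symm_apply a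
    rw [h0, h2, hM0] at h1
    exact h1.symm
  · refine eventually_of_fst_ne_zero ?_ ?_
    · filter_upwards [hfa.eventually_analyticAt,
        (analyticAt_liftField hv' u).eventually_analyticAt] with z h1 h2
      exact h1.fderiv.continuousAt.clm_apply h2.continuousAt
    · filter_upwards [hcomp, hM.tendsto.eventually hf.2.2, hM.fst_ne,
        liftField_of_isPush hG h hM.bihol.1 hM.eq] with z h1 h2 h3 h4 hz
      rw [h1]
      have h5 := congrArg (fderiv ℂ f (M z)) (h4 (h3 hz))
      rw [map_smul, map_smul, h2, smul_zero, eq_comm, smul_eq_zero] at h5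
      exact h5.resolve_left (h3 hz)

/-! ## Direct images of dicritical foliations -/

theorem exists_fst_blowup_eq {v : ℂ × ℂ → ℂ × ℂ} (hv : AnalyticAt ℂ v 0) {n : ℕ}
    (h0 : VanishesToOrder n v) (u : ℂ) :
    ∃ A : ℂ × ℂ → ℂ, AnalyticAt ℂ A (0, u) ∧
      (∀ᶠ z in 𝓝 (0, u), (v (z.1, z.2 * z.1)).1 = z.1 ^ n * A z) ∧
      ∀ᶠ t in 𝓝 u, A (0, t) = radialPoly n v t := by
  have hx : ∀ j t, xCoeff j (fun z => (v (z.1, z.2 * z.1)).1) t =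
      homPart j (fun w => (v w).1) (1, t) := fun j t => by
    unfold xCoeff homPart
    simp only [mul_one, mul_comm t]
  obtain ⟨A, hA, h1, h2⟩ := (analyticAt_comp_blowup hv.prod_fst u).exists_eq_pow_mul (n := n)
    fun j hj => Eventually.of_forall fun t => (hx j t).trans (h0 j hj _).1
  refine ⟨A, hA, h1, ?_⟩
  filter_upwards [h2] with t ht
  rw [← ht, hx]
  rfl

theorem exists_liftField_snd_eq {v : ℂ × ℂ → ℂ × ℂ} (hv : AnalyticAt ℂ v 0) {n : ℕ}
    (h0 : ∀ j < n, ∀ t, tangentPoly j v t = 0) (u : ℂ) :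
    ∃ V : ℂ × ℂ → ℂ, AnalyticAt ℂ V (0, u) ∧
      (∀ᶠ z in 𝓝 (0, u), (liftField v z).2 = z.1 ^ n * V z) ∧
      ∀ᶠ t in 𝓝 u, V (0, t) = tangentPoly n v t := by
  obtain ⟨V, hV, h1, h2⟩ := (analyticAt_liftField hv u).prod_snd.exists_eq_pow_mul (n := n)
    fun j hj => Eventually.of_forall fun t => (xCoeff_liftField_snd hv j t).trans (h0 j hj t)
  refine ⟨V, hV, h1, ?_⟩
  filter_upwards [h2] with t ht
  rw [← ht, xCoeff_liftField_snd hv]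

theorem tangentPoly_of_vanishesToOrder {v : ℂ × ℂ → ℂ × ℂ} {n : ℕ} (h0 : VanishesToOrder n v)
    {j : ℕ} (hj : j < n) (t : ℂ) : tangentPoly j v t = 0 := by
  rw [tangentPoly, (h0 j hj _).1, (h0 j hj _).2, mul_zero, sub_zero]

/-- The second jet of a dicritical foliation at a tangency point is invariant. -/
theorem tangentPoly_succ_of_isPush {H w w' : ℂ × ℂ → ℂ × ℂ} {m : ℕ} {c : ℂ}
    (hH : IsTangentToId H) (h : IsPush H w w') (hw : AnalyticAt ℂ w 0) (hw' : AnalyticAt ℂ w' 0)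
    (h0 : VanishesToOrder (m + 1) w) (h1 : ∀ t, tangentPoly (m + 1) w t = 0)
    (h0' : VanishesToOrder (m + 1) w') (h1' : ∀ t, tangentPoly (m + 1) w' t = 0)
    (hc : radialPoly (m + 1) w c = 0) :
    tangentPoly (m + 2) w' c = tangentPoly (m + 2) w c := by
  have aux : ∀ {y : ℂ × ℂ → ℂ × ℂ}, VanishesToOrder (m + 1) y →
      (∀ t, tangentPoly (m + 1) y t = 0) → ∀ j < m + 2, ∀ t, tangentPoly j y t = 0 :=
    fun hy1 hy2 j hj t => by
      rcases Nat.lt_succ_iff_lt_or_eq.1 hj with hj | rfl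
      · exact tangentPoly_of_vanishesToOrder hy1 hj t
      · exact hy2 t
  obtain ⟨A, hA, eA, eA0⟩ := exists_fst_blowup_eq hw h0 c
  obtain ⟨V, hV, eV, eV0⟩ := exists_liftField_snd_eq hw (aux h0 h1) c
  obtain ⟨V', hV', eV', eV0'⟩ := exists_liftField_snd_eq hw' (aux h0' h1') c
  obtain ⟨K, hK⟩ := hH.exists_isLiftX c
  obtain ⟨b, hb, eb, eb0⟩ := hK.fst
  have hK0 : K (0, c) = (0, c) := hK.divisor.self_of_nhds
  -- The second component of the transformation law of the lifted fields, with the common factor `x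
  -- ^ (m + 3)` removed. At `(0, c)` one has `b = 1` and `A = 0`, so `dK` is applied to a multiple
  -- of `(0, 1)`, which it fixes.
  set f : ℂ × ℂ → ℂ := fun z => b z ^ (m + 2) * V' (K z) - b z * (fderiv ℂ K z (A z, V z)).2
  have hf : ∀ᶠ z in 𝓝 ((0 : ℂ), c), ContinuousAt f z := by
    filter_upwards [hA.eventually_analyticAt, hV.eventually_analyticAt,
      hK.tendsto.eventually hV'.eventually_analyticAt, hb.eventually_analyticAt,
      hK.bihol.1.eventually_analyticAt] with z a1 a2 a3 a4 a5
    have c1 := a5.fderiv.continuousAt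
    have c2 : ContinuousAt (fun z => V' (K z)) z := a3.continuousAt.comp a5.continuousAt
    have c3 := a4.continuousAt
    have c4 := a1.continuousAt
    have c5 := a2.continuousAt
    fun_prop
  have hz : ∀ᶠ z in 𝓝 ((0 : ℂ), c), z.1 ≠ 0 → f z = 0 := by
    filter_upwards [liftField_of_isPush hH h hK.bihol.1 hK.eq, hK.fst_ne, eA, eV,
      hK.tendsto.eventually eV', eb] with z e1 e2 e3 e4 e5 e6 hz
    have e7 := e1 (e2 hz)
    have e8 : liftField w z = z.1 ^ (m + 2) • (A z, V z) := by
      refine Prod.ext ?_ e4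
      simp only [liftField, e3, Prod.smul_fst, smul_eq_mul]
      ring
    rw [e8, map_smul] at e7
    have e9 := congrArg Prod.snd e7
    simp only [Prod.smul_snd, smul_eq_mul, e5, e6] at e9
    have e10 : z.1 ^ (m + 3) * f z = 0 := by
      simp only [f]
      linear_combination e9
    exact (mul_eq_zero.1 e10).resolve_left (pow_ne_zero _ hz)
  have hc0 := (eventually_of_fst_ne_zero hf hz).self_of_nhds
  simp only [f, hK0, eb0.self_of_nhds, eA0.self_of_nhds, eV0.self_of_nhds, eV0'.self_of_nhds, hc,
    one_pow, one_mul] at hc0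
  rw [show ((0 : ℂ), tangentPoly (m + 2) w c) = tangentPoly (m + 2) w c • ((0 : ℂ), (1 : ℂ)) by
    simp, map_smul, hK.fderiv_snd] at hc0
  simpa [sub_eq_zero] using hc0

/-- The lift is the identity on the divisor, so the first integral pulled back by it has the same
restriction there and the same involution. -/
theorem IsTangencyInvolution.of_isPush {G w w' : ℂ × ℂ → ℂ × ℂ} {c : ℂ} {J : ℂ → ℂ}
    (hw : IsTangencyInvolution w c J) (hG : IsTangentToId G) (h : IsPush G w' w)
    (hw' : AnalyticAt ℂ w' 0) : IsTangencyInvolution w' c J := by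
  obtain ⟨h1, h2, h3, h4, f, hf, hJ⟩ := hw
  obtain ⟨M, hM⟩ := hG.exists_isLiftX c
  refine ⟨h1, h2, h3, h4, _, hf.comp_lift hG h hw' hM, ?_⟩
  have h5 : Tendsto J (𝓝 c) (𝓝 c) := by simpa [h2] using h1.continuousAt.tendsto
  filter_upwards [hJ, hM.divisor, h5.eventually hM.divisor] with u e1 e2 e3
  rw [e2, e3, e1]

theorem IsDicritical.of_isPush {H G w w' : ℂ × ℂ → ℂ × ℂ} {m : ℕ} {q : Fin m → ℂ}
    {I : Fin m → ℂ → ℂ} (hw : IsDicritical q I w) (hH : IsTangentToId H) (hG : IsTangentToId G)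
    (hGH : ∀ᶠ z in 𝓝 0, G (H z) = z) (hHG : ∀ᶠ z in 𝓝 0, H (G z) = z)
    (hw' : AnalyticAt ℂ w' 0) (h : IsPush H w w') : IsDicritical q I w' := by
  obtain ⟨h1, h2⟩ := homVec_of_isPush hH hG hHG hw.germ.1 hw' h hw.order
  have h3 : ∀ u, tangentPoly (m + 1) w' u = 0 := fun u => by
    rw [tangentPoly_eq, h2, ← tangentPoly_eq, hw.dicritical]
  have h4 : ∀ u, radialPoly (m + 1) w' u = radialPoly (m + 1) w u := fun u => by
    rw [radialPoly_eq, h2, ← radialPoly_eq]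
  refine ⟨isFoliationGerm_of_isPush hH hG hHG hw.germ hw' h, h1, h3, ?_, fun j => ?_, fun j =>
    (hw.involution j).of_isPush hG (isPush_symm hH hG hGH hHG h) hw'⟩
  · simpa only [h4] using hw.tangency
  · obtain ⟨c, -, hc⟩ := hw.tangency
    rw [tangentPoly_succ_of_isPush hH h hw.germ.1 hw' hw.order hw.dicritical h1 h3]
    · exact hw.regular j
    · rw [hc, Finset.prod_eq_zero (Finset.mem_univ j) (sub_self _), mul_zero]

theorem YAxisInvariant.of_isPush {H w w' : ℂ × ℂ → ℂ × ℂ} (hw : YAxisInvariant w)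
    (hH : IsTangentToId H) (hax : ∀ᶠ y in 𝓝 (0 : ℂ), (H (0, y)).1 = 0) (h : IsPush H w w') :
    YAxisInvariant w' := by
  have hi : Tendsto (fun y : ℂ => ((0 : ℂ), y)) (𝓝 0) (𝓝 0) := tendsto_mk_zero 0
  set e : ℂ → ℂ := fun y => (H (0, y)).2 with he
  have hea : AnalyticAt ℂ e 0 :=
    AnalyticAt.restrict_divisor (f := fun z => (H z).2) (c := 0) hH.1.prod_snd
  have hd : HasDerivAt (fun y : ℂ => H (0, y)) (0, 1) 0 := by
    have h1 : HasDerivAt (fun t : ℂ => ((0 : ℂ), t)) ((0 : ℂ), (1 : ℂ)) 0 :=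
      (hasDerivAt_const 0 (0 : ℂ)).prodMk (hasDerivAt_id 0)
    have h2 : HasFDerivAt H (ContinuousLinearMap.id ℂ (ℂ × ℂ)) ((fun t : ℂ => ((0 : ℂ), t)) 0) := by
      rw [← hH.2.2]; exact hH.1.differentiableAt.hasFDerivAt
    exact h2.comp_hasDerivAt 0 h1
  have hed : HasDerivAt e 1 0 :=
    (ContinuousLinearMap.snd ℂ ℂ ℂ).hasFDerivAt.comp_hasDerivAt (0 : ℂ) hd
  have he0 : e 0 = 0 := congrArg Prod.snd hH.2.1
  -- `H` induces on the axis a germ with derivative `1`, so every point of the axis near `0` is the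
  -- image of a point of the axis.
  have hmap : map e (𝓝 0) = 𝓝 0 := by
    have := (hea.hasStrictDerivAt.map_nhds_eq (by rw [hed.deriv]; exact one_ne_zero))
    rwa [he0] at this
  unfold YAxisInvariant
  rw [← hmap, eventually_map]
  filter_upwards [hax.eventually_nhds, hi.eventually h, hw,
    hi.eventually hH.1.eventually_analyticAt] with y e1 e2 e3 e4
  have e5 : H (0, y) = (0, e y) := Prod.ext e1.self_of_nhds rfl
  rw [← e5, e2]
  have h1 : HasDerivAt (fun t : ℂ => ((0 : ℂ), t)) ((0 : ℂ), (1 : ℂ)) y :=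
    (hasDerivAt_const y (0 : ℂ)).prodMk (hasDerivAt_id y)
  have h2 := (ContinuousLinearMap.fst ℂ ℂ ℂ).hasFDerivAt.comp_hasDerivAt y
    (e4.differentiableAt.hasFDerivAt.comp_hasDerivAt y h1)
  have h3 : (fderiv ℂ H (0, y) (0, 1)).1 = 0 :=
    h2.unique ((hasDerivAt_const y (0 : ℂ)).congr_of_eventuallyEq e1)
  rw [show w (0, y) = (w (0, y)).2 • ((0 : ℂ), (1 : ℂ)) by ext <;> simp [e3], map_smul,
    Prod.smul_fst, h3, smul_zero]

/-! ## First integrals near a regular point of the divisor -/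

/-- Near a regular point of the divisor, the lifted field is `x ^ n` times a field which is
transverse to the fibres of `u` and tangent to the divisor. -/
theorem exists_regular_field {v : ℂ × ℂ → ℂ × ℂ} (hv : AnalyticAt ℂ v 0) {n : ℕ}
    (h0 : VanishesToOrder n v) {u : ℂ} (hu : tangentPoly n v u ≠ 0) :
    ∃ X : ℂ × ℂ → ℂ × ℂ, (∀ᶠ z in 𝓝 (0, u), (X z).2 ≠ 0) ∧ (∀ᶠ t in 𝓝 u, (X (0, t)).1 = 0) ∧
      ∀ f, IsFirstIntegralAt v f (0, u) → ∀ᶠ z in 𝓝 (0, u), fderiv ℂ f z (X z) = 0 := by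
  obtain ⟨A, hA, eA, -⟩ := exists_fst_blowup_eq hv h0 u
  obtain ⟨V, hV, eV, eV0⟩ := exists_liftField_snd_eq hv
    (fun j hj t => tangentPoly_of_vanishesToOrder h0 hj t) u
  refine ⟨fun z => (z.1 * A z, V z), hV.continuousAt.eventually_ne
    (by rw [eV0.self_of_nhds]; exact hu), Eventually.of_forall fun t => zero_mul _,
    fun f hf => eventually_of_fst_ne_zero ?_ ?_⟩
  · filter_upwards [hA.eventually_analyticAt, hV.eventually_analyticAt,
      hf.1.eventually_analyticAt] with z a1 a2 a3
    have c1 := a3.fderiv.continuousAt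
    have c4 := a1.continuousAt
    have c5 := a2.continuousAt
    fun_prop
  · filter_upwards [eA, eV, hf.2.2] with z e1 e2 e3 hz
    have e4 : liftField v z = z.1 ^ n • (z.1 * A z, V z) := by
      refine Prod.ext ?_ e2
      simp only [liftField, e1, Prod.smul_fst, smul_eq_mul]
      ring
    rw [e4, map_smul, smul_eq_zero] at e3
    exact e3.resolve_left (pow_ne_zero _ hz)

/-- Near this point the divisor is a leaf: the regular field is tangent to it and does not vanish.
-/
theorem IsFirstIntegralAt.fderiv_snd_eq_zero {v : ℂ × ℂ → ℂ × ℂ} (hv : AnalyticAt ℂ v 0) {n : ℕ}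
    (h0 : VanishesToOrder n v) {u : ℂ} (hu : tangentPoly n v u ≠ 0) {f : ℂ × ℂ → ℂ}
    (hf : IsFirstIntegralAt v f (0, u)) : ∀ᶠ t in 𝓝 u, fderiv ℂ f (0, t) (0, 1) = 0 := by
  obtain ⟨X, hX, hX0, hXf⟩ := exists_regular_field hv h0 hu
  filter_upwards [(tendsto_mk_zero u).eventually hX, hX0, (tendsto_mk_zero u).eventually (hXf f hf)]
    with t e1 e2 e3
  rw [show X (0, t) = (X (0, t)).2 • ((0 : ℂ), (1 : ℂ)) by ext <;> simp [e2], map_smul,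
    smul_eq_zero] at e3
  exact e3.resolve_left e1

theorem eventually_eq_of_deriv_eq_zero {f : ℂ → ℂ} {u : ℂ} (hf : ∀ᶠ t in 𝓝 u, HasDerivAt f 0 t) :
    ∀ᶠ t in 𝓝 u, f t = f u := by
  obtain ⟨r, hr, h⟩ := Metric.eventually_nhds_iff_ball.1 hf
  filter_upwards [Metric.ball_mem_nhds u hr] with t ht
  exact Metric.isOpen_ball.is_const_of_deriv_eq_zero (convex_ball u r).isPreconnected
    (fun x hx => (h x hx).differentiableAt.differentiableWithinAt)
    (fun x hx => (h x hx).deriv) ht (Metric.mem_ball_self hr)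

theorem IsFirstIntegralAt.eventually_divisor_eq {v : ℂ × ℂ → ℂ × ℂ} (hv : AnalyticAt ℂ v 0) {n : ℕ}
    (h0 : VanishesToOrder n v) {u : ℂ} (hu : tangentPoly n v u ≠ 0) {f : ℂ × ℂ → ℂ}
    (hf : IsFirstIntegralAt v f (0, u)) : ∀ᶠ t in 𝓝 u, f (0, t) = f (0, u) := by
  refine eventually_eq_of_deriv_eq_zero (f := fun t => f (0, t)) ?_
  filter_upwards [hf.fderiv_snd_eq_zero hv h0 hu,
    (tendsto_mk_zero u).eventually hf.1.eventually_analyticAt] with t e1 e2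
  have h1 : HasDerivAt (fun t : ℂ => ((0 : ℂ), t)) ((0 : ℂ), (1 : ℂ)) t :=
    (hasDerivAt_const t (0 : ℂ)).prodMk (hasDerivAt_id t)
  have h2 := e2.differentiableAt.hasFDerivAt.comp_hasDerivAt t h1
  rwa [e1] at h2

theorem IsFirstIntegralAt.fderiv_fst {v : ℂ × ℂ → ℂ × ℂ} {f : ℂ × ℂ → ℂ} {u : ℂ}
    (hf : IsFirstIntegralAt v f (0, u)) (hfu : ∀ᶠ x in 𝓝 (0 : ℂ), f (x, u) = x) :
    fderiv ℂ f (0, u) (1, 0) = 1 := by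
  have h1 : HasDerivAt (fun t : ℂ => (t, u)) ((1 : ℂ), (0 : ℂ)) 0 :=
    (hasDerivAt_id (0 : ℂ)).prodMk (hasDerivAt_const 0 u)
  have h2 := hf.1.differentiableAt.hasFDerivAt.comp_hasDerivAt (0 : ℂ) h1
  exact h2.unique ((hasDerivAt_id (0 : ℂ)).congr_of_eventuallyEq hfu)

/-- Two first integrals are functions of each other. -/
theorem IsFirstIntegralAt.eq_comp {v : ℂ × ℂ → ℂ × ℂ} (hv : AnalyticAt ℂ v 0) {n : ℕ}
    (h0 : VanishesToOrder n v) {u : ℂ} (hu : tangentPoly n v u ≠ 0) {f g : ℂ × ℂ → ℂ}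
    (hf : IsFirstIntegralAt v f (0, u)) (hg : IsFirstIntegralAt v g (0, u))
    (hfu : ∀ᶠ x in 𝓝 (0 : ℂ), f (x, u) = x) :
    ∀ᶠ z in 𝓝 ((0 : ℂ), u), g z = g (f z, u) := by
  obtain ⟨X, hX, -, hXf⟩ := exists_regular_field hv h0 hu
  have hf1 := hf.fderiv_fst hfu
  have hf0 : f (0, u) = 0 := hfu.self_of_nhds
  -- In the coordinates `(f, u)` the leaves are the lines `f = cst`, so `g` depends on `f` alone;
  -- the dependence is read off on the transversal, where `f = x`.
  set T : ℂ × ℂ → ℂ × ℂ := fun z => (f z, z.2)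
  have hTd : ∀ z, AnalyticAt ℂ f z → ∀ a, fderiv ℂ T z a = (fderiv ℂ f z a, a.2) := fun z hz a => by
    have := (hz.differentiableAt.hasFDerivAt.prodMk (hasFDerivAt_snd (𝕜 := ℂ) (p := z))).fderiv
    simp only [T]
    rw [this]
    rfl
  have hT : IsLocalBihol T (0, u) := by
    refine ⟨hf.1.prod analyticAt_snd, ?_⟩
    rw [det_eq_det2, hTd _ hf.1, hTd _ hf.1, hf1]
    simp [det2]
  have hT0 : T (0, u) = (0, u) := Prod.ext hf0 rfl
  obtain ⟨S, hS, hS0, hST, hTS⟩ := hT.exists_inverse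
  rw [hT0] at hS hS0 hTS
  have hSt : Tendsto S (𝓝 (0, u)) (𝓝 (0, u)) := by simpa [hS0] using hS.continuousAt.tendsto
  have hTt : Tendsto T (𝓝 (0, u)) (𝓝 (0, u)) := by simpa [hT0] using hT.1.continuousAt.tendsto
  have hf1' : ∀ᶠ z in 𝓝 ((0 : ℂ), u), fderiv ℂ f z (1, 0) ≠ 0 := by
    have c1 := hf.1.fderiv.continuousAt
    have : ContinuousAt (fun z => fderiv ℂ f z (1, 0)) (0, u) := by fun_prop
    exact this.eventually_ne (by rw [hf1]; exact one_ne_zero)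
  have key : ∀ᶠ y in 𝓝 ((0 : ℂ), u), HasDerivAt (fun t => g (S (y.1, t))) 0 y.2 := by
    filter_upwards [hTS.eventually_nhds, hS.eventually_analyticAt,
      hSt.eventually hf.1.eventually_analyticAt, hSt.eventually hg.1.eventually_analyticAt,
      hSt.eventually hX, hSt.eventually (hXf f hf), hSt.eventually (hXf g hg),
      hSt.eventually hf1'] with y e1 e2 e3 e4 e5 e6 e7 e8
    have h1 : HasDerivAt (fun t : ℂ => (y.1, t)) ((0 : ℂ), (1 : ℂ)) y.2 :=
      (hasDerivAt_const y.2 y.1).prodMk (hasDerivAt_id y.2)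
    have h2 := e2.differentiableAt.hasFDerivAt.comp_hasDerivAt (f := fun t : ℂ => (y.1, t)) y.2 h1
    have h3 := e4.differentiableAt.hasFDerivAt.comp_hasDerivAt
      (f := S ∘ fun t : ℂ => (y.1, t)) y.2 h2
    set l := fderiv ℂ S y (0, 1)
    have h4 : fderiv ℂ T (S y) l = (0, 1) := by
      have h5 : fderiv ℂ (T ∘ S) y = ContinuousLinearMap.id ℂ (ℂ × ℂ) :=
        (EventuallyEq.fderiv_eq (e1 : T ∘ S =ᶠ[𝓝 y] id)).trans fderiv_id
      rw [fderiv_comp y (e3.differentiableAt.prodMk differentiableAt_snd) e2.differentiableAt] at h5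
      exact congrArg (fun L : ℂ × ℂ →L[ℂ] ℂ × ℂ => L (0, 1)) h5
    rw [hTd _ e3, Prod.mk.injEq] at h4
    -- Both `l` (where `l.2 = 1`) and `X` are in the kernel of `df` at this point, once `l` is known
    -- to preserve `f`; the kernel is a line because `df (1, 0) ≠ 0`.
    have h6 : (X (S y)).2 • l = X (S y) := by
      have h7 : fderiv ℂ f (S y) ((X (S y)).2 • l - X (S y)) = 0 := by
        rw [map_sub, map_smul, h4.1, e6, smul_zero, sub_zero]
      have h8 : (X (S y)).2 • l - X (S y) =
          ((X (S y)).2 • l - X (S y)).1 • ((1 : ℂ), (0 : ℂ)) := by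
        ext <;> simp [h4.2]
      rw [h8, map_smul, smul_eq_zero] at h7
      rw [← sub_eq_zero, h8, h7.resolve_right e8, zero_smul]
    have h9 : fderiv ℂ g (S y) l = 0 := by
      rw [← h6, map_smul, smul_eq_zero] at e7
      exact e7.resolve_left e5
    rw [← h9]
    exact h3
  obtain ⟨r, hr, hball⟩ := Metric.eventually_nhds_iff_ball.1 key
  have key2 : ∀ᶠ y in 𝓝 ((0 : ℂ), u), g (S y) = g (S (y.1, u)) := by
    filter_upwards [Metric.ball_mem_nhds _ hr] with y hy
    rw [← ball_prod_same, Set.mem_prod] at hy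
    have hmem : ∀ t ∈ Metric.ball u r, (y.1, t) ∈ Metric.ball ((0 : ℂ), u) r := fun t ht => by
      rw [← ball_prod_same]
      exact ⟨hy.1, ht⟩
    exact Metric.isOpen_ball.is_const_of_deriv_eq_zero (f := fun t => g (S (y.1, t)))
      (convex_ball u r).isPreconnected
      (fun x hx => (hball _ (hmem x hx)).differentiableAt.differentiableWithinAt)
      (fun x hx => (hball _ (hmem x hx)).deriv) hy.2 (Metric.mem_ball_self hr)
  have key3 : ∀ᶠ x in 𝓝 (0 : ℂ), g (S (x, u)) = g (x, u) := by
    filter_upwards [hfu, (tendsto_mk_right 0 u).eventually hST] with x e1 e2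
    have : T (x, u) = (x, u) := Prod.ext e1 rfl
    rw [this] at e2
    rw [e2]
  have hft : Tendsto f (𝓝 (0, u)) (𝓝 0) := by simpa [hf0] using hf.1.continuousAt.tendsto
  filter_upwards [hTt.eventually key2, hST, hft.eventually key3] with z e1 e2 e3
  rw [e2] at e1
  rw [e1, ← e3]

theorem IsFirstIntegralAt.comp_left {v : ℂ × ℂ → ℂ × ℂ} {f : ℂ × ℂ → ℂ} {z : ℂ × ℂ}
    (hf : IsFirstIntegralAt v f z) {φ : ℂ → ℂ} (hφ : AnalyticAt ℂ φ (f z))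
    (hφ' : deriv φ (f z) ≠ 0) : IsFirstIntegralAt v (fun w => φ (f w)) z := by
  have hd : ∀ᶠ w in 𝓝 z, fderiv ℂ (fun w => φ (f w)) w = deriv φ (f w) • fderiv ℂ f w := by
    filter_upwards [hf.1.eventually_analyticAt,
      hf.1.continuousAt.tendsto.eventually hφ.eventually_analyticAt] with w e1 e2
    exact (e2.differentiableAt.hasDerivAt.comp_hasFDerivAt w
      e1.differentiableAt.hasFDerivAt).fderiv
  refine ⟨AnalyticAt.fun_comp hφ hf.1, ?_, ?_⟩
  · rw [hd.self_of_nhds]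
    exact smul_ne_zero hφ' hf.2.1
  · filter_upwards [hd, hf.2.2] with w e1 e2
    rw [e1, _root_.smul_apply, e2, smul_zero]

/-! ## The holonomy of a direct image -/

theorem IsTangentToId.isLiftX {H : ℂ × ℂ → ℂ × ℂ} (hH : IsTangentToId H) (u : ℂ) :
    IsLiftX H (fun z => coordX (lift H (chartX z))) u := by
  obtain ⟨K, h1, h2, h3, b, h4, h5, h6⟩ := hH.exists_isLiftX u
  have e : K =ᶠ[𝓝 (0, u)] fun z => coordX (lift H (chartX z)) := by
    filter_upwards [h2] with z hz
    rw [hz, coordX_chartX]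
  refine ⟨h1.congr e, ?_, ?_, b, h4, ?_, h6⟩
  · filter_upwards [h2, e] with z e1 e2
    rw [e1, coordX_chartX]
  · filter_upwards [h3, (tendsto_mk_zero u).eventually e] with t e1 e2
    rw [← e2, e1]
  · filter_upwards [h5, e] with z e1 e2
    rw [← e2, e1]

/-- `df` vanishes along the divisor, so only the first component of `dM (1, 0)` matters, and it is
`1`. This keeps the germ conjugating the holonomies tangent to the identity. -/
theorem IsFirstIntegralAt.hasDerivAt_comp_isLiftX {v G M : ℂ × ℂ → ℂ × ℂ} (hv : AnalyticAt ℂ v 0)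
    {n : ℕ} (h0 : VanishesToOrder n v) {u : ℂ} (hu : tangentPoly n v u ≠ 0) {f : ℂ × ℂ → ℂ}
    (hf : IsFirstIntegralAt v f (0, u)) (hfu : ∀ᶠ x in 𝓝 (0 : ℂ), f (x, u) = x)
    (hM : IsLiftX G M u) : HasDerivAt (fun x => f (M (x, u))) 1 0 := by
  have hM0 : M (0, u) = (0, u) := hM.divisor.self_of_nhds
  have h1 : HasDerivAt (fun t : ℂ => (t, u)) ((1 : ℂ), (0 : ℂ)) 0 :=
    (hasDerivAt_id (0 : ℂ)).prodMk (hasDerivAt_const 0 u)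
  have h2 := hM.bihol.1.differentiableAt.hasFDerivAt.comp_hasDerivAt (0 : ℂ) h1
  have h3 : HasFDerivAt f (fderiv ℂ f (0, u)) ((M ∘ fun t : ℂ => (t, u)) 0) := by
    simp only [Function.comp, hM0]
    exact hf.1.differentiableAt.hasFDerivAt
  have h4 := h3.comp_hasDerivAt (0 : ℂ) h2
  obtain ⟨b, hb, e1, e2⟩ := hM.fst
  have h5 : (fderiv ℂ M (0, u) (1, 0)).1 = 1 := by
    have h6 := (ContinuousLinearMap.fst ℂ ℂ ℂ).hasFDerivAt.comp_hasDerivAt (0 : ℂ) h2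
    have h7 : HasDerivAt (fun x => x * b (x, u)) (1 * b (0, u) + 0 * deriv (fun x => b (x, u)) 0) 0 :=
      (hasDerivAt_id (0 : ℂ)).mul hb.slice.differentiableAt.hasDerivAt
    rw [zero_mul, add_zero, one_mul, e2.self_of_nhds] at h7
    exact h6.unique (h7.congr_of_eventuallyEq ((tendsto_mk_right 0 u).eventually e1))
  have h6 : fderiv ℂ f (0, u) (fderiv ℂ M (0, u) (1, 0)) = 1 := by
    rw [show fderiv ℂ M (0, u) (1, 0) = (1, 0) + (fderiv ℂ M (0, u) (1, 0)).2 • ((0 : ℂ), (1 : ℂ)) by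
      ext <;> simp [h5], map_add, map_smul, hf.fderiv_fst hfu,
      (hf.fderiv_snd_eq_zero hv h0 hu).self_of_nhds, smul_zero, add_zero]
  rw [h6] at h4
  exact h4

theorem exists_inverse_germ {κ : ℂ → ℂ} (hκ : AnalyticAt ℂ κ 0) (h0 : κ 0 = 0)
    (h1 : deriv κ 0 = 1) : ∃ ρ : ℂ → ℂ, AnalyticAt ℂ ρ 0 ∧ ρ 0 = 0 ∧ deriv ρ 0 = 1 ∧
      (∀ᶠ x in 𝓝 0, ρ (κ x) = x) ∧ ∀ᶠ x in 𝓝 0, κ (ρ x) = x := by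
  have hd : deriv κ 0 ≠ 0 := by rw [h1]; exact one_ne_zero
  have hs := hκ.hasStrictDerivAt
  have ha := hκ.analyticAt_localInverse hd
  have hb := (hs.to_localInverse hd).hasDerivAt.deriv
  have hc : hs.localInverse _ _ _ hd (κ 0) = 0 := HasStrictFDerivAt.localInverse_apply_image ..
  have hr := hs.eventually_right_inverse hd
  rw [h0] at ha hb hc hr
  exact ⟨_, ha, hc, by rw [hb, h1, inv_one], hs.eventually_left_inverse hd, hr⟩

/-- The lift of `G` moves the transversal `u = u₀` to another curve; sliding it back along the
leaves, by means of the first integral `f`, gives a germ `κ` tangent to the identity. The holonomies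
are conjugated by `κ`, so with `ρ = κ⁻¹` the single germ `ρ ∘ χ` serves for all loops. -/
theorem IsNonDicritical.of_isPush {H G v v' : ℂ × ℂ → ℂ × ℂ} {n : ℕ} {p : Fin (n + 1) → ℂ}
    {u₀ : ℂ} (hu₀ : u₀ ∉ Set.range p) {h : Path u₀ u₀ → ℂ → ℂ} (hv : IsNonDicritical p h v)
    (hH : IsTangentToId H) (hG : IsTangentToId G)
    (hGH : ∀ᶠ z in 𝓝 0, G (H z) = z) (hHG : ∀ᶠ z in 𝓝 0, H (G z) = z)
    (hv' : AnalyticAt ℂ v' 0) (hp : IsPush H v v') : IsNonDicritical p h v' := by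
  obtain ⟨h1, h2⟩ := homVec_of_isPush hH hG hHG hv.germ.1 hv' hp hv.order
  have h3 : ∀ u, tangentPoly n v' u = tangentPoly n v u := fun u => by
    rw [tangentPoly_eq, h2, ← tangentPoly_eq]
  have hsing : ∃ c : ℂ, c ≠ 0 ∧ ∀ u, tangentPoly n v u = c * ∏ i, (u - p i) := hv.singular
  refine ⟨isFoliationGerm_of_isPush hH hG hHG hv.germ hv' hp, h1, by simpa only [h3], ?_⟩
  have hne : ∀ u, (∀ i, u ≠ p i) → tangentPoly n v u ≠ 0 := fun u hu => by
    obtain ⟨c, hc, e⟩ := hsing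
    rw [e]
    exact mul_ne_zero hc (Finset.prod_ne_zero_iff.2 fun i _ => sub_ne_zero.2 (hu i))
  have hu₀' : ∀ i, u₀ ≠ p i := fun i e => hu₀ ⟨i, e.symm⟩
  obtain ⟨χ, hχ, hχ0, hχ1, hχh⟩ := hv.holonomy
  set M : ℂ × ℂ → ℂ × ℂ := fun z => coordX (lift G (chartX z)) with hMdef
  have hM : ∀ u, IsLiftX G M u := hG.isLiftX
  have hpush := isPush_symm hH hG hGH hHG hp
  -- The constant loop only provides a first integral near `(0, u₀)` which is `x` on the
  -- transversal.
  obtain ⟨-, -, g₀, ⟨-, -, F, hF, -, hF0, -⟩, -⟩ := hχh (Path.refl u₀) fun t i => hu₀' i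
  set f := F 0 with hf_def
  have hf : IsFirstIntegralAt v f (0, u₀) := by simpa using hF 0
  have hM0 : ∀ t, M (0, t) = (0, t) := fun t => (hM t).divisor.self_of_nhds
  set κ : ℂ → ℂ := fun x => f (M (x, u₀)) with hκ_def
  have hκ : AnalyticAt ℂ κ 0 :=
    AnalyticAt.slice (f := fun z => f (M z))
      (AnalyticAt.fun_comp (by rw [hM0]; exact hf.1) (hM u₀).bihol.1)
  have hκ0 : κ 0 = 0 := by simp only [κ, hM0]; exact hF0.self_of_nhds
  have hκ1 : deriv κ 0 = 1 := (hf.hasDerivAt_comp_isLiftX hv.germ.1 hv.order (hne _ hu₀') hF0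
    (hM u₀)).deriv
  obtain ⟨ρ, hρ, hρ0, hρ1, hρκ, hκρ⟩ := exists_inverse_germ hκ hκ0 hκ1
  have hχt : Tendsto χ (𝓝 0) (𝓝 0) := by simpa [hχ0] using hχ.continuousAt.tendsto
  have hκt : Tendsto κ (𝓝 0) (𝓝 0) := by simpa [hκ0] using hκ.continuousAt.tendsto
  have hρt : Tendsto ρ (𝓝 0) (𝓝 0) := by simpa [hρ0] using hρ.continuousAt.tendsto
  refine ⟨fun x => ρ (χ x), AnalyticAt.fun_comp (by rwa [hχ0]) hχ, by simp only [hχ0, hρ0], ?_,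
    fun γ hγ => ?_⟩
  · have h4 := hρ.differentiableAt.hasDerivAt
    have h5 : HasDerivAt ρ (deriv ρ 0) (χ 0) := by rwa [hχ0]
    have h6 := (h5.comp 0 hχ.differentiableAt.hasDerivAt).deriv
    rw [hρ1, hχ1, one_mul] at h6
    exact h6
  obtain ⟨hh, hh0, g, ⟨hg, hg0, E, hE1, hE2, hE3, hE4⟩, hconj⟩ := hχh γ hγ
  have hgt : Tendsto g (𝓝 0) (𝓝 0) := by simpa [hg0] using hg.continuousAt.tendsto
  have hhγ : Tendsto (h γ) (𝓝 0) (𝓝 0) := by simpa [hh0] using hh.continuousAt.tendsto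
  have hE10 : IsFirstIntegralAt v (E 0) (0, u₀) := by simpa using hE1 0
  have hE11 : IsFirstIntegralAt v (E 1) (0, u₀) := by simpa using hE1 1
  -- the first integrals vanish on the divisor
  have hzero : ∀ t, E t (0, γ t) = 0 := by
    have hlc : IsLocallyConstant fun t => E t (0, γ t) := by
      rw [IsLocallyConstant.iff_eventually_eq]
      intro t
      filter_upwards [hE2 t, (γ.continuous.tendsto t).eventually
        ((hE1 t).eventually_divisor_eq hv.germ.1 hv.order (hne _ (hγ t)))] with s e1 e2
      rw [e1.self_of_nhds, e2]
    intro t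
    have h4 := hlc.apply_eq_of_isPreconnected isPreconnected_univ (Set.mem_univ t)
      (Set.mem_univ 0)
    rw [h4, Path.source]
    exact hE3.self_of_nhds
  have hMt : Tendsto (fun x => M (x, u₀)) (𝓝 0) (𝓝 (0, u₀)) :=
    (hM u₀).tendsto.comp (tendsto_mk_right 0 u₀)
  -- compatibility of the first integrals at the base point
  have hEf : ∀ᶠ x in 𝓝 (0 : ℂ), E 0 (M (x, u₀)) = κ x := by
    filter_upwards [hMt.eventually (hf.eq_comp hv.germ.1 hv.order (hne _ hu₀') hE10 hF0),
      hκt.eventually hE3] with x e1 e2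
    rw [e1]
    exact e2
  have hE1f : ∀ᶠ x in 𝓝 (0 : ℂ), E 1 (M (x, u₀)) = E 1 (κ x, u₀) := by
    filter_upwards [hMt.eventually (hf.eq_comp hv.germ.1 hv.order (hne _ hu₀') hE11 hF0)]
      with x e1
    exact e1
  -- The continued first integrals are pulled back by `M` and renormalized by `ρ`, so that the
  -- initial one is again `x` on the transversal. The final one is `ρ (E 1 (κ x, u₀))` there, which
  -- makes the holonomy `ρ ∘ g ∘ κ`.
  refine ⟨hh, hh0, fun x => ρ (g (κ x)), ⟨?_, ?_, fun t z => ρ (E t (M z)), fun t => ?_,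
    fun t => ?_, ?_, ?_⟩, ?_⟩
  · refine AnalyticAt.fun_comp (g := ρ) (f := fun x => g (κ x)) (by rwa [hκ0, hg0]) ?_
    exact AnalyticAt.fun_comp (by rwa [hκ0]) hκ
  · simp only [hκ0, hg0, hρ0]
  · refine ((hE1 t).comp_lift hG hpush hv' (hM _)).comp_left ?_ ?_
    · rwa [hM0, hzero]
    · rw [hM0, hzero, hρ1]
      exact one_ne_zero
  · filter_upwards [hE2 t] with s hs
    filter_upwards [(hM (γ s)).tendsto.eventually hs] with z hz
    rw [hz]
  · filter_upwards [hEf, hρκ] with x e1 e2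
    rw [e1, e2]
  · have ht : Tendsto (fun x => ρ (g (κ x))) (𝓝 0) (𝓝 0) := hρt.comp (hgt.comp hκt)
    filter_upwards [ht.eventually hE1f, (hgt.comp hκt).eventually hκρ, hκt.eventually hE4, hρκ]
      with x e1 e2 e3 e4
    simp only [Function.comp] at e2
    rw [e1, e2, e3, e4]
  · filter_upwards [hχt.eventually hκρ, hconj] with x e1 e2
    rw [e1, e2]

/-! ## Transport of normalizing transformations -/

theorem fderiv_comp_apply_of_analyticAt {H f : ℂ × ℂ → ℂ × ℂ} {z : ℂ × ℂ}
    (hH : AnalyticAt ℂ H (f z)) (hf : AnalyticAt ℂ f z) (a : ℂ × ℂ) :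
    fderiv ℂ (fun w => H (f w)) z a = fderiv ℂ H (f z) (fderiv ℂ f z a) := by
  rw [show (fun w => H (f w)) = H ∘ f from rfl,
    fderiv_comp z hH.differentiableAt hf.differentiableAt]
  rfl

theorem CarriesAt.of_isPush {H X v v' : ℂ × ℂ → ℂ × ℂ} {F : ℂ × ℂ → Blowup} {z₀ : ℂ × ℂ}
    (hH : IsTangentToId H) (h : IsPush H v v') (hF : IsBiholAt F z₀) (h0 : (F z₀).pt = 0)
    (hc : CarriesAt (fun z => (F z).pt) X v z₀) :
    CarriesAt (fun z => (lift H (F z)).pt) X v' z₀ := by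
  have ht : Tendsto (fun z => (F z).pt) (𝓝 z₀) (𝓝 0) := by
    simpa [h0] using hF.analyticAt_pt.continuousAt.tendsto
  unfold CarriesAt
  simp only [lift_pt]
  filter_upwards [hc, ht.eventually h, ht.eventually hH.1.eventually_analyticAt,
    hF.analyticAt_pt.eventually_analyticAt] with z e1 e2 e3 e4
  rw [fderiv_comp_apply_of_analyticAt (f := fun z => (F z).pt) e3 e4, e2, det2_map, e1, mul_zero]

theorem AnalyticAt.isBigO_fst_of_divisor {f : ℂ × ℂ → ℂ} {u : ℂ} (hf : AnalyticAt ℂ f (0, u))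
    (h : ∀ᶠ t in 𝓝 u, f (0, t) = 0) : f =O[𝓝 (0, u)] fun z => z.1 := by
  obtain ⟨F, hF, h1, -⟩ := hf.exists_xCoeff_succ
  have h2 : f =ᶠ[𝓝 (0, u)] fun z => z.1 * F z := by
    filter_upwards [h1, (continuous_snd.tendsto ((0 : ℂ), u)).eventually h] with z e1 e2
    rw [e1, e2, zero_add]
  refine h2.trans_isBigO ?_
  simpa using (Asymptotics.isBigO_refl (fun z : ℂ × ℂ => z.1) (𝓝 (0, u))).mul
    (hF.continuousAt.tendsto.isBigO_one ℂ)

theorem Blowup.tendsto_of_jet {N : ℂ × ℂ → ℂ × ℂ} {u : ℂ}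
    (h1 : (fun a => (N a).1 - a.1) =O[𝓝 (0, u)] fun a => a.1 ^ 2)
    (h2 : (fun a => (N a).2 - a.2) =O[𝓝 (0, u)] fun a => a.1) :
    Tendsto N (𝓝 (0, u)) (𝓝 (0, u)) := by
  have c1 : Tendsto (fun a : ℂ × ℂ => a.1) (𝓝 (0, u)) (𝓝 0) := continuous_fst.tendsto _
  have c2 : Tendsto (fun a : ℂ × ℂ => a.2) (𝓝 (0, u)) (𝓝 u) := continuous_snd.tendsto _
  have h3 := (h1.trans_tendsto (by simpa using c1.pow 2)).add c1
  have h4 := (h2.trans_tendsto c1).add c2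
  simp only [sub_add_cancel, zero_add] at h3 h4
  exact h3.prodMk_nhds h4

/-- The lift is `(x b, u + O(x))` with `b = 1 + O(x)`, and the first coordinate of `N` is `O(x)`. -/
theorem Blowup.jet_lift {H : ℂ × ℂ → ℂ × ℂ} {N : ℂ × ℂ → ℂ × ℂ} {u : ℂ} (hH : IsTangentToId H)
    (h1 : (fun a => (N a).1 - a.1) =O[𝓝 (0, u)] fun a => a.1 ^ 2)
    (h2 : (fun a => (N a).2 - a.2) =O[𝓝 (0, u)] fun a => a.1) :
    ((fun a => (coordX (lift H (chartX (N a)))).1 - a.1) =O[𝓝 (0, u)] fun a => a.1 ^ 2) ∧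
    ((fun a => (coordX (lift H (chartX (N a)))).2 - a.2) =O[𝓝 (0, u)] fun a => a.1) := by
  have ht := tendsto_of_jet h1 h2
  have c1 : Tendsto (fun a : ℂ × ℂ => a.1) (𝓝 (0, u)) (𝓝 0) := continuous_fst.tendsto _
  have h3 : (fun a => (N a).1) =O[𝓝 (0, u)] fun a => a.1 := by
    have h4 : (fun a : ℂ × ℂ => a.1 ^ 2) =O[𝓝 (0, u)] fun a => a.1 := by
      simpa [pow_two] using (Asymptotics.isBigO_refl (fun a : ℂ × ℂ => a.1) (𝓝 (0, u))).mul
        (c1.isBigO_one ℂ)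
    simpa using (h1.trans h4).add (Asymptotics.isBigO_refl (fun a : ℂ × ℂ => a.1) (𝓝 (0, u)))
  set K : ℂ × ℂ → ℂ × ℂ := fun z => coordX (lift H (chartX z))
  have hK : IsLiftX H K u := hH.isLiftX u
  obtain ⟨b, hb, e1, e2⟩ := hK.fst
  have hb1 : (fun z => b z - 1) =O[𝓝 (0, u)] fun z => z.1 :=
    (hb.fun_sub analyticAt_const).isBigO_fst_of_divisor (by
      filter_upwards [e2] with t ht
      rw [ht, sub_self])
  have hK2 : (fun z => (K z).2 - z.2) =O[𝓝 (0, u)] fun z => z.1 :=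
    (hK.bihol.1.prod_snd.fun_sub analyticAt_snd).isBigO_fst_of_divisor (by
      filter_upwards [hK.divisor] with t ht
      rw [ht, sub_self])
  constructor
  · have h4 : (fun a => ((N a).1 - a.1) * b (N a) + a.1 * (b (N a) - 1)) =O[𝓝 (0, u)]
        fun a => a.1 ^ 2 := by
      refine Asymptotics.IsBigO.add ?_ ?_
      · simpa using h1.mul ((hb.continuousAt.tendsto.comp ht).isBigO_one ℂ)
      · simpa [pow_two] using (Asymptotics.isBigO_refl (fun a : ℂ × ℂ => a.1) (𝓝 (0, u))).mul
          ((hb1.comp_tendsto ht).trans h3)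
    refine EventuallyEq.trans_isBigO ?_ h4
    filter_upwards [ht.eventually e1] with a ha
    change (K (N a)).1 - a.1 = _
    rw [ha]
    ring
  · have h4 := ((hK2.comp_tendsto ht).trans h3).add h2
    refine h4.congr_left fun a => ?_
    simp only [Function.comp]
    exact sub_add_sub_cancel _ _ _

section
variable {n m : ℕ} {p : Fin (n + 1) → ℂ} {q : Fin m → ℂ} {I : Fin m → ℂ → ℂ}
  {μ : ℂ × ℂ → ℂ × ℂ} {ε : Fin (n + 1) → ℂ × ℂ → ℂ} {ς : Fin m → ℂ × ℂ → ℂ}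
  {s : Fin (n + 1) → ℂ → ℂ} {z : Fin m → ℂ → ℂ} {v w : ℂ × ℂ → ℂ × ℂ}
  {Hn : Blowup → Blowup} {Hp : Fin (n + 1) → ℂ × ℂ → Blowup} {Hq : Fin m → ℂ × ℂ → Blowup}

theorem chartX_mem_puncturedDivisor {S : Set ℂ} {u : ℂ} (hu : u ∉ S) :
    chartX (0, u) ∈ puncturedDivisor S :=
  ⟨by simp [chartX], fun t ht h => hu (by
    have h1 : u = t := OnePoint.coe_injective h
    rwa [h1])⟩

theorem IsNormalizing.isBiholAt_chartX (h : IsNormalizing p q I μ ε ς s z v w Hn Hp Hq) {u : ℂ}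
    (hu : u ∉ Set.range p ∪ Set.range q) : IsBiholAt (fun a => Hn (chartX a)) (0, u) := by
  obtain ⟨U, hU, hb, -⟩ := h.regular_bihol
  exact hb.2.2.1 _ (hU (chartX_mem_puncturedDivisor hu))

theorem IsNormalizing.chartX_eq (h : IsNormalizing p q I μ ε ς s z v w Hn Hp Hq) {u : ℂ}
    (hu : u ∉ Set.range p ∪ Set.range q) : Hn (chartX (0, u)) = chartX (0, u) :=
  h.regular_id _ (chartX_mem_puncturedDivisor hu)

theorem IsNormalizing.eventually_chartX (h : IsNormalizing p q I μ ε ς s z v w Hn Hp Hq) {u : ℂ}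
    (hu : u ∉ Set.range p ∪ Set.range q) :
    IsLocalBihol (fun a => coordX (Hn (chartX a))) (0, u) ∧
      ∀ᶠ a in 𝓝 (0, u), Hn (chartX a) = chartX (coordX (Hn (chartX a))) :=
  (h.isBiholAt_chartX hu).exists_chartX (by
    rw [h.chartX_eq hu]; exact OnePoint.coe_ne_infty _)

/-- Composition on the left by a map which is the identity on the divisor leaves the models and the
factorizations unchanged. Only the condition on a neighbourhood of the punctured sphere requires
shrinking: the images must project into a ball where `H` is injective and the transformation laws
hold. -/
theorem IsNormalizing.of_isPush {H v' w' : ℂ × ℂ → ℂ × ℂ}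
    (h : IsNormalizing p q I μ ε ς s z v w Hn Hp Hq) (hH : IsTangentToId H)
    (hv : IsPush H v v') (hw : IsPush H w w') :
    IsNormalizing p q I μ ε ς s z v' w' (fun a => lift H (Hn a)) (fun i a => lift H (Hp i a))
      (fun j a => lift H (Hq j a)) := by
  have hp0 : ∀ i, (Hp i (0, p i)).pt = 0 := fun i => by
    rw [(h.singular_id i).self_of_nhds]; simp [chartX]
  have hq0 : ∀ j, (Hq j (0, q j)).pt = 0 := fun j => by
    rw [(h.tangency_id j).self_of_nhds]; simp [chartX]
  have hlift0 : ∀ t : ℂ, lift H (chartX (0, t)) = chartX (0, t) := fun t =>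
    lift_of_pt_eq_zero hH.2.1 (by simp [chartX])
  have hbi := hH.isBiholAt_lift.self_of_nhds
  refine ⟨?_, ?_, ?_, h.s_germ, fun i => hbi _ _ (hp0 i) (h.singular_bihol i), ?_, fun i =>
    ⟨(h.singular_carries i).1.of_isPush hH hv (h.singular_bihol i) (hp0 i),
      (h.singular_carries i).2.of_isPush hH hw (h.singular_bihol i) (hp0 i)⟩, h.z_germ, fun j =>
    hbi _ _ (hq0 j) (h.tangency_bihol j), ?_, fun j =>
    ⟨(h.tangency_carries j).1.of_isPush hH hv (h.tangency_bihol j) (hq0 j),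
      (h.tangency_carries j).2.of_isPush hH hw (h.tangency_bihol j) (hq0 j)⟩, ?_, ?_⟩
  · obtain ⟨U, hU, ⟨hUo, hinj, hX, hY⟩, hc1, hc2⟩ := h.regular_bihol
    obtain ⟨G, hG, hGH, -⟩ := hH.exists_inverse
    obtain ⟨r, hr, hB⟩ := Metric.eventually_nhds_iff_ball.1
      (hGH.and (hv.and (hw.and (hH.1.eventually_analyticAt.and hH.isBiholAt_lift))))
    set B := Metric.ball (0 : ℂ × ℂ) r
    have hHinj : Set.InjOn H B := fun a ha b hb e => by
      rw [← (hB a ha).1, e, (hB b hb).1]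
    have hopen : ∀ c : ℂ × ℂ → Blowup, IsOpen (c ⁻¹' U) →
        (∀ a, c a ∈ U → IsBiholAt (fun b => Hn (c b)) a) →
        IsOpen (c ⁻¹' (U ∩ {a | (Hn a).pt ∈ B})) := fun c hcU hcb => by
      have : ContinuousOn (fun a => (Hn (c a)).pt) (c ⁻¹' U) := fun a ha =>
        (hcb a ha).analyticAt_pt.continuousAt.continuousWithinAt
      exact this.isOpen_inter_preimage hcU Metric.isOpen_ball
    have hpt : ∀ a : ℂ × ℂ, a ≠ 0 → ofPoint a ∈ U →
        AnalyticAt ℂ (fun b => (Hn (ofPoint b)).pt) a := fun a ha haU => by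
      have : IsBiholAt (fun b => Hn (ofPoint b)) a := by
        rcases isBiholAt_iff.1 (isBiholAt_ofPoint (h := fun b => b) (z := a)
          ⟨analyticAt_id, by simp [det_eq_det2, det2]⟩ ha) with ⟨N, hN, e⟩ | ⟨N, hN, e⟩
        · refine Blowup.IsBiholAt.congr (F := fun b => Hn (chartX (N b))) ?_ ?_
          · refine Blowup.IsBiholAt.comp (F := fun b => Hn (chartX b)) (hX _ ?_) hN
            rwa [← e.self_of_nhds]
          · filter_upwards [e] with b hb
            rw [hb]
        · refine Blowup.IsBiholAt.congr (F := fun b => Hn (chartY (N b))) ?_ ?_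
          · refine Blowup.IsBiholAt.comp (F := fun b => Hn (chartY b)) (hY _ ?_) hN
            rwa [← e.self_of_nhds]
          · filter_upwards [e] with b hb
            rw [hb]
      exact this.analyticAt_pt
    refine ⟨U ∩ {a | (Hn a).pt ∈ B}, fun a ha => ⟨hU ha, ?_⟩, ⟨?_, ?_, ?_, ?_⟩, ?_, ?_⟩
    · rw [Set.mem_ofPred_eq, h.regular_id a ha, ha.1]
      exact Metric.mem_ball_self hr
    · exact (isOpen_iff _).2 ⟨hopen _ ((isOpen_iff _).1 hUo).1 hX,
        hopen _ ((isOpen_iff _).1 hUo).2 hY⟩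
    · intro a ha b hb e
      exact hinj ha.1 hb.1 (lift_injOn hHinj hH.2.1 ha.2 hb.2 e)
    · exact fun a ha => (hB _ ha.2).2.2.2.2 _ _ rfl (hX a ha.1)
    · exact fun a ha => (hB _ ha.2).2.2.2.2 _ _ rfl (hY a ha.1)
    · intro a ha haU
      obtain ⟨-, e1, -, e2, -⟩ := hB _ haU.2
      simp only [lift_pt]
      rw [fderiv_comp_apply_of_analyticAt (f := fun b => (Hn (ofPoint b)).pt) e2
        (hpt a ha haU.1), e1, det2_map, hc1 a ha haU.1, mul_zero]
    · intro a ha haU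
      obtain ⟨-, -, e1, e2, -⟩ := hB _ haU.2
      simp only [lift_pt]
      rw [fderiv_comp_apply_of_analyticAt (f := fun b => (Hn (ofPoint b)).pt) e2
        (hpt a ha haU.1), e1, det2_map, hc2 a ha haU.1, mul_zero]
  · intro a ha
    simp only [h.regular_id a ha]
    exact lift_of_pt_eq_zero hH.2.1 ha.1
  · intro u hu
    have h1 := h.regular_jet u hu
    have h2 := jet_lift hH h1.1 h1.2
    have h3 := (h.eventually_chartX hu).2
    refine ⟨EventuallyEq.trans_isBigO ?_ h2.1, EventuallyEq.trans_isBigO ?_ h2.2⟩ <;>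
    · filter_upwards [h3] with a ha
      rw [← ha]
  · intro i
    filter_upwards [h.singular_id i] with t ht
    rw [ht, hlift0]
  · intro j
    filter_upwards [h.tangency_id j] with t ht
    rw [ht, hlift0]
  · intro i
    filter_upwards [h.factorization_p i] with t ht
    filter_upwards [ht] with a ha
    rw [ha]
  · intro j
    obtain ⟨φ, hφ⟩ := h.factorization_q j
    refine ⟨φ, ?_⟩
    filter_upwards [hφ] with t ht
    refine ⟨ht.1, ht.2.1, ?_⟩
    filter_upwards [ht.2.2] with a ha
    exact ⟨ha.1, by rw [ha.2]⟩

end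

/-! ## The jets of normalizing transformations -/

theorem hasDerivAt_involutionFun {c u : ℂ} {J : ℂ → ℂ} (hJ : DifferentiableAt ℂ J u) :
    HasDerivAt (involutionFun c J) (-(J u - c) + (c - u) * deriv J u) u := by
  have h := ((hasDerivAt_id u).const_sub c).mul (hJ.hasDerivAt.sub_const c)
  exact h.congr_deriv (by simp)

theorem deriv_involutionFun {c : ℂ} {J : ℂ → ℂ} (hJ : AnalyticAt ℂ J c) (h0 : J c = c) :
    deriv (involutionFun c J) c = 0 := by
  rw [(hasDerivAt_involutionFun hJ.differentiableAt).deriv, h0]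
  ring

/-- Since `J' = -1` at the fixed point, `(c - u) (J u - c)` is `(u - c) ^ 2` to leading order; so
the derivative of this function has a simple zero at `c`. -/
theorem deriv_deriv_involutionFun {c : ℂ} {J : ℂ → ℂ} (hJ : AnalyticAt ℂ J c)
    (h1 : deriv J c = -1) : deriv (deriv (involutionFun c J)) c = 2 := by
  have h : deriv (involutionFun c J) =ᶠ[𝓝 c] fun u => -(J u - c) + (c - u) * deriv J u := by
    filter_upwards [hJ.eventually_analyticAt] with u hu
    exact (hasDerivAt_involutionFun hu.differentiableAt).deriv
  rw [h.deriv_eq]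
  have h2 := ((hJ.differentiableAt.hasDerivAt.sub_const c).neg).add
    (((hasDerivAt_id c).const_sub c).mul hJ.deriv.differentiableAt.hasDerivAt)
  have h3 := h2.deriv
  rw [h1] at h3
  refine Eq.trans ?_ (h3.trans ?_)
  · rfl
  · simp; norm_num

/-- The coefficient of `x ^ k` in the first coordinate of `F`. -/
noncomputable def jetX (F : ℂ × ℂ → Blowup) (k : ℕ) : ℂ → ℂ := xCoeff k fun a => (coordX (F a)).1

/-- The coefficient of `x ^ k` in the second coordinate of `F`, minus `u`. -/
noncomputable def jetU (F : ℂ × ℂ → Blowup) (k : ℕ) : ℂ → ℂ :=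
  xCoeff k fun a => (coordX (F a)).2 - a.2

/-- `F` is a germ of biholomorphism at `(0, c)` which is the identity on the divisor. -/
structure IsDivisorGerm (F : ℂ × ℂ → Blowup) (c : ℂ) : Prop where
  bihol : IsBiholAt F (0, c)
  divisor : ∀ᶠ t in 𝓝 c, F (0, t) = chartX (0, t)

namespace IsDivisorGerm

variable {F : ℂ × ℂ → Blowup} {c : ℂ}

theorem coord (h : IsDivisorGerm F c) : IsLocalBihol (fun a => coordX (F a)) (0, c) :=
  (h.bihol.exists_chartX (by
    rw [h.divisor.self_of_nhds]; exact OnePoint.coe_ne_infty _)).1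

theorem eventually_eq (h : IsDivisorGerm F c) : ∀ᶠ a in 𝓝 (0, c), F a = chartX (coordX (F a)) :=
  (h.bihol.exists_chartX (by
    rw [h.divisor.self_of_nhds]; exact OnePoint.coe_ne_infty _)).2

theorem analyticAt_fst (h : IsDivisorGerm F c) :
    AnalyticAt ℂ (fun a => (coordX (F a)).1) (0, c) := h.coord.1.prod_fst

theorem analyticAt_snd (h : IsDivisorGerm F c) :
    AnalyticAt ℂ (fun a => (coordX (F a)).2 - a.2) (0, c) :=
  h.coord.1.prod_snd.fun_sub _root_.analyticAt_snd

theorem fst_zero (h : IsDivisorGerm F c) : ∀ᶠ t in 𝓝 c, (coordX (F (0, t))).1 = 0 := by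
  filter_upwards [h.divisor] with t ht
  rw [ht, coordX_chartX]

theorem snd_zero (h : IsDivisorGerm F c) : ∀ᶠ t in 𝓝 c, (coordX (F (0, t))).2 - t = 0 := by
  filter_upwards [h.divisor] with t ht
  rw [ht, coordX_chartX, sub_self]

theorem analyticAt_jetX (h : IsDivisorGerm F c) (k : ℕ) : AnalyticAt ℂ (jetX F k) c :=
  analyticAt_xCoeff h.analyticAt_fst k

theorem analyticAt_jetU (h : IsDivisorGerm F c) (k : ℕ) : AnalyticAt ℂ (jetU F k) c :=
  analyticAt_xCoeff h.analyticAt_snd k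

theorem hasJetAt (h : IsDivisorGerm F c) {k : ℕ} {a b : ℕ → ℂ → ℂ}
    (ha : ∀ r ∈ Finset.Icc 1 k, jetX F r =ᶠ[𝓝 c] a r)
    (hb : ∀ r ∈ Finset.Icc 1 k, jetU F r =ᶠ[𝓝 c] b r) : HasJetAt k F a b c := by
  have aux : ∀ (f : ℂ × ℂ → ℂ) (a : ℕ → ℂ → ℂ), AnalyticAt ℂ f (0, c) →
      (∀ᶠ t in 𝓝 c, f (0, t) = 0) → (∀ r ∈ Finset.Icc 1 k, xCoeff r f =ᶠ[𝓝 c] a r) →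
      (fun y : ℂ × ℂ => f y - ∑ r ∈ Finset.Icc 1 k, a r y.2 * y.1 ^ r)
        =O[𝓝 (0, c)] fun y => y.1 ^ (k + 1) := by
    intro f a hf hf0 ha
    refine EventuallyEq.trans_isBigO ?_ (hf.isBigO_expansion (k + 1))
    have hs := continuous_snd.tendsto ((0 : ℂ), c)
    filter_upwards [hs.eventually hf0, hs.eventually ((Finset.eventually_all _).2 ha)] with y e1 e2
    rw [Finset.sum_range_eq_add_Ico _ (Nat.succ_pos k), xCoeff_zero, e1, zero_mul, zero_add,
      show Finset.Ico 1 (k + 1) = Finset.Icc 1 k by ext; simp]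
    congr 1
    exact Finset.sum_congr rfl fun r hr => by rw [e2 r hr]
  refine ⟨aux _ _ h.analyticAt_fst h.fst_zero ha, ?_⟩
  refine (aux _ _ h.analyticAt_snd h.snd_zero hb).congr_left fun y => ?_
  ring

end IsDivisorGerm

theorem extendAt_of_ne (f : ℂ → ℂ) {c u : ℂ} (h : u ≠ c) : extendAt f c u = f u :=
  Function.update_of_ne h _ _

namespace ModelData

variable {n m : ℕ} (D : ModelData n m)

theorem aP_one (i : Fin (n + 1)) : D.aP i 1 = D.eps i 1 := by rw [aP]

theorem aP_add_two {i : Fin (n + 1)} (k : ℕ) {u : ℂ} (hu : u ≠ D.p i) :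
    D.aP i (k + 2) u = D.eps i (k + 2) u
        + functionalP (k + 1) (D.lam i) (D.p i) (D.s i) (D.eps i) D.aN u
        + (D.eps i 1 u) ^ (k + 2) * D.aN (k + 2) u := by
  rw [aP, extendAt_of_ne _ hu]

theorem bP_one (i : Fin (n + 1)) : D.bP i 1 = fun u => D.s i 1 + D.eps i 1 u * D.bN 1 u := by
  rw [bP]

theorem bP_add_two {i : Fin (n + 1)} (k : ℕ) {u : ℂ} (hu : u ≠ D.p i) :
    D.bP i (k + 2) u = D.s i (k + 2) + D.eps i (k + 2) u * D.bN 1 u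
        + functionalP (k + 1) (D.lam i) (D.p i) (D.s i) (D.eps i) D.bN u
        + (D.eps i 1 u) ^ (k + 2) * D.bN (k + 2) u := by
  rw [bP, extendAt_of_ne _ hu]

theorem aQ_one (j : Fin m) : D.aQ j 1 = D.sig j 1 := by rw [aQ]

theorem aQ_add_two {j : Fin m} (k : ℕ) {u : ℂ} (hu : u ≠ D.q j) :
    D.aQ j (k + 2) u = D.sig j (k + 2) u
        + functionalAQ (k + 1) (D.g j) (D.z j) (D.sig j) D.aN u
        + (D.sig j 1 u) ^ (k + 2) * D.aN (k + 2) u := by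
  rw [aQ, extendAt_of_ne _ hu]

theorem bQ_one {j : Fin m} {u : ℂ} (hu : u ≠ D.q j) :
    D.bQ j 1 u = D.z j 1 / deriv (D.g j) u + D.sig j 1 u * D.bN 1 u := by
  rw [bQ, extendAt_of_ne _ hu]

theorem bQ_add_two {j : Fin m} (k : ℕ) {u : ℂ} (hu : u ≠ D.q j) :
    D.bQ j (k + 2) u = D.z j (k + 2) / deriv (D.g j) u + D.sig j (k + 2) u * D.bN 1 u
        + functionalBQ (k + 1) (D.g j) (D.z j) (D.sig j) D.bN u
        + (D.sig j 1 u) ^ (k + 2) * D.bN (k + 2) u := by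
  rw [bQ, extendAt_of_ne _ hu]

end ModelData

section
variable {n m : ℕ} {p : Fin (n + 1) → ℂ} {q : Fin m → ℂ} {I : Fin m → ℂ → ℂ}
  {μ : ℂ × ℂ → ℂ × ℂ} {ε : Fin (n + 1) → ℂ × ℂ → ℂ} {ς : Fin m → ℂ × ℂ → ℂ}
  {s : Fin (n + 1) → ℂ → ℂ} {z : Fin m → ℂ → ℂ} {v w : ℂ × ℂ → ℂ × ℂ}
  {Hn : Blowup → Blowup} {Hp : Fin (n + 1) → ℂ × ℂ → Blowup} {Hq : Fin m → ℂ × ℂ → Blowup}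

theorem modelData_regular (hp : Function.Injective p) (hq : Function.Injective q)
    (hpq : ∀ i j, p i ≠ q j) (hε : ∀ i, IsXi μ (camachoSad n μ (p i)) (p i) (ε i))
    (hς : ∀ j, IsZeta μ (q j) (ς j)) (hw : IsDicritical q I w) :
    (modelData p q I μ ε ς s z).Regular where
  inj_p := hp
  inj_q := hq
  ne := hpq
  eps i r := analyticAt_xCoeff (hε i).1 r
  eps_one i := (hε i).2.2.1
  sig j r := analyticAt_xCoeff (hς j).1 r
  sig_one j := (hς j).2.2.1
  sig_vanish j r hr := (hς j).2.2.2.1 r hr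
  g j := by
    have := (hw.involution j).1
    exact (analyticAt_const.fun_sub analyticAt_id).fun_mul (this.fun_sub analyticAt_const)
  g_deriv j := deriv_involutionFun (hw.involution j).1 (hw.involution j).2.1
  g_deriv_two j := by
    have := deriv_deriv_involutionFun (c := q j) (hw.involution j).1 (hw.involution j).2.2.1
    simp only [modelData, this]
    exact two_ne_zero

theorem eventually_notMem_of_finite {S : Set ℂ} (hS : S.Finite) (c : ℂ) : ∀ᶠ u in 𝓝[≠] c, u ∉ S := by
  have h1 : (S \ {c})ᶜ ∈ 𝓝 c := (hS.subset Set.sdiff_subset).isClosed.isOpen_compl.mem_nhds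
    (by simp)
  filter_upwards [mem_nhdsWithin_of_mem_nhds h1, self_mem_nhdsWithin] with u h1 h2 h3
  exact h1 ⟨h3, h2⟩

theorem IsNormalizing.isDivisorGerm_n (h : IsNormalizing p q I μ ε ς s z v w Hn Hp Hq) {u : ℂ}
    (hu : u ∉ Set.range p ∪ Set.range q) : IsDivisorGerm (fun a => Hn (chartX a)) u := by
  refine ⟨h.isBiholAt_chartX hu, ?_⟩
  have : IsOpen (Set.range p ∪ Set.range q)ᶜ :=
    ((Set.finite_range p).union (Set.finite_range q)).isClosed.isOpen_compl
  filter_upwards [this.mem_nhds hu] with t ht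
  exact h.chartX_eq ht

theorem IsNormalizing.isDivisorGerm_p (h : IsNormalizing p q I μ ε ς s z v w Hn Hp Hq)
    (i : Fin (n + 1)) : IsDivisorGerm (Hp i) (p i) := ⟨h.singular_bihol i, h.singular_id i⟩

theorem IsNormalizing.isDivisorGerm_q (h : IsNormalizing p q I μ ε ς s z v w Hn Hp Hq)
    (j : Fin m) : IsDivisorGerm (Hq j) (q j) := ⟨h.tangency_bihol j, h.tangency_id j⟩

/-- The relation between the coefficients of `H_n` and of `H_{p_i}`. -/
theorem IsNormalizing.jet_p (h : IsNormalizing p q I μ ε ς s z v w Hn Hp Hq)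
    (hε : ∀ i, IsXi μ (camachoSad n μ (p i)) (p i) (ε i)) {k : ℕ} {D : ModelData n m}
    (hDdef : D = modelData p q I μ ε ς s z)
    (ha : ∀ r ∈ Finset.Icc 1 k, ∀ u ∉ Set.range p ∪ Set.range q,
      jetX (fun a => Hn (chartX a)) r u = D.aN r u)
    (hb : ∀ r ∈ Finset.Icc 1 k, ∀ u ∉ Set.range p ∪ Set.range q,
      jetU (fun a => Hn (chartX a)) r u = D.bN r u) (i : Fin (n + 1)) :
    (∀ᶠ u in 𝓝[≠] (p i), jetX (Hp i) (k + 1) u = D.aP i (k + 1) u +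
      (jetX (fun a => Hn (chartX a)) (k + 1) u - D.aN (k + 1) u) * xCoeff 1 (ε i) u ^ (k + 1)) ∧
    ∀ᶠ u in 𝓝[≠] (p i), jetU (Hp i) (k + 1) u = D.bP i (k + 1) u +
      (jetU (fun a => Hn (chartX a)) (k + 1) u - D.bN (k + 1) u) * xCoeff 1 (ε i) u ^ (k + 1) := by
  have hS : (Set.range p ∪ Set.range q).Finite := (Set.finite_range p).union (Set.finite_range q)
  rw [← eventually_and]
  filter_upwards [h.factorization_p i, eventually_notMem_of_finite hS (p i), self_mem_nhdsWithin,
    nhdsWithin_le_nhds (hε i).1.eventually_divisor,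
    nhdsWithin_le_nhds (hε i).2.1.eventually_nhds] with u hf hu hup e1 e2
  obtain ⟨hs, hs0⟩ := h.s_germ i
  have hN := h.isDivisorGerm_n hu
  have hSo := hS.isClosed.isOpen_compl.mem_nhds hu
  set lam := camachoSad n μ (p i)
  have hfac := (tendsto_mk_right 0 u).eventually hf
  have hX : taylorCoeff (k + 1) (fun x => (coordX (Hp i (x, u))).1) = taylorCoeff (k + 1)
      (fun x => (coordX (Hn (chartX (ε i (Psi lam (p i) (s i) (x, u)),
        (Psi lam (p i) (s i) (x, u)).2)))).1) := by
    refine taylorCoeff_congr ?_ _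
    filter_upwards [hfac] with x hx
    rw [hx]
  have hψ : AnalyticAt ℂ (fun x => (Psi lam (p i) (s i) (x, u)).2) 0 :=
    analyticAt_const.fun_add hs
  have hA : AnalyticAt ℂ (fun x => (coordX (Hn (chartX (ε i (Psi lam (p i) (s i) (x, u)),
        (Psi lam (p i) (s i) (x, u)).2)))).2 - (Psi lam (p i) (s i) (x, u)).2) 0 := by
    have h1 : AnalyticAt ℂ (fun x => Psi lam (p i) (s i) (x, u)) 0 :=
      (analyticAt_psi_fst hs hs0 lam (u - p i)).prod hψ
    have h10 : Psi lam (p i) (s i) (0, u) = (0, u) := by simp [Psi, hs0]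
    have h2 : AnalyticAt ℂ (fun x => (ε i (Psi lam (p i) (s i) (x, u)),
        (Psi lam (p i) (s i) (x, u)).2)) 0 :=
      (AnalyticAt.fun_comp (by rwa [h10]) h1).prod hψ
    have h20 : (ε i (Psi lam (p i) (s i) (0, u)), (Psi lam (p i) (s i) (0, u)).2) = (0, u) := by
      rw [h10, e2.self_of_nhds]
    exact AnalyticAt.fun_comp (g := fun a => (coordX (Hn (chartX a))).2 - a.2)
      (by rw [h20]; exact hN.analyticAt_snd) h2
  -- `jetU` measures the displacement of the second coordinate, and `Ψ` already moves it by `s`;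
  -- hence the additional coefficient of `s`.
  have hU : taylorCoeff (k + 1) (fun x => (coordX (Hp i (x, u))).2 - u) = taylorCoeff (k + 1)
      (fun x => (coordX (Hn (chartX (ε i (Psi lam (p i) (s i) (x, u)),
        (Psi lam (p i) (s i) (x, u)).2)))).2 - (Psi lam (p i) (s i) (x, u)).2) +
      taylorCoeff (k + 1) (s i) := by
    rw [← taylorCoeff_add hA hs]
    refine taylorCoeff_congr ?_ _
    filter_upwards [hfac] with x hx
    rw [hx]
    simp only [Psi]
    ring
  have hup' : u ≠ p i := hup
  change taylorCoeff (k + 1) _ = _ ∧ taylorCoeff (k + 1) _ = _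
  rw [hX, hU]
  subst hDdef
  set D := modelData p q I μ ε ς s z
  have hDp : u ≠ D.p i := hup
  cases k with
  | zero =>
    rw [zero_add, D.aP_one, D.bP_one,
      taylorCoeff_one_comp_psi hN.analyticAt_fst hN.fst_zero e1 e2 hs hs0,
      taylorCoeff_one_comp_psi hN.analyticAt_snd hN.snd_zero e1 e2 hs hs0, D.aN_one]
    simp only [jetX, jetU, D, modelData]
    constructor <;> ring
  | succ k =>
    have hev : ∀ {f g : ℕ → ℂ → ℂ}, (∀ r ∈ Finset.Icc 1 (k + 1), ∀ u ∉ Set.range p ∪ Set.range q,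
        f r u = g r u) → ∀ r ∈ Finset.Icc 1 (k + 1), f r =ᶠ[𝓝 u] g r := fun hfg r hr => by
      filter_upwards [hSo] with t ht
      exact hfg r hr t ht
    rw [taylorCoeff_comp_psi hN.analyticAt_fst hN.fst_zero e1 e2 hs hs0 (Nat.le_add_left 1 k)
        (a := D.aN) (hev ha),
      taylorCoeff_comp_psi hN.analyticAt_snd hN.snd_zero e1 e2 hs hs0 (Nat.le_add_left 1 k)
        (a := D.bN) (hev hb), D.aP_add_two k hDp, D.bP_add_two k hDp, D.aN_one]
    simp only [jetX, jetU, D, modelData, lam]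
    constructor <;> ring

/-- The relation between the coefficients of `H_n` and of `H_{q_j}`. -/
theorem IsNormalizing.jet_q (h : IsNormalizing p q I μ ε ς s z v w Hn Hp Hq)
    (hς : ∀ j, IsZeta μ (q j) (ς j)) {k : ℕ} {D : ModelData n m}
    (hDdef : D = modelData p q I μ ε ς s z) (hD : D.Regular)
    (ha : ∀ r ∈ Finset.Icc 1 k, ∀ u ∉ Set.range p ∪ Set.range q,
      jetX (fun a => Hn (chartX a)) r u = D.aN r u)
    (hb : ∀ r ∈ Finset.Icc 1 k, ∀ u ∉ Set.range p ∪ Set.range q,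
      jetU (fun a => Hn (chartX a)) r u = D.bN r u) (j : Fin m) :
    (∀ᶠ u in 𝓝[≠] (q j), jetX (Hq j) (k + 1) u = D.aQ j (k + 1) u +
      (jetX (fun a => Hn (chartX a)) (k + 1) u - D.aN (k + 1) u) * xCoeff 1 (ς j) u ^ (k + 1)) ∧
    ∀ᶠ u in 𝓝[≠] (q j), jetU (Hq j) (k + 1) u = D.bQ j (k + 1) u +
      (jetU (fun a => Hn (chartX a)) (k + 1) u - D.bN (k + 1) u) * xCoeff 1 (ς j) u ^ (k + 1) := by
  have hS : (Set.range p ∪ Set.range q).Finite := (Set.finite_range p).union (Set.finite_range q)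
  subst hDdef
  rw [← eventually_and]
  obtain ⟨φ, hφall⟩ := h.factorization_q j
  have hg' : ∀ᶠ u in 𝓝[≠] (q j), deriv (involutionFun (q j) (I j)) u ≠ 0 := hD.deriv_g_ne_zero j
  have hga : ∀ᶠ u in 𝓝 (q j), AnalyticAt ℂ (involutionFun (q j) (I j)) u :=
    (hD.g j).eventually_analyticAt
  filter_upwards [hφall, eventually_notMem_of_finite hS (q j), self_mem_nhdsWithin,
    nhdsWithin_le_nhds (hς j).1.eventually_divisor,
    nhdsWithin_le_nhds (hς j).2.1.eventually_nhds, hg', nhdsWithin_le_nhds hga]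
    with u hf hu huq e1 e2 hgu hgu'
  obtain ⟨hφ, hφ0, hf⟩ := hf
  have hz := (h.z_germ j).1
  have hN := h.isDivisorGerm_n hu
  have hSo := hS.isClosed.isOpen_compl.mem_nhds hu
  have hfac := (tendsto_mk_right 0 u).eventually hf
  have hφs := hφ.slice
  have hgφ : ∀ᶠ x in 𝓝 (0 : ℂ), involutionFun (q j) (I j) (φ (x, u)) =
      involutionFun (q j) (I j) u + z j x := by
    filter_upwards [hfac] with x hx
    exact hx.1
  have hX : taylorCoeff (k + 1) (fun x => (coordX (Hq j (x, u))).1) = taylorCoeff (k + 1)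
      (fun x => (coordX (Hn (chartX (ς j (x, φ (x, u)), φ (x, u))))).1) := by
    refine taylorCoeff_congr ?_ _
    filter_upwards [hfac] with x hx
    rw [hx.2]
  have hA : AnalyticAt ℂ (fun x => (coordX (Hn (chartX (ς j (x, φ (x, u)), φ (x, u))))).2 -
      φ (x, u)) 0 := by
    have h1 : AnalyticAt ℂ (fun x => (x, φ (x, u))) 0 := analyticAt_id.prod hφs
    have h2 : AnalyticAt ℂ (fun x => (ς j (x, φ (x, u)), φ (x, u))) 0 :=
      (AnalyticAt.fun_comp (g := ς j) (f := fun x => (x, φ (x, u))) (by rwa [hφ0]) h1).prod hφs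
    exact AnalyticAt.fun_comp (g := fun a => (coordX (Hn (chartX a))).2 - a.2)
      (by rw [hφ0, e2.self_of_nhds]; exact hN.analyticAt_snd) h2
  -- The displacement is now `φ - u`. Its coefficient is `z_{k+1} / g'` plus a remainder which, for
  -- orders above the first, is the extra term of `functionalBQ`.
  have hU : taylorCoeff (k + 1) (fun x => (coordX (Hq j (x, u))).2 - u) = taylorCoeff (k + 1)
      (fun x => (coordX (Hn (chartX (ς j (x, φ (x, u)), φ (x, u))))).2 - φ (x, u)) +
      phiCoeff (involutionFun (q j) (I j)) (fun r => taylorCoeff r (z j)) u (k + 1) := by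
    rw [← taylorCoeff_eq_phiCoeff hgu' hgu hz hφs hφ0 hgφ]
    have h1 : taylorCoeff (k + 1) (fun x => φ (x, u)) =
        taylorCoeff (k + 1) fun x => φ (x, u) - u := by
      rw [taylorCoeff_sub hφs analyticAt_const, taylorCoeff_const, if_neg (Nat.succ_ne_zero k),
        sub_zero]
    rw [h1, ← taylorCoeff_add hA (hφs.fun_sub analyticAt_const)]
    refine taylorCoeff_congr ?_ _
    filter_upwards [hfac] with x hx
    rw [hx.2]
    ring
  change taylorCoeff (k + 1) _ = _ ∧ taylorCoeff (k + 1) _ = _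
  rw [hX, hU]
  set D := modelData p q I μ ε ς s z
  have hDq : u ≠ D.q j := huq
  cases k with
  | zero =>
    rw [zero_add, D.aQ_one, D.bQ_one hDq,
      taylorCoeff_one_comp_phi hN.analyticAt_fst hN.fst_zero e1 e2 hφs hφ0,
      taylorCoeff_one_comp_phi hN.analyticAt_snd hN.snd_zero e1 e2 hφs hφ0, D.aN_one,
      phiCoeff_succ]
    simp only [jetX, jetU, D, modelData, zero_add, Finset.sum_range_one, pow_zero, mul_one,
      taylorCoeff_const, one_ne_zero, if_false]
    constructor <;> ring
  | succ k =>
    have hev : ∀ {f g : ℕ → ℂ → ℂ}, (∀ r ∈ Finset.Icc 1 (k + 1), ∀ u ∉ Set.range p ∪ Set.range q,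
        f r u = g r u) → ∀ r ∈ Finset.Icc 1 (k + 1), f r =ᶠ[𝓝 u] g r := fun hfg r hr => by
      filter_upwards [hSo] with t ht
      exact hfg r hr t ht
    rw [taylorCoeff_comp_phi hN.analyticAt_fst hN.fst_zero e1 e2 hgu' hgu hz hφs hφ0 hgφ
        (Nat.le_add_left 1 k) (a := D.aN) (hev ha),
      taylorCoeff_comp_phi hN.analyticAt_snd hN.snd_zero e1 e2 hgu' hgu hz hφs hφ0 hgφ
        (Nat.le_add_left 1 k) (a := D.bN) (hev hb), D.aQ_add_two k hDq, D.bQ_add_two k hDq, D.aN_one]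
    simp only [jetX, jetU, D, modelData, functionalBQ]
    constructor <;> ring

end

/-! ## The direction of the `y`-axis -/

/-- The principal part of a dicritical foliation in the direction of the `y`-axis. -/
theorem IsDicritical.leading {m : ℕ} {q : Fin m → ℂ} {I : Fin m → ℂ → ℂ} {w : ℂ × ℂ → ℂ × ℂ}
    (hw : IsDicritical q I w) {ω : ℂ × ℂ → ℂ} (hω : AnalyticAt ℂ ω 0)
    (h : ∀ᶠ z in 𝓝 0, (w z).1 = z.1 * ω z) :
    (∀ j < m, ∀ z, homPart j ω z = 0) ∧ ∃ c : ℂ, c ≠ 0 ∧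
      ∀ η, homPart (m + 1) (fun z => (w z).2) (0, η) = c * η ^ (m + 1) ∧
        homPart m ω (0, η) = c * η ^ m := by
  have h1 := hw.germ.1.prod_fst
  have h2 := hw.germ.1.prod_snd
  have hsucc : ∀ j z, homPart (j + 1) (fun z => (w z).1) z = z.1 * homPart j ω z := fun j z => by
    have e : (fun t : ℂ => (w (t * z.1, t * z.2)).1) =ᶠ[𝓝 0]
        fun t => t ^ 1 * (z.1 * ω (t * z.1, t * z.2)) := by
      filter_upwards [(tendsto_smul_zero z).eventually h] with t ht
      rw [ht]
      ring
    unfold homPart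
    rw [taylorCoeff_congr e, taylorCoeff_pow_mul
      (analyticAt_const.fun_mul (analyticAt_comp_smul hω z)), if_pos (Nat.le_add_left 1 j),
      Nat.add_sub_cancel, taylorCoeff_const_mul]
  -- Homogeneous parts are continuous, so their values on `x = 0` are limits of values at `(t, y)`,
  -- `t ≠ 0`, where the polynomials in the slope give the information.
  have hlim : ∀ {f : ℂ × ℂ → ℂ} {k : ℕ} {g : ℂ → ℂ} {y : ℂ}, AnalyticAt ℂ f 0 →
      (∀ t ≠ 0, homPart k f (t, y) = g t) → ContinuousAt g 0 → homPart k f (0, y) = g 0 := by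
    intro f k g y hf hg hgc
    have c1 : Tendsto (fun t : ℂ => homPart k f (t, y)) (𝓝[≠] 0) (𝓝 (homPart k f (0, y))) :=
      (((continuous_homPart hf k).tendsto _).comp (tendsto_mk_right 0 y)).mono_left
        nhdsWithin_le_nhds
    refine tendsto_nhds_unique (c1.congr' ?_) (hgc.tendsto.mono_left nhdsWithin_le_nhds)
    filter_upwards [self_mem_nhdsWithin] with t ht
    exact hg t ht
  have hsc : ∀ {f : ℂ × ℂ → ℂ} (k : ℕ), AnalyticAt ℂ f 0 → ∀ t x y : ℂ,
      homPart k f (t * x, t * y) = t ^ k * homPart k f (x, y) := fun k hf t x y => by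
    rw [← homPart_smul hf]
    rfl
  refine ⟨fun j hj z => ?_, ?_⟩
  · have e : ∀ x y : ℂ, x ≠ 0 → homPart j ω (x, y) = 0 := fun x y hx => by
      have := hsucc j (x, y)
      rw [(hw.order (j + 1) (by omega) _).1, eq_comm, mul_eq_zero] at this
      exact this.resolve_left hx
    obtain ⟨x, y⟩ := z
    by_cases hx : x = 0
    · subst hx
      exact hlim (g := fun _ => 0) hω (fun t ht => e t y ht) continuousAt_const
    · exact e x y hx
  · obtain ⟨c, hc, hrad⟩ := hw.tangency
    have hrad' : ∀ u, homPart (m + 1) (fun z => (w z).1) (1, u) = c * ∏ j, (u - q j) := hrad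
    have hprod : ∀ t : ℂ, t ≠ 0 → t ^ m * ∏ j, (t⁻¹ - q j) = ∏ j, (1 - t * q j) := fun t ht => by
      rw [← Fin.prod_const m t, ← Finset.prod_mul_distrib]
      refine Finset.prod_congr rfl fun j _ => ?_
      field_simp
    have hgc : ContinuousAt (fun t : ℂ => c * ∏ j, (1 - t * q j)) 0 := by fun_prop
    have e1 : homPart (m + 1) (fun z => (w z).2) (0, 1) = c := by
      have := hlim (y := 1) h2 (fun t ht => ?_) hgc (k := m + 1)
      · simpa using this
      · have h3 := hsc (m + 1) h2 t 1 t⁻¹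
        rw [mul_one, mul_inv_cancel₀ ht] at h3
        have h4 : homPart (m + 1) (fun z => (w z).2) (1, t⁻¹) = t⁻¹ * (c * ∏ j, (t⁻¹ - q j)) := by
          rw [← hrad']
          exact sub_eq_zero.1 (hw.dicritical t⁻¹)
        rw [h3, h4, ← hprod t ht]
        linear_combination (t ^ m * c * ∏ j, (t⁻¹ - q j)) * mul_inv_cancel₀ ht
    have e2 : homPart m ω (0, 1) = c := by
      have := hlim (y := 1) hω (fun t ht => ?_) hgc (k := m)
      · simpa using this
      · have h3 := hsc m hω t 1 t⁻¹
        rw [mul_one, mul_inv_cancel₀ ht] at h3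
        have h4 := hsucc m (1, t⁻¹)
        rw [hrad', one_mul] at h4
        rw [h3, ← h4, ← hprod t ht]
        ring
    refine ⟨c, hc, fun η => ⟨?_, ?_⟩⟩
    · have := hsc (m + 1) h2 η 0 1
      rw [mul_zero, mul_one, e1] at this
      rw [this, mul_comm]
    · have := hsc m hω η 0 1
      rw [mul_zero, mul_one, e2] at this
      rw [this, mul_comm]

/-- The `y`-axis is the only leaf through its infinitely near point on the divisor. -/
theorem IsDicritical.eq_zero_of_tangent {m : ℕ} {q : Fin m → ℂ} {I : Fin m → ℂ → ℂ}
    {w : ℂ × ℂ → ℂ × ℂ} (hw : IsDicritical q I w) (hy : YAxisInvariant w) {a b : ℂ → ℂ}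
    (ha : AnalyticAt ℂ a 0) (hb : AnalyticAt ℂ b 0) (ha0 : a 0 = 0) (hb0 : b 0 = 0)
    (hb1 : deriv b 0 ≠ 0)
    (h : ∀ᶠ y in 𝓝[≠] 0, deriv (fun t => a t * b t) y * (w (a y * b y, b y)).2 =
      deriv b y * (w (a y * b y, b y)).1) : ∀ᶠ y in 𝓝 0, a y = 0 := by
  -- Invariance of the axis makes the first component of `w` equal to `x ω`; by
  -- `IsDicritical.leading` the principal parts of `ω` and of the second component have the same
  -- constant `c` on the axis.
  obtain ⟨ω, hω, hω'⟩ := hw.germ.1.prod_fst.exists_sub_eq_mul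
  have hω1 : ∀ᶠ z in 𝓝 (0 : ℂ × ℂ), (w z).1 = z.1 * ω z := by
    filter_upwards [hω', (continuous_snd.tendsto (0 : ℂ × ℂ)).eventually hy] with z e1 e2
    simp only [Prod.fst_zero, sub_zero] at e1
    rw [← e1, e2, sub_zero]
  obtain ⟨hω0, c, hc, hlead⟩ := hw.leading hω hω1
  set A : ℂ → ℂ := fun t => a t * b t with hAdef
  have hA : AnalyticAt ℂ A 0 := ha.fun_mul hb
  have hA0 : A 0 = 0 := by simp [hAdef, ha0]
  have hA1 : deriv A 0 = 0 := by
    have : deriv A 0 = _ := (ha.differentiableAt.hasDerivAt.mul hb.differentiableAt.hasDerivAt).deriv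
    rw [this, ha0, hb0]
    simp
  suffices hAz : ∀ᶠ y in 𝓝 0, A y = 0 by
    have h1 : ∀ᶠ y in 𝓝[≠] (0 : ℂ), a y = 0 := by
      have hbne : ∀ᶠ y in 𝓝[≠] (0 : ℂ), b y ≠ 0 := by
        have := (hb.differentiableAt.hasDerivAt.eventually_ne hb1 (c := 0))
        exact this
      filter_upwards [nhdsWithin_le_nhds hAz, hbne] with y e1 e2
      exact (mul_eq_zero.1 e1).resolve_right e2
    rw [eventually_nhdsWithin_iff] at h1
    filter_upwards [h1] with y hy'
    by_cases hy0 : y = 0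
    · rw [hy0, ha0]
    · exact hy' hy0
  by_contra hne
  obtain ⟨l, g, hg, hg0, hAg⟩ := hA.exists_eventuallyEq_pow_smul_nonzero_iff.2 hne
  simp only [sub_zero, smul_eq_mul] at hAg
  -- the order of `A` is at least `2`
  have hl0 : l ≠ 0 := by
    rintro rfl
    have := hAg.self_of_nhds
    rw [hA0, pow_zero, one_mul] at this
    exact hg0 this.symm
  have hAd : ∀ᶠ y in 𝓝 0, y * deriv A y = y ^ l * (l * g y + y * deriv g y) := by
    filter_upwards [hAg.eventually_nhds, hg.eventually_analyticAt] with y e1 e2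
    have e3 : A =ᶠ[𝓝 y] fun t => t ^ l * g t := e1
    have e4 : HasDerivAt (fun t => t ^ l * g t) (l * y ^ (l - 1) * g y + y ^ l * deriv g y) y :=
      (hasDerivAt_pow l y).mul e2.differentiableAt.hasDerivAt
    rw [e3.deriv_eq, e4.deriv]
    obtain ⟨l, rfl⟩ := Nat.exists_eq_succ_of_ne_zero hl0
    simp only [Nat.succ_eq_add_one, Nat.add_sub_cancel]
    ring
  have hid : Tendsto (fun t : ℂ => t) (𝓝[≠] 0) (𝓝 0) := tendsto_id.mono_left nhdsWithin_le_nhds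
  have htan : Tendsto (fun t : ℂ => t⁻¹ • (A t, b t)) (𝓝[≠] 0) (𝓝 (0, deriv b 0)) := by
    have h3 : HasDerivAt A (deriv A 0) 0 := hA.differentiableAt.hasDerivAt
    have h4 := (h3.prodMk hb.differentiableAt.hasDerivAt).tendsto_slope_zero
    rw [hA1] at h4
    simpa [hA0, hb0] using h4
  have hη := hlead (deriv b 0)
  have L1 := tendsto_homPart hw.germ.1.prod_snd (fun j hj z => (hw.order j hj z).2) htan
  have L2 := tendsto_homPart hω hω0 htan
  rw [hη.1] at L1
  rw [hη.2] at L2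
  have hcg := hg.continuousAt.tendsto.mono_left (nhdsWithin_le_nhds (s := {(0 : ℂ)}ᶜ))
  have hcg' := hg.deriv.continuousAt.tendsto.mono_left (nhdsWithin_le_nhds (s := {(0 : ℂ)}ᶜ))
  have hcb' := hb.deriv.continuousAt.tendsto.mono_left (nhdsWithin_le_nhds (s := {(0 : ℂ)}ᶜ))
  -- With `A = y ^ l g` and `η = deriv b 0`, the tangency equation, multiplied by `y` and divided by
  -- `y ^ (l + m + 1)`, has the limits `l g(0) c η ^ (m + 1)` and `η g(0) c η ^ m`. Hence `l = 1`,
  -- which contradicts `deriv A 0 = 0`.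
  have M1 := ((hcg.const_mul (l : ℂ)).add (hid.mul hcg')).mul L1
  have M2 := (hcb'.mul hcg).mul L2
  have hAt : Tendsto (fun t : ℂ => (A t, b t)) (𝓝[≠] 0) (𝓝 0) := by
    have := (hA.continuousAt.tendsto.prodMk_nhds hb.continuousAt.tendsto).mono_left
      (nhdsWithin_le_nhds (s := {(0 : ℂ)}ᶜ))
    simpa [hA0, hb0, Prod.zero_eq_mk] using this
  have heq := tendsto_nhds_unique (M1.congr' ?_) M2
  · have h5 : c * deriv b 0 ^ (m + 1) * g 0 ≠ 0 := mul_ne_zero (mul_ne_zero hc (pow_ne_zero _ hb1)) hg0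
    have h6 : (l : ℂ) = 1 := by
      refine mul_right_cancel₀ h5 ?_
      rw [zero_mul, add_zero] at heq
      linear_combination heq
    have hl1 : l = 1 := by exact_mod_cast h6
    subst hl1
    have h7 : HasDerivAt (fun t => t ^ 1 * g t) (g 0) 0 := by
      have := (hasDerivAt_pow 1 (0 : ℂ)).mul hg.differentiableAt.hasDerivAt
      exact this.congr_deriv (by simp)
    have h8 := hAg
    have h9 : deriv A 0 = g 0 := (EventuallyEq.deriv_eq h8).trans h7.deriv
    exact hg0 (h9 ▸ hA1)
  · filter_upwards [h, nhdsWithin_le_nhds hAd, nhdsWithin_le_nhds hAg, hAt.eventually hω1,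
      self_mem_nhdsWithin] with y e1 e2 e3 e4 hy0
    have hy0' : y ≠ 0 := hy0
    change deriv A y * _ = _ at e1
    change (w (A y, b y)).1 = A y * ω (A y, b y) at e4
    rw [show a y * b y = A y from rfl, e4] at e1
    have e5 : y ^ l * ((l * g y + y * deriv g y) * (w (A y, b y)).2) =
        y ^ l * (y * (deriv b y * g y) * ω (A y, b y)) := by
      rw [← mul_assoc, ← e2, mul_assoc, e1, e3]
      ring
    have e6 := mul_left_cancel₀ (pow_ne_zero l hy0') e5
    have e7 : (y ^ (m + 1))⁻¹ * y = (y ^ m)⁻¹ := by rw [pow_succ]; field_simp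
    linear_combination (y ^ (m + 1))⁻¹ * e6 + deriv b y * g y * ω (A y, b y) * e7

/-! ## Normalizing transformations near `u = ∞` -/

section
variable {n m : ℕ} {p : Fin (n + 1) → ℂ} {q : Fin m → ℂ} {I : Fin m → ℂ → ℂ}
  {μ : ℂ × ℂ → ℂ × ℂ} {ε : Fin (n + 1) → ℂ × ℂ → ℂ} {ς : Fin m → ℂ × ℂ → ℂ}
  {s : Fin (n + 1) → ℂ → ℂ} {z : Fin m → ℂ → ℂ} {v w : ℂ × ℂ → ℂ × ℂ}
  {Hn : Blowup → Blowup} {Hp : Fin (n + 1) → ℂ × ℂ → Blowup} {Hq : Fin m → ℂ × ℂ → Blowup}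

theorem eventually_chartY_mem_puncturedDivisor {S : Set ℂ} (hS : S.Finite) :
    ∀ᶠ t : ℂ in 𝓝 0, chartY (t, 0) ∈ puncturedDivisor S := by
  have h := eventually_notMem_of_finite (hS.image fun u => u⁻¹) 0
  rw [eventually_nhdsWithin_iff] at h
  filter_upwards [h] with t ht
  refine ⟨by simp [chartY], fun u hu hs => ?_⟩
  by_cases h0 : t = 0
  · simp [chartY, h0] at hs
  · simp only [chartY, if_neg h0] at hs
    have h1 : t⁻¹ = u := OnePoint.coe_injective hs
    exact ht h0 ⟨u, hu, h1 ▸ inv_inv t⟩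

/-- A local biholomorphism in the chart `(v, y)` which takes the radial foliation to a dicritical
foliation for which the `y`-axis is invariant preserves the `y`-axis. -/
theorem eventually_fst_eq_zero_of_carries (hw : IsDicritical q I w) (hy : YAxisInvariant w)
    {U : Set Blowup} (hU : IsOpen U) (hU0 : chartY (0, 0) ∈ U) (hc : CarriesOn Hn U (fun a => a) w)
    {N : ℂ × ℂ → ℂ × ℂ} (hN : IsLocalBihol N (0, 0))
    (hHN : ∀ᶠ a in 𝓝 ((0 : ℂ), (0 : ℂ)), Hn (chartY a) = chartY (N a))
    (hdiv : ∀ᶠ t in 𝓝 (0 : ℂ), N (t, 0) = (t, 0)) : ∀ᶠ y in 𝓝 (0 : ℂ), (N (0, y)).1 = 0 := by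
  have hN0 : N (0, 0) = (0, 0) := hdiv.self_of_nhds
  have ha : AnalyticAt ℂ (fun y => (N (0, y)).1) 0 := hN.1.prod_fst.restrict_divisor
  have hb : AnalyticAt ℂ (fun y => (N (0, y)).2) 0 := hN.1.prod_snd.restrict_divisor
  have hcur : ∀ y : ℂ, HasDerivAt (fun t : ℂ => ((0 : ℂ), t)) ((0 : ℂ), (1 : ℂ)) y := fun y =>
    (hasDerivAt_const y (0 : ℂ)).prodMk (hasDerivAt_id y)
  refine hw.eq_zero_of_tangent hy ha hb (by rw [hN0]) (by rw [hN0]) ?_ ?_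
  -- As `N` is the identity on the divisor, its Jacobian at the origin is the derivative of `N.2` in
  -- the direction of `y`.
  · have h1 : fderiv ℂ N (0, 0) (1, 0) = (1, 0) := by
      have h2 : HasDerivAt (fun t : ℂ => (t, (0 : ℂ))) ((1 : ℂ), (0 : ℂ)) 0 :=
        (hasDerivAt_id (0 : ℂ)).prodMk (hasDerivAt_const 0 0)
      have h3 := hN.1.differentiableAt.hasFDerivAt.comp_hasDerivAt (f := fun t : ℂ => (t, (0 : ℂ)))
        (0 : ℂ) h2
      exact h3.unique (h2.congr_of_eventuallyEq hdiv)
    have h2 := hN.2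
    rw [det_eq_det2, h1] at h2
    have h3 := (ContinuousLinearMap.snd ℂ ℂ ℂ).hasFDerivAt.comp_hasDerivAt (0 : ℂ)
      (hN.1.differentiableAt.hasFDerivAt.comp_hasDerivAt (0 : ℂ) (hcur 0))
    have h4 : deriv (fun y => (N (0, y)).2) 0 = (fderiv ℂ N (0, 0) (0, 1)).2 := h3.deriv
    rw [h4]
    simpa [det2] using h2
  · have hUy := (tendsto_mk_zero 0).eventually (((isOpen_iff U).1 hU).2.mem_nhds hU0)
    filter_upwards [nhdsWithin_le_nhds ((tendsto_mk_zero 0).eventually hHN.eventually_nhds),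
      nhdsWithin_le_nhds ((tendsto_mk_zero 0).eventually hN.1.eventually_analyticAt),
      nhdsWithin_le_nhds hUy, self_mem_nhdsWithin] with y e1 e2 e3 hy0
    have hy0' : y ≠ 0 := hy0
    set f : ℂ × ℂ → ℂ × ℂ := fun b => (Hn (ofPoint b)).pt
    set g : ℂ × ℂ → ℂ × ℂ := fun b => ((N b).1 * (N b).2, (N b).2)
    set d : ℂ × ℂ → ℂ × ℂ := fun b => (b.1 / b.2, b.2)
    have hd0 : d (0, y) = (0, y) := by simp [d]
    have hd : AnalyticAt ℂ d (0, y) := (isLocalBihol_divY hy0').1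
    have hg : AnalyticAt ℂ g (d (0, y)) := by
      rw [hd0]; exact (e2.prod_fst.fun_mul e2.prod_snd).prod e2.prod_snd
    have hfg : f =ᶠ[𝓝 (0, y)] fun b => g (d b) := by
      have hdt : Tendsto d (𝓝 (0, y)) (𝓝 (0, y)) := by simpa [hd0] using hd.continuousAt.tendsto
      filter_upwards [hdt.eventually e1,
        continuous_snd.continuousAt.eventually_ne (show ((0 : ℂ), y).2 ≠ 0 from hy0')] with b b1 b2
      simp only [f, ofPoint_eq_chartY b2]
      rw [b1]
      rfl
    have hof : ofPoint (0, y) = chartY (0, y) := by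
      rw [ofPoint_eq_chartY (show ((0 : ℂ), y).2 ≠ 0 from hy0')]
      simp
    have hgd : AnalyticAt ℂ (fun b => g (d b)) (0, y) := AnalyticAt.fun_comp hg hd
    have h1 := hc (0, y) (fun h => hy0' (congrArg Prod.snd h)) (by rw [hof]; exact e3)
    have h2 : fderiv ℂ f (0, y) (0, 1) =
        (deriv (fun t => (N (0, t)).1 * (N (0, t)).2) y, deriv (fun t => (N (0, t)).2) y) := by
      rw [hfg.fderiv_eq]
      have h3 := hgd.differentiableAt.hasFDerivAt.comp_hasDerivAt y (hcur y)
      have a1 : DifferentiableAt ℂ (fun t => (N (0, t)).1) y :=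
        (AnalyticAt.fun_comp (f := fun t : ℂ => ((0 : ℂ), t)) e2.prod_fst
          (by fun_prop)).differentiableAt
      have a2 : DifferentiableAt ℂ (fun t => (N (0, t)).2) y :=
        (AnalyticAt.fun_comp (f := fun t : ℂ => ((0 : ℂ), t)) e2.prod_snd
          (by fun_prop)).differentiableAt
      have h4 := (a1.fun_mul a2).hasDerivAt.prodMk a2.hasDerivAt
      refine h3.unique (h4.congr_of_eventuallyEq (Eventually.of_forall fun t => ?_))
      simp [g, d]
    have h3 : (f (0, y)) = ((N (0, y)).1 * (N (0, y)).2, (N (0, y)).2) := by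
      rw [hfg.self_of_nhds]
      change g (d (0, y)) = _
      rw [hd0]
    -- On the axis the radial field is `y` times `(0, 1)`, so the condition says that the image of
    -- the axis is tangent to `w`.
    change det2 (fderiv ℂ f (0, y) (0, y)) (w (f (0, y))) = 0 at h1
    rw [show ((0 : ℂ), y) = y • ((0 : ℂ), (1 : ℂ)) by simp, map_smul,
      show y • ((0 : ℂ), (1 : ℂ)) = (0, y) by simp, h2, h3] at h1
    simp only [det2, Prod.smul_fst, Prod.smul_snd, smul_eq_mul] at h1
    refine mul_left_cancel₀ hy0' ?_
    linear_combination h1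

/-- In the chart `(v, y)` the map is `(v V, y Y)`: it preserves the divisor `y = 0`, and also `v =
0`, which is a leaf of the radial foliation and the only leaf of `w` through its point of the
divisor. The formula is this one read with `v = t = 1 / u` and `y = x / t`. -/
theorem IsNormalizing.exists_at_infinity (h : IsNormalizing p q I μ ε ς s z v w Hn Hp Hq)
    (hw : IsDicritical q I w) (hy : YAxisInvariant w) :
    ∃ V Y : ℂ × ℂ → ℂ, AnalyticAt ℂ V (0, 0) ∧ AnalyticAt ℂ Y (0, 0) ∧ V (0, 0) = 1 ∧
      ∀ᶠ t in 𝓝[≠] (0 : ℂ), ∀ᶠ x in 𝓝 (0 : ℂ), coordX (Hn (chartX (x, t⁻¹))) =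
        (x * (V (t⁻¹ * x, t) * Y (t⁻¹ * x, t)), t⁻¹ * (V (t⁻¹ * x, t))⁻¹) := by
  have hS : (Set.range p ∪ Set.range q).Finite := (Set.finite_range p).union (Set.finite_range q)
  obtain ⟨U, hU, hb, -, hc⟩ := h.regular_bihol
  have hdiv := eventually_chartY_mem_puncturedDivisor hS
  have hU0 : chartY (0, 0) ∈ U := hU hdiv.self_of_nhds
  obtain ⟨N, hN, hHN⟩ := (hb.2.2.2 _ hU0).exists_chartY (by
    rw [h.regular_id _ hdiv.self_of_nhds]
    simp [chartY])
  have hNdiv : ∀ᶠ t in 𝓝 (0 : ℂ), N (t, 0) = (t, 0) := by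
    filter_upwards [hdiv, (tendsto_mk_right 0 0).eventually hHN] with t e1 e2
    rw [h.regular_id _ e1] at e2
    exact (chartY_injective e2).symm
  have hax := eventually_fst_eq_zero_of_carries hw hy hb.1 hU0 hc hN hHN hNdiv
  obtain ⟨V, hV, hV'⟩ := hN.1.prod_fst.exists_sub_eq_mul
  have hsw : AnalyticAt ℂ (fun a : ℂ × ℂ => (a.2, a.1)) (0, 0) := by fun_prop
  have hY₁ : AnalyticAt ℂ (fun a : ℂ × ℂ => (N (a.2, a.1)).2) (0, 0) :=
    AnalyticAt.fun_comp (f := fun a : ℂ × ℂ => (a.2, a.1)) hN.1.prod_snd hsw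
  obtain ⟨Y, hY, hY'⟩ := hY₁.exists_sub_eq_mul
  have hVs : AnalyticAt ℂ (fun a : ℂ × ℂ => V (a.2, a.1)) (0, 0) :=
    AnalyticAt.fun_comp (f := fun a : ℂ × ℂ => (a.2, a.1)) hV hsw
  have hswt : Tendsto (fun a : ℂ × ℂ => (a.2, a.1)) (𝓝 (0, 0)) (𝓝 (0, 0)) := by
    simpa using hsw.continuousAt.tendsto
  have hV1 : ∀ᶠ a in 𝓝 ((0 : ℂ), (0 : ℂ)), (N a).1 = a.1 * V a := by
    filter_upwards [hV', (continuous_snd.tendsto ((0 : ℂ), (0 : ℂ))).eventually hax] with a e1 e2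
    simp only [sub_zero] at e1
    rw [← e1, e2, sub_zero]
  have hY1 : ∀ᶠ a in 𝓝 ((0 : ℂ), (0 : ℂ)), (N a).2 = a.2 * Y (a.2, a.1) := by
    filter_upwards [hswt.eventually hY',
      (continuous_fst.tendsto ((0 : ℂ), (0 : ℂ))).eventually hNdiv] with a e1 e2
    simp only [sub_zero] at e1
    rw [← e1, e2, sub_zero]
  have hV0 : V (0, 0) = 1 := by
    have h1 : Tendsto (fun t : ℂ => V (t, 0)) (𝓝[≠] 0) (𝓝 (V (0, 0))) :=
      (hV.continuousAt.tendsto.comp (tendsto_mk_right 0 0)).mono_left nhdsWithin_le_nhds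
    refine tendsto_nhds_unique h1 (tendsto_const_nhds.congr' ?_)
    filter_upwards [nhdsWithin_le_nhds hNdiv,
      nhdsWithin_le_nhds ((tendsto_mk_right 0 0).eventually hV1), self_mem_nhdsWithin] with t e1 e2 ht
    rw [e1] at e2
    exact mul_left_cancel₀ ht (by rw [mul_one]; exact e2)
  have hVne : ∀ᶠ a in 𝓝 ((0 : ℂ), (0 : ℂ)), V a ≠ 0 :=
    hV.continuousAt.eventually_ne (by rw [hV0]; exact one_ne_zero)
  refine ⟨fun a => V (a.2, a.1), Y, hVs, hY, hV0, ?_⟩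
  have hall := (hHN.and (hV1.and (hY1.and hVne))).eventually_nhds
  filter_upwards [nhdsWithin_le_nhds ((tendsto_mk_right 0 0).eventually hall), self_mem_nhdsWithin]
    with t e ht
  have ht' : t ≠ 0 := ht
  have hlim : Tendsto (fun x : ℂ => (t, t⁻¹ * x)) (𝓝 0) (𝓝 (t, 0)) := by
    have : Continuous fun x : ℂ => (t, t⁻¹ * x) := by fun_prop
    simpa using this.tendsto 0
  filter_upwards [hlim.eventually e] with x ⟨e1, e2, e3, e4⟩
  have h1 : (N (t, t⁻¹ * x)).1 ≠ 0 := by rw [e2]; exact mul_ne_zero ht' e4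
  rw [chartX_eq_chartY (show ((x, t⁻¹) : ℂ × ℂ).2 ≠ 0 from inv_ne_zero ht'), inv_inv, e1,
    chartY_eq_chartX h1, coordX_chartX, e2, e3]
  ext
  · simp only
    field_simp
  · simp only
    rw [mul_inv]

/-- The first coordinate is `x`, and the second `t⁻¹`, times a series in `x / t` with coefficients
analytic in `t`. Counting negative powers of `t` gives the exponents `r` and `r + 2`. A map not
preserving the `y`-axis need not satisfy these bounds. -/
theorem IsNormalizing.jet_infinity (h : IsNormalizing p q I μ ε ς s z v w Hn Hp Hq)
    (hw : IsDicritical q I w) (hy : YAxisInvariant w) (r : ℕ) :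
    (∃ c : ℂ → ℂ, AnalyticAt ℂ c 0 ∧ ∀ᶠ t in 𝓝[≠] (0 : ℂ),
      t ^ r * jetX (fun a => Hn (chartX a)) (r + 1) t⁻¹ = c t) ∧
    ∃ c : ℂ → ℂ, AnalyticAt ℂ c 0 ∧ ∀ᶠ t in 𝓝[≠] (0 : ℂ),
      t ^ (r + 2) * jetU (fun a => Hn (chartX a)) (r + 1) t⁻¹ = c t := by
  obtain ⟨V, Y, hV, hY, hV0, hN⟩ := h.exists_at_infinity hw hy
  have hP : AnalyticAt ℂ (fun a => V a * Y a) (0, 0) := hV.fun_mul hY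
  have hW : AnalyticAt ℂ (fun a => (V a)⁻¹) (0, 0) :=
    hV.fun_inv (by rw [hV0]; exact one_ne_zero)
  refine ⟨⟨_, analyticAt_xCoeff hP r, ?_⟩, _, analyticAt_xCoeff hW (r + 1), ?_⟩
  · filter_upwards [hN, nhdsWithin_le_nhds hP.eventually_divisor, self_mem_nhdsWithin]
      with t e1 e2 ht
    have ht' : t ≠ 0 := ht
    have h1 : jetX (fun a => Hn (chartX a)) (r + 1) t⁻¹ =
        taylorCoeff (r + 1) fun x => x ^ 1 * (V (t⁻¹ * x, t) * Y (t⁻¹ * x, t)) := by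
      refine taylorCoeff_congr ?_ _
      filter_upwards [e1] with x hx
      rw [hx, pow_one]
    rw [h1, taylorCoeff_pow_mul (analyticAt_comp_mul e2.slice t⁻¹), if_pos (Nat.le_add_left 1 r),
      Nat.add_sub_cancel, taylorCoeff_comp_mul e2.slice t⁻¹, ← mul_assoc, ← mul_pow,
      mul_inv_cancel₀ ht', one_pow, one_mul]
    rfl
  · filter_upwards [hN, nhdsWithin_le_nhds hW.eventually_divisor, self_mem_nhdsWithin]
      with t e1 e2 ht
    have ht' : t ≠ 0 := ht
    have h1 : jetU (fun a => Hn (chartX a)) (r + 1) t⁻¹ =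
        taylorCoeff (r + 1) fun x => t⁻¹ * (V (t⁻¹ * x, t))⁻¹ - t⁻¹ := by
      refine taylorCoeff_congr ?_ _
      filter_upwards [e1] with x hx
      rw [hx]
    have h2 := analyticAt_comp_mul e2.slice t⁻¹
    rw [h1, taylorCoeff_sub (analyticAt_const.fun_mul h2) analyticAt_const, taylorCoeff_const,
      if_neg (Nat.succ_ne_zero r), sub_zero, taylorCoeff_const_mul,
      taylorCoeff_comp_mul e2.slice t⁻¹]
    have h3 : t ^ (r + 2) * (t⁻¹ * t⁻¹ ^ (r + 1)) = 1 := by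
      rw [← pow_succ', ← mul_pow, mul_inv_cancel₀ ht', one_pow]
    rw [← mul_assoc t⁻¹, ← mul_assoc, h3, one_mul]
    rfl

end

/-! ## The defect of the coefficients of order `k + 1` -/

theorem exists_polynomial_of_removable {S : Set ℂ} (hS : S.Finite) {f : ℂ → ℂ} {d : ℕ}
    (hf : ∀ u ∉ S, AnalyticAt ℂ f u)
    (hr : ∀ c ∈ S, ∃ g : ℂ → ℂ, AnalyticAt ℂ g c ∧ f =ᶠ[𝓝[≠] c] g)
    (hinf : ∃ g : ℂ → ℂ, AnalyticAt ℂ g 0 ∧ ∀ᶠ t in 𝓝[≠] (0 : ℂ), t ^ d * f t⁻¹ = g t) :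
    ∃ P : Polynomial ℂ, P.natDegree ≤ d ∧ ∀ u ∉ S, f u = P.eval u := by
  obtain ⟨F, hF, hFf⟩ := exists_differentiable_of_removable hS hf hr
  obtain ⟨g, hg, hgt⟩ := hinf
  have hS' := eventually_notMem_of_finite (hS.image fun u => u⁻¹) 0
  obtain ⟨P, hP, hFP⟩ := exists_polynomial_of_bound_at_infinity d hF ⟨‖g 0‖ + 1, by
    have h1 : ∀ᶠ t in 𝓝 (0 : ℂ), ‖g t‖ < ‖g 0‖ + 1 :=
      hg.continuousAt.norm.eventually_lt_const (lt_add_one _)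
    filter_upwards [hgt, hS', nhdsWithin_le_nhds h1] with t e1 e2 e3
    rw [hFf t⁻¹ fun h => e2 ⟨_, h, inv_inv t⟩, e1]
    exact e3.le⟩
  exact ⟨P, hP, fun u hu => by rw [← hFf u hu, hFP]⟩

theorem exists_analyticAt_of_add_mul {f r a e : ℂ → ℂ} {c : ℂ} (hr : AnalyticAt ℂ r c)
    (ha : AnalyticAt ℂ a c) (he : AnalyticAt ℂ e c) (he0 : e c = 1) {k : ℕ}
    (h : ∀ᶠ u in 𝓝[≠] c, r u = a u + f u * e u ^ k) :
    ∃ g : ℂ → ℂ, AnalyticAt ℂ g c ∧ f =ᶠ[𝓝[≠] c] g := by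
  refine ⟨fun u => (r u - a u) / e u ^ k, (hr.fun_sub ha).fun_div (he.fun_pow k)
    (by rw [he0, one_pow]; exact one_ne_zero), ?_⟩
  have h1 : ∀ᶠ u in 𝓝 c, e u ≠ 0 :=
    he.continuousAt.eventually_ne (by rw [he0]; exact one_ne_zero)
  filter_upwards [h, nhdsWithin_le_nhds h1] with u h2 h3
  rw [h2, add_sub_cancel_left, mul_div_cancel_right₀ _ (pow_ne_zero k h3)]

theorem exists_analyticAt_sub_at_infinity {f a : ℂ → ℂ} {S : Set ℂ} {d : ℕ}
    (hf : ∃ c : ℂ → ℂ, AnalyticAt ℂ c 0 ∧ ∀ᶠ t in 𝓝[≠] (0 : ℂ), t ^ d * f t⁻¹ = c t)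
    (ha : HolomorphicOffInSphere a S) : ∃ c : ℂ → ℂ, AnalyticAt ℂ c 0 ∧
      ∀ᶠ t in 𝓝[≠] (0 : ℂ), t ^ d * (f t⁻¹ - a t⁻¹) = c t := by
  obtain ⟨c, hc, h1⟩ := hf
  obtain ⟨-, G, hG, h2⟩ := ha
  refine ⟨fun t => c t - t ^ d * G t, hc.fun_sub ((analyticAt_id.fun_pow d).fun_mul hG), ?_⟩
  filter_upwards [h1, h2] with t e1 e2
  rw [mul_sub, e1, e2]

section
variable {n m : ℕ} {p : Fin (n + 1) → ℂ} {q : Fin m → ℂ} {I : Fin m → ℂ → ℂ}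
  {μ : ℂ × ℂ → ℂ × ℂ} {ε : Fin (n + 1) → ℂ × ℂ → ℂ} {ς : Fin m → ℂ × ℂ → ℂ}
  {s : Fin (n + 1) → ℂ → ℂ} {z : Fin m → ℂ → ℂ} {v w : ℂ × ℂ → ℂ × ℂ}
  {Hn : Blowup → Blowup} {Hp : Fin (n + 1) → ℂ × ℂ → Blowup} {Hq : Fin m → ℂ × ℂ → Blowup}

theorem IsNormalizing.jetX_one (h : IsNormalizing p q I μ ε ς s z v w Hn Hp Hq) {u : ℂ}
    (hu : u ∉ Set.range p ∪ Set.range q) : jetX (fun a => Hn (chartX a)) 1 u = 1 := by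
  have hN := h.isDivisorGerm_n hu
  have h1 := (h.regular_jet u hu).1.comp_tendsto (tendsto_mk_right 0 u)
  have h2 := taylorCoeff_eq_zero_of_isBigO (hN.analyticAt_fst.slice.fun_sub analyticAt_id)
    (n := 2) (by simpa [Function.comp_def] using h1) (j := 1) (by norm_num)
  rw [taylorCoeff_sub hN.analyticAt_fst.slice analyticAt_id, sub_eq_zero] at h2
  refine Eq.trans h2 ?_
  rw [taylorCoeff_one]
  exact deriv_id 0

/-- `jet_p` and `jet_q` express the defect by functions holomorphic at `p_i` and `q_j`, so its
singularities are removable; `jet_infinity` bounds its growth, and it is polynomial. For `k = 0` the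
first coefficient of the first coordinate is already `1`. -/
theorem IsNormalizing.exists_defect (h : IsNormalizing p q I μ ε ς s z v w Hn Hp Hq)
    (hw : IsDicritical q I w) (hy : YAxisInvariant w)
    (hε : ∀ i, IsXi μ (camachoSad n μ (p i)) (p i) (ε i)) (hς : ∀ j, IsZeta μ (q j) (ς j)) {k : ℕ}
    {D : ModelData n m} (hDdef : D = modelData p q I μ ε ς s z) (hD : D.Regular)
    (ha : ∀ r ∈ Finset.Icc 1 k, ∀ u ∉ Set.range p ∪ Set.range q,
      jetX (fun a => Hn (chartX a)) r u = D.aN r u)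
    (hb : ∀ r ∈ Finset.Icc 1 k, ∀ u ∉ Set.range p ∪ Set.range q,
      jetU (fun a => Hn (chartX a)) r u = D.bN r u) :
    ∃ P Q : Polynomial ℂ, P.natDegree ≤ k ∧ Q.natDegree ≤ k + 2 ∧ (k = 0 → P = 0) ∧
      ∀ u ∉ Set.range p ∪ Set.range q,
        jetX (fun a => Hn (chartX a)) (k + 1) u - D.aN (k + 1) u = P.eval u ∧
        jetU (fun a => Hn (chartX a)) (k + 1) u - D.bN (k + 1) u = Q.eval u := by
  have hS : (Set.range p ∪ Set.range q).Finite := (Set.finite_range p).union (Set.finite_range q)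
  have hpts : D.pts = Set.range p ∪ Set.range q := by rw [hDdef]; rfl
  have hp : ∀ i, D.p i = p i := fun i => by rw [hDdef]; rfl
  have hq : ∀ j, D.q j = q j := fun j => by rw [hDdef]; rfl
  have jp := h.jet_p hε hDdef ha hb
  have jq := h.jet_q hς hDdef hD ha hb
  have hinf := h.jet_infinity hw hy k
  have haN := D.holomorphicOffInSphere_aN k
  have hbN := D.holomorphicOffInSphere_bN k
  rw [hpts] at haN hbN
  obtain ⟨P, hP, hP'⟩ := exists_polynomial_of_removable hS (d := k)
    (f := fun u => jetX (fun a => Hn (chartX a)) (k + 1) u - D.aN (k + 1) u)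
    (fun u hu => ((h.isDivisorGerm_n hu).analyticAt_jetX _).fun_sub (haN.1 u hu))
    (by
      rintro c (⟨i, rfl⟩ | ⟨j, rfl⟩)
      · exact exists_analyticAt_of_add_mul ((h.isDivisorGerm_p i).analyticAt_jetX (k + 1))
          (hp i ▸ hD.analyticAt_aP i (k + 1)) (analyticAt_xCoeff (hε i).1 1) (hε i).2.2.1 (jp i).1
      · exact exists_analyticAt_of_add_mul ((h.isDivisorGerm_q j).analyticAt_jetX (k + 1))
          (hq j ▸ hD.analyticAt_aQ j (k + 1)) (analyticAt_xCoeff (hς j).1 1) (hς j).2.2.1 (jq j).1)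
    (exists_analyticAt_sub_at_infinity hinf.1 haN)
  obtain ⟨Q, hQ, hQ'⟩ := exists_polynomial_of_removable hS (d := k + 2)
    (f := fun u => jetU (fun a => Hn (chartX a)) (k + 1) u - D.bN (k + 1) u)
    (fun u hu => ((h.isDivisorGerm_n hu).analyticAt_jetU _).fun_sub (hbN.1 u hu))
    (by
      rintro c (⟨i, rfl⟩ | ⟨j, rfl⟩)
      · exact exists_analyticAt_of_add_mul ((h.isDivisorGerm_p i).analyticAt_jetU (k + 1))
          (hp i ▸ hD.analyticAt_bP i (k + 1)) (analyticAt_xCoeff (hε i).1 1) (hε i).2.2.1 (jp i).2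
      · exact exists_analyticAt_of_add_mul ((h.isDivisorGerm_q j).analyticAt_jetU (k + 1))
          (hq j ▸ hD.analyticAt_bQ j (k + 1)) (analyticAt_xCoeff (hς j).1 1) (hς j).2.2.1 (jq j).2)
    (exists_analyticAt_sub_at_infinity hinf.2 hbN)
  refine ⟨P, Q, hP, hQ, fun hk => ?_, fun u hu => ⟨hP' u hu, hQ' u hu⟩⟩
  subst hk
  obtain ⟨u, hu⟩ := hS.infinite_compl.nonempty
  have h1 := hP' u hu
  rw [zero_add, h.jetX_one hu, D.aN_one, sub_self, Polynomial.eq_C_of_natDegree_le_zero hP,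
    Polynomial.eval_C] at h1
  rw [Polynomial.eq_C_of_natDegree_le_zero hP, ← h1, map_zero]

end

/-! ## The correction of the coefficients of order `k + 1` -/

/-- The homogeneous polynomial of degree `d` in `(x, y)` which is `P` for `x = 1`. -/
noncomputable def homogenize (d : ℕ) (P : Polynomial ℂ) (z : ℂ × ℂ) : ℂ :=
  ∑ j ∈ Finset.range (d + 1), P.coeff j * z.2 ^ j * z.1 ^ (d - j)

theorem homogenize_blowup {d : ℕ} {P : Polynomial ℂ} (hP : P.natDegree ≤ d) (x u : ℂ) :
    homogenize d P (x, u * x) = x ^ d * P.eval u := by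
  rw [homogenize, Polynomial.eval_eq_sum_range' (Nat.lt_succ_of_le hP), Finset.mul_sum]
  refine Finset.sum_congr rfl fun j hj => ?_
  have hj' : j ≤ d := Nat.lt_succ_iff.1 (Finset.mem_range.1 hj)
  simp only [mul_pow]
  rw [← Nat.add_sub_cancel' hj', pow_add, Nat.add_sub_cancel_left]
  ring

theorem homogenize_smul (d : ℕ) (P : Polynomial ℂ) (t : ℂ) (z : ℂ × ℂ) :
    homogenize d P (t • z) = t ^ d * homogenize d P z := by
  rw [homogenize, homogenize, Finset.mul_sum]
  refine Finset.sum_congr rfl fun j hj => ?_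
  have hj' : j ≤ d := Nat.lt_succ_iff.1 (Finset.mem_range.1 hj)
  simp only [Prod.smul_fst, Prod.smul_snd, smul_eq_mul, mul_pow]
  rw [show t ^ d = t ^ j * t ^ (d - j) by rw [← pow_add, Nat.add_sub_cancel' hj']]
  ring

theorem analyticAt_homogenize (d : ℕ) (P : Polynomial ℂ) (z : ℂ × ℂ) :
    AnalyticAt ℂ (homogenize d P) z := by
  unfold homogenize
  refine Finset.analyticAt_fun_sum _ fun j _ => ?_
  fun_prop

theorem fderiv_eq_zero_of_homogeneous {f : ℂ × ℂ → ℂ} {d : ℕ} (hf : DifferentiableAt ℂ f 0)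
    (h : ∀ (t : ℂ) (z : ℂ × ℂ), f (t • z) = t ^ (d + 2) * f z) : fderiv ℂ f 0 = 0 := by
  refine ContinuousLinearMap.ext fun a => ?_
  have h1 : HasDerivAt (fun t : ℂ => t • a) a 0 := by
    simpa using (hasDerivAt_id (0 : ℂ)).smul_const a
  have h2 : HasFDerivAt f (fderiv ℂ f 0) ((fun t : ℂ => t • a) 0) := by
    simpa using hf.hasFDerivAt
  have h3 := h2.comp_hasDerivAt (0 : ℂ) h1
  have h4 : HasDerivAt (fun t : ℂ => t ^ (d + 2) * f a) 0 0 := by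
    have := (hasDerivAt_pow (d + 2) (0 : ℂ)).mul_const (f a)
    simpa using this
  exact h3.unique (h4.congr_of_eventuallyEq (Eventually.of_forall fun t => h t a))

/-- The map `(x - x P, y - y P - Q)`, `P` and `Q` being made homogeneous of degrees `k`, `k + 2`. -/
noncomputable def correction (k : ℕ) (P Q : Polynomial ℂ) (z : ℂ × ℂ) : ℂ × ℂ :=
  (z.1 - z.1 * homogenize k P z, z.2 - z.2 * homogenize k P z - homogenize (k + 2) Q z)

theorem homogenize_zero {k : ℕ} {P : Polynomial ℂ} (hP : k = 0 → P = 0) : homogenize k P 0 = 0 := by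
  by_cases hk : k = 0
  · simp [homogenize, hP hk]
  · have := homogenize_smul k P 0 0
    rwa [smul_zero, zero_pow hk, zero_mul] at this

/-- All the added terms have order at least `2`, except `x P` and `y P` for `k = 0`, which would be
linear; hence the assumption that `P = 0` in that case. -/
theorem isTangentToId_correction {k : ℕ} {P Q : Polynomial ℂ} (hP : k = 0 → P = 0) :
    IsTangentToId (correction k P Q) := by
  have a1 := analyticAt_homogenize k P 0
  have a2 := analyticAt_homogenize (k + 2) Q 0
  have hQ0 : homogenize (k + 2) Q 0 = 0 := homogenize_zero fun h => absurd h (Nat.succ_ne_zero _)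
  have hP0 := homogenize_zero hP
  refine ⟨?_, ?_, ?_⟩
  · exact (analyticAt_fst.fun_sub (analyticAt_fst.fun_mul a1)).prod
      ((analyticAt_snd.fun_sub (analyticAt_snd.fun_mul a1)).fun_sub a2)
  · simp [correction, hQ0]
  · have d1 := a1.differentiableAt.hasFDerivAt
    have d2 := a2.differentiableAt.hasFDerivAt
    rw [fderiv_eq_zero_of_homogeneous a2.differentiableAt (homogenize_smul (k + 2) Q)] at d2
    have f1 : HasFDerivAt (fun z : ℂ × ℂ => z.1) (ContinuousLinearMap.fst ℂ ℂ ℂ) 0 := hasFDerivAt_fst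
    have f2 : HasFDerivAt (fun z : ℂ × ℂ => z.2) (ContinuousLinearMap.snd ℂ ℂ ℂ) 0 := hasFDerivAt_snd
    have h := ((f1.sub (f1.mul d1)).prodMk ((f2.sub (f2.mul d1)).sub d2)).fderiv
    refine Eq.trans ?_ (h.trans ?_)
    · rfl
    · ext <;> simp [hP0]

theorem correction_axis (k : ℕ) (P Q : Polynomial ℂ) (y : ℂ) : (correction k P Q (0, y)).1 = 0 := by
  simp [correction]

/-- On `(x, u x)` the homogenized polynomials are `x ^ k P(u)` and `x ^ (k + 2) Q(u)`, and taking
the slope divides the latter by `x`. Both corrections thus occur at order `k + 1`, for exactly the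
degrees that the defects may have. -/
theorem lift_correction {k : ℕ} {P Q : Polynomial ℂ} (hP : P.natDegree ≤ k)
    (hQ : Q.natDegree ≤ k + 2) (hP0 : k = 0 → P = 0) (u : ℂ) :
    ∀ᶠ a in 𝓝 ((0 : ℂ), u), lift (correction k P Q) (chartX a) =
      chartX (a.1 * (1 - a.1 ^ k * P.eval a.2),
        a.2 - a.1 ^ (k + 1) * Q.eval a.2 / (1 - a.1 ^ k * P.eval a.2)) := by
  have hc : ContinuousAt (fun a : ℂ × ℂ => 1 - a.1 ^ k * P.eval a.2) (0, u) := by fun_prop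
  have hne : ∀ᶠ a in 𝓝 ((0 : ℂ), u), 1 - a.1 ^ k * P.eval a.2 ≠ 0 := by
    refine hc.eventually_ne ?_
    by_cases hk : k = 0
    · simp [hP0 hk]
    · simp [hk]
  filter_upwards [hne] with a ha
  by_cases h0 : a.1 = 0
  · rw [lift_of_pt_eq_zero (isTangentToId_correction hP0).2.1 (by simp [chartX, h0])]
    congr 1
    ext <;> simp [h0]
  · have h1 : (a.1 * (1 - a.1 ^ k * P.eval a.2)) ≠ 0 := mul_ne_zero h0 ha
    refine Blowup.ext_of_pt ?_ ?_
    · rw [lift_pt]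
      simp only [chartX, correction, homogenize_blowup hP, homogenize_blowup hQ]
      ext
      · simp only
        ring
      · simp only
        field_simp
        ring
    · rw [lift_pt]
      intro h2
      refine h1 ?_
      have h3 := congrArg Prod.fst h2
      simp only [chartX, correction, homogenize_blowup hP, Prod.fst_zero] at h3
      rw [← h3]
      ring

theorem taylorCoeff_eq_of_sub_eq_pow_mul {f g E : ℂ → ℂ} {k : ℕ} (hg : AnalyticAt ℂ g 0)
    (hE : AnalyticAt ℂ E 0) (h : ∀ᶠ x in 𝓝 0, f x = g x - x ^ (k + 1) * E x) :
    (∀ r ≤ k, taylorCoeff r f = taylorCoeff r g) ∧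
      taylorCoeff (k + 1) f = taylorCoeff (k + 1) g - E 0 := by
  have hpE : AnalyticAt ℂ (fun x => x ^ (k + 1) * E x) 0 := (analyticAt_id.fun_pow _).fun_mul hE
  refine ⟨fun r hr => ?_, ?_⟩
  · rw [taylorCoeff_congr h, taylorCoeff_sub hg hpE, taylorCoeff_pow_mul hE,
      if_neg (by omega), sub_zero]
  · rw [taylorCoeff_congr h, taylorCoeff_sub hg hpE, taylorCoeff_pow_mul hE, if_pos le_rfl,
      Nat.sub_self, taylorCoeff_zero]

/-- The correction changes the coefficients of order `k + 1` by `P` and `Q`, and does not change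
the coefficients of smaller order. -/
theorem IsDivisorGerm.jet_correction {F : ℂ × ℂ → Blowup} {u : ℂ} (hF : IsDivisorGerm F u)
    (h1 : jetX F 1 u = 1) {k : ℕ} {P Q : Polynomial ℂ} (hP : P.natDegree ≤ k)
    (hQ : Q.natDegree ≤ k + 2) (hP0 : k = 0 → P = 0) {H : ℂ × ℂ → ℂ × ℂ}
    (hH : H =ᶠ[𝓝 0] correction k P Q) :
    ((∀ r ≤ k, jetX (fun a => lift H (F a)) r u = jetX F r u) ∧
      jetX (fun a => lift H (F a)) (k + 1) u = jetX F (k + 1) u - P.eval u) ∧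
    (∀ r ≤ k, jetU (fun a => lift H (F a)) r u = jetU F r u) ∧
      jetU (fun a => lift H (F a)) (k + 1) u = jetU F (k + 1) u - Q.eval u := by
  set X : ℂ → ℂ := fun x => (coordX (F (x, u))).1
  set Y : ℂ → ℂ := fun x => (coordX (F (x, u))).2
  have hX : AnalyticAt ℂ X 0 := hF.analyticAt_fst.slice
  have hY : AnalyticAt ℂ Y 0 := hF.coord.1.prod_snd.slice
  have hF0 := hF.divisor.self_of_nhds
  have hX0 : X 0 = 0 := by simp only [X, hF0, coordX_chartX]
  have hY0 : Y 0 = u := by simp only [Y, hF0, coordX_chartX]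
  -- As `X = x G` with `G 0 = 1`, the factor `X ^ (k + 1)` is `x ^ (k + 1)` to leading order, so the
  -- coefficient changes by exactly `P u` or `Q u`.
  obtain ⟨G, hG, hXG⟩ : ∃ G : ℂ → ℂ, AnalyticAt ℂ G 0 ∧ ∀ᶠ x in 𝓝 0, X x = x * G x := by
    obtain ⟨G, hG, e, -⟩ := hF.analyticAt_fst.exists_xCoeff_succ
    refine ⟨fun x => G (x, u), hG.slice, ?_⟩
    filter_upwards [(tendsto_mk_right 0 u).eventually e] with x hx
    simp only [X]
    rw [hx, hF0, coordX_chartX, zero_add]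
  have hG0 : G 0 = 1 := by
    have e1 : taylorCoeff 1 X = 1 := h1
    have e2 : X =ᶠ[𝓝 0] fun x => x ^ 1 * G x := by
      filter_upwards [hXG] with x hx
      rw [hx, pow_one]
    rw [taylorCoeff_congr e2, taylorCoeff_pow_mul hG, if_pos le_rfl, Nat.sub_self,
      taylorCoeff_zero] at e1
    exact e1
  have hPY : AnalyticAt ℂ (fun x => P.eval (Y x)) 0 := hY.polynomial_eval P
  have hQY : AnalyticAt ℂ (fun x => Q.eval (Y x)) 0 := hY.polynomial_eval Q
  have hden : AnalyticAt ℂ (fun x => 1 - X x ^ k * P.eval (Y x)) 0 :=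
    analyticAt_const.fun_sub ((hX.fun_pow k).fun_mul hPY)
  have hden0 : 1 - X 0 ^ k * P.eval (Y 0) = 1 := by
    by_cases hk : k = 0
    · simp [hP0 hk]
    · rw [hX0, zero_pow hk, zero_mul, sub_zero]
  have hlift : ∀ᶠ x in 𝓝 (0 : ℂ), coordX (lift H (F (x, u))) =
      (X x * (1 - X x ^ k * P.eval (Y x)),
        Y x - X x ^ (k + 1) * Q.eval (Y x) / (1 - X x ^ k * P.eval (Y x))) := by
    have t1 : Tendsto (fun x => coordX (F (x, u))) (𝓝 0) (𝓝 (0, u)) := by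
      have := hX.continuousAt.tendsto.prodMk_nhds hY.continuousAt.tendsto
      rwa [hX0, hY0] at this
    have t2 := (tendsto_mk_right 0 u).eventually hF.eventually_eq
    filter_upwards [t1.eventually (lift_correction hP hQ hP0 u), t2,
      t1.eventually ((tendsto_blowup u).eventually hH)] with x e1 e2 e3
    have e4 : lift H (chartX (coordX (F (x, u)))) =
        lift (correction k P Q) (chartX (coordX (F (x, u)))) := by
      unfold lift
      rw [show H (chartX (coordX (F (x, u)))).pt = correction k P Q
        (chartX (coordX (F (x, u)))).pt from e3]
    rw [e2, e4, e1, coordX_chartX]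
  have J1 := taylorCoeff_eq_of_sub_eq_pow_mul
    (f := fun x => (coordX (lift H (F (x, u)))).1) (g := X) (k := k)
    (E := fun x => G x ^ (k + 1) * P.eval (Y x)) hX ((hG.fun_pow _).fun_mul hPY) (by
      filter_upwards [hlift, hXG] with x e1 e2
      rw [e1]
      simp only
      rw [e2]
      ring)
  have J2 := taylorCoeff_eq_of_sub_eq_pow_mul
    (f := fun x => (coordX (lift H (F (x, u)))).2 - u) (g := fun x => Y x - u) (k := k)
    (E := fun x => G x ^ (k + 1) * Q.eval (Y x) / (1 - X x ^ k * P.eval (Y x)))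
    (hY.fun_sub analyticAt_const)
    (((hG.fun_pow _).fun_mul hQY).fun_div hden (by rw [hden0]; exact one_ne_zero)) (by
      filter_upwards [hlift, hXG] with x e1 e2
      rw [e1]
      simp only
      rw [show X x ^ (k + 1) = x ^ (k + 1) * G x ^ (k + 1) by rw [e2, mul_pow]]
      ring)
  rw [hY0] at hden0
  simp only [hG0, hY0, hden0, one_pow, one_mul, div_one] at J1 J2
  exact ⟨J1, J2⟩

theorem IsTangentToId.congr {H G : ℂ × ℂ → ℂ × ℂ} (hH : IsTangentToId H) (h : H =ᶠ[𝓝 0] G) :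
    IsTangentToId G :=
  ⟨hH.1.congr h, by rw [← h.self_of_nhds, hH.2.1], by rw [← h.fderiv_eq, hH.2.2]⟩

theorem IsTangentToId.comp {H G : ℂ × ℂ → ℂ × ℂ} (hG : IsTangentToId G) (hH : IsTangentToId H) :
    IsTangentToId fun z => G (H z) := by
  have h1 : AnalyticAt ℂ G (H 0) := by rw [hH.2.1]; exact hG.1
  refine ⟨AnalyticAt.fun_comp h1 hH.1, by simp only [hH.2.1, hG.2.1], ?_⟩
  rw [show (fun z => G (H z)) = G ∘ H from rfl,
    fderiv_comp 0 h1.differentiableAt hH.1.differentiableAt, hH.2.1, hG.2.2, hH.2.2]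
  rfl

/-- A germ tangent to the identity has a representative which vanishes only at the origin. -/
theorem IsTangentToId.exists_representative {H : ℂ × ℂ → ℂ × ℂ} (hH : IsTangentToId H) :
    ∃ G : ℂ × ℂ → ℂ × ℂ, IsTangentToId G ∧ (∀ z, G z = 0 → z = 0) ∧ G =ᶠ[𝓝 0] H := by
  classical
  obtain ⟨K, hK, h1, -⟩ := hH.exists_inverse
  have h2 : (fun z => if H z = 0 then z else H z) =ᶠ[𝓝 0] H := by
    filter_upwards [h1] with z hz
    split_ifs with h
    · rw [h, ← hz, h, hK.2.1]
    · rfl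
  refine ⟨_, hH.congr h2.symm, fun z hz => ?_, h2⟩
  split_ifs at hz with h
  · exact hz
  · exact absurd hz h

/-- Where a germ vanishes its lift keeps the slope. If the outer germ vanishes only at `0`, no slope
is lost, and lifts compose at every point of the blow-up. -/
theorem lift_lift {G H : ℂ × ℂ → ℂ × ℂ} (hG0 : G 0 = 0) (hG : ∀ z, G z = 0 → z = 0) (a : Blowup) :
    lift G (lift H a) = lift (fun z => G (H z)) a := by
  by_cases h : H a.pt = 0
  · rw [lift_of_eq h, lift_of_pt_eq_zero hG0 rfl, lift_of_eq (by rw [h, hG0])]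
  · have h1 : G (H a.pt) ≠ 0 := fun h1 => h (hG _ h1)
    rw [lift_of_ne h]
    exact (lift_of_ne (H := G) (a := ofPoint (H a.pt)) h1).trans
      (lift_of_ne (H := fun z => G (H z)) (a := a) h1).symm

/-! ### Transport and induction on the order -/

section
variable {n m : ℕ} {p : Fin (n + 1) → ℂ} {q : Fin m → ℂ} {I : Fin m → ℂ → ℂ}
  {μ : ℂ × ℂ → ℂ × ℂ} {ε : Fin (n + 1) → ℂ × ℂ → ℂ} {ς : Fin m → ℂ × ℂ → ℂ}
  {s : Fin (n + 1) → ℂ → ℂ} {z : Fin m → ℂ → ℂ} {v w : ℂ × ℂ → ℂ × ℂ}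
  {Hn : Blowup → Blowup} {Hp : Fin (n + 1) → ℂ × ℂ → Blowup} {Hq : Fin m → ℂ × ℂ → Blowup}

/-- A pair of foliations, together with its normalizing transformations, is transported by a germ
of biholomorphism tangent to the identity which preserves the `y`-axis. -/
theorem IsNormalizing.exists_transport {u₀ : ℂ} (hu₀ : u₀ ∉ Set.range p) {h : Path u₀ u₀ → ℂ → ℂ}
    (hn : IsNormalizing p q I μ ε ς s z v w Hn Hp Hq) (hv : IsNonDicritical p h v)
    (hw : IsDicritical q I w) (hy : YAxisInvariant w) {H : ℂ × ℂ → ℂ × ℂ} (hH : IsTangentToId H)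
    (hax : ∀ᶠ y in 𝓝 (0 : ℂ), (H (0, y)).1 = 0) :
    ∃ v' w' : ℂ × ℂ → ℂ × ℂ, CarriesAt H v v' 0 ∧ CarriesAt H w w' 0 ∧ IsNonDicritical p h v' ∧
      IsDicritical q I w' ∧ YAxisInvariant w' ∧
      IsNormalizing p q I μ ε ς s z v' w' (fun a => lift H (Hn a)) (fun i a => lift H (Hp i a))
        (fun j a => lift H (Hq j a)) := by
  obtain ⟨G, hG, hGH, hHG⟩ := hH.exists_inverse
  have h1 := isPush_pushField hGH v
  have h2 := isPush_pushField hGH w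
  exact ⟨_, _, carriesAt_of_isPush h1, carriesAt_of_isPush h2,
    hv.of_isPush hu₀ hH hG hGH hHG (analyticAt_pushField hH hG hv.germ.1) h1,
    hw.of_isPush hH hG hGH hHG (analyticAt_pushField hH hG hw.germ.1) h2,
    hy.of_isPush hH hax h2, hn.of_isPush hH h1 h2⟩

theorem IsNormalizing.exists_jets {u₀ : ℂ} (hu₀ : u₀ ∉ Set.range p) {h : Path u₀ u₀ → ℂ → ℂ}
    (hn : IsNormalizing p q I μ ε ς s z v w Hn Hp Hq) (hv : IsNonDicritical p h v)
    (hw : IsDicritical q I w) (hy : YAxisInvariant w)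
    (hε : ∀ i, IsXi μ (camachoSad n μ (p i)) (p i) (ε i)) (hς : ∀ j, IsZeta μ (q j) (ς j))
    {D : ModelData n m} (hDdef : D = modelData p q I μ ε ς s z) (hD : D.Regular) (k : ℕ) :
    ∃ H : ℂ × ℂ → ℂ × ℂ, IsTangentToId H ∧ (∀ z, H z = 0 → z = 0) ∧
      (∀ᶠ y in 𝓝 (0 : ℂ), (H (0, y)).1 = 0) ∧
      (∀ r ∈ Finset.Icc 1 k, ∀ u ∉ Set.range p ∪ Set.range q,
        jetX (fun a => lift H (Hn (chartX a))) r u = D.aN r u) ∧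
      ∀ r ∈ Finset.Icc 1 k, ∀ u ∉ Set.range p ∪ Set.range q,
        jetU (fun a => lift H (Hn (chartX a))) r u = D.bN r u := by
  induction k with
  | zero =>
    exact ⟨fun z => z, ⟨analyticAt_id, rfl, fderiv_id⟩, fun _ hz => hz, by simp, by simp, by simp⟩
  | succ k ih =>
    obtain ⟨H, hH, hH0, hax, ha, hb⟩ := ih
    obtain ⟨v', w', -, -, -, hw', hy', hn'⟩ := hn.exists_transport hu₀ hv hw hy hH hax
    obtain ⟨P, Q, hP, hQ, hP0, hPQ⟩ := hn'.exists_defect hw' hy' hε hς hDdef hD ha hb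
    -- The correction attached to the defect of the transported pair; the representative is chosen
    -- so that its lift composes with that of `H` without restriction.
    obtain ⟨G, hG, hG0, hGe⟩ := (isTangentToId_correction (Q := Q) hP0).exists_representative
    have hjet := fun u (hu : u ∉ Set.range p ∪ Set.range q) =>
      (hn'.isDivisorGerm_n hu).jet_correction (hn'.jetX_one hu) hP hQ hP0 hGe
    simp only [lift_lift hG.2.1 hG0] at hjet
    refine ⟨fun z => G (H z), hG.comp hH, fun z hz => hH0 z (hG0 _ hz), ?_, fun r hr u hu => ?_,
      fun r hr u hu => ?_⟩
    · have h0 : Tendsto (fun y : ℂ => H (0, y)) (𝓝 0) (𝓝 0) := hH.tendsto.comp (tendsto_mk_zero 0)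
      filter_upwards [hax, h0.eventually hGe] with y e1 e2
      rw [e2, show H (0, y) = (0, (H (0, y)).2) from Prod.ext e1 rfl, correction_axis]
    · obtain ⟨h1, h2⟩ := Finset.mem_Icc.1 hr
      rcases Nat.lt_or_ge k r with h3 | h3
      · obtain rfl : r = k + 1 := by omega
        rw [(hjet u hu).1.2, ← (hPQ u hu).1, sub_sub_cancel]
      · rw [(hjet u hu).1.1 r h3, ha r (Finset.mem_Icc.2 ⟨h1, h3⟩) u hu]
    · obtain ⟨h1, h2⟩ := Finset.mem_Icc.1 hr
      rcases Nat.lt_or_ge k r with h3 | h3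
      · obtain rfl : r = k + 1 := by omega
        rw [(hjet u hu).2.2, ← (hPQ u hu).2, sub_sub_cancel]
      · rw [(hjet u hu).2.1 r h3, hb r (Finset.mem_Icc.2 ⟨h1, h3⟩) u hu]

end

/-! ### Conclusion -/

theorem eventuallyEq_of_punctured {f g : ℂ → ℂ} {c : ℂ} (hf : AnalyticAt ℂ f c)
    (hg : AnalyticAt ℂ g c) (h : ∀ᶠ u in 𝓝[≠] c, f u = g u) : f =ᶠ[𝓝 c] g :=
  (hf.frequently_eq_iff_eventually_eq hg).1 h.frequently

theorem mainTheorem1 {n m : ℕ} (p : Fin (n + 1) → ℂ) (q : Fin m → ℂ)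
    (hp : Function.Injective p) (hq : Function.Injective q) (hpq : ∀ i j, p i ≠ q j)
    (u₀ : ℂ) (hu₀ : u₀ ∉ Set.range p) (h : Path u₀ u₀ → ℂ → ℂ) (I : Fin m → ℂ → ℂ)
    (μ : ℂ × ℂ → ℂ × ℂ) (hμ : IsNonDicritical p h μ) (hμ_lines : HasLinesAsSeparatrices p μ)
    (ε : Fin (n + 1) → ℂ × ℂ → ℂ) (hε : ∀ i, IsXi μ (camachoSad n μ (p i)) (p i) (ε i))
    (ς : Fin m → ℂ × ℂ → ℂ) (hς : ∀ j, IsZeta μ (q j) (ς j))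
    (v w : ℂ × ℂ → ℂ × ℂ) (hv : IsNonDicritical p h v) (hw : IsDicritical q I w)
    (hy : YAxisInvariant w)
    (s : Fin (n + 1) → ℂ → ℂ) (z : Fin m → ℂ → ℂ)
    (Hn : Blowup → Blowup) (Hp : Fin (n + 1) → ℂ × ℂ → Blowup) (Hq : Fin m → ℂ × ℂ → Blowup)
    (hnorm : IsNormalizing p q I μ ε ς s z v w Hn Hp Hq)
    (k : ℕ) (hk : 1 ≤ k) :
    ∃ H : ℂ × ℂ → ℂ × ℂ, IsTangentToId H ∧ (∀ᶠ y in 𝓝 (0 : ℂ), (H (0, y)).1 = 0) ∧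
      ∃ v' w' : ℂ × ℂ → ℂ × ℂ,
        CarriesAt H v v' 0 ∧ CarriesAt H w w' 0 ∧
        IsNonDicritical p h v' ∧ IsDicritical q I w' ∧
        IsNormalizing p q I μ ε ς s z v' w' (fun a => Blowup.lift H (Hn a))
          (fun i a => Blowup.lift H (Hp i a)) (fun j a => Blowup.lift H (Hq j a)) ∧
        (∀ r ∈ Finset.Icc 1 k,
          HolomorphicOffInSphere ((modelData p q I μ ε ς s z).aN r) (Set.range p ∪ Set.range q) ∧
          HolomorphicOffInSphere ((modelData p q I μ ε ς s z).bN r) (Set.range p ∪ Set.range q) ∧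
          (∀ i, AnalyticAt ℂ ((modelData p q I μ ε ς s z).aP i r) (p i) ∧
            AnalyticAt ℂ ((modelData p q I μ ε ς s z).bP i r) (p i)) ∧
          ∀ j, AnalyticAt ℂ ((modelData p q I μ ε ς s z).aQ j r) (q j) ∧
            AnalyticAt ℂ ((modelData p q I μ ε ς s z).bQ j r) (q j)) ∧
        (∀ u : ℂ, u ∉ Set.range p ∪ Set.range q →
          HasJetAt k (fun a => Blowup.lift H (Hn (Blowup.chartX a)))
            (modelData p q I μ ε ς s z).aN (modelData p q I μ ε ς s z).bN u) ∧
        (∀ i, HasJetAt k (fun a => Blowup.lift H (Hp i a))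
          ((modelData p q I μ ε ς s z).aP i) ((modelData p q I μ ε ς s z).bP i) (p i)) ∧
        ∀ j, HasJetAt k (fun a => Blowup.lift H (Hq j a))
          ((modelData p q I μ ε ς s z).aQ j) ((modelData p q I μ ε ς s z).bQ j) (q j) := by
  have hD : (modelData p q I μ ε ς s z).Regular := modelData_regular hp hq hpq hε hς hw
  obtain ⟨H, hH, -, hax, ha, hb⟩ := hnorm.exists_jets hu₀ hv hw hy hε hς rfl hD k
  obtain ⟨v', w', c1, c2, hv', hw', -, hn'⟩ := hnorm.exists_transport hu₀ hv hw hy hH hax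
  have hS : (Set.range p ∪ Set.range q).Finite := (Set.finite_range p).union (Set.finite_range q)
  have hsub : ∀ {j : ℕ}, j + 1 ∈ Finset.Icc 1 k → ∀ r ∈ Finset.Icc 1 j, r ∈ Finset.Icc 1 k :=
    fun {j} hj r hr => by
      simp only [Finset.mem_Icc] at *
      omega
  have hsucc : ∀ r ∈ Finset.Icc 1 k, ∃ j, r = j + 1 := fun r hr =>
    ⟨r - 1, by have := (Finset.mem_Icc.1 hr).1; omega⟩
  refine ⟨H, hH, hax, v', w', c1, c2, hv', hw', hn', fun r hr => ?_, fun u hu => ?_, fun i => ?_,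
    fun j => ?_⟩
  · obtain ⟨j, rfl⟩ := hsucc r hr
    exact ⟨ModelData.holomorphicOffInSphere_aN _ j, ModelData.holomorphicOffInSphere_bN _ j,
      fun i => ⟨hD.analyticAt_aP i _, hD.analyticAt_bP i _⟩,
      fun i => ⟨hD.analyticAt_aQ i _, hD.analyticAt_bQ i _⟩⟩
  · have hSo := hS.isClosed.isOpen_compl.mem_nhds hu
    refine (hn'.isDivisorGerm_n hu).hasJetAt (fun r hr => ?_) fun r hr => ?_
    · filter_upwards [hSo] with t ht
      exact ha r hr t ht
    · filter_upwards [hSo] with t ht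
      exact hb r hr t ht
  -- The coefficients of `H_n` are canonical up to order `k`, so the defect in `jet_p` is zero and
  -- the coefficients agree near `p i` except at `p i` itself; being analytic, they agree there as
  -- well.
  · refine (hn'.isDivisorGerm_p i).hasJetAt (fun r hr => ?_) fun r hr => ?_
    all_goals
      obtain ⟨j, rfl⟩ := hsucc r hr
      have hjet := hn'.jet_p hε rfl (fun r hr' => ha r (hsub hr r hr'))
        (fun r hr' => hb r (hsub hr r hr')) i
    · refine eventuallyEq_of_punctured ((hn'.isDivisorGerm_p i).analyticAt_jetX _)
        (hD.analyticAt_aP i _) ?_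
      filter_upwards [hjet.1, eventually_notMem_of_finite hS (p i)] with u e1 e2
      rw [e1, ha _ hr u e2, sub_self, zero_mul, add_zero]
    · refine eventuallyEq_of_punctured ((hn'.isDivisorGerm_p i).analyticAt_jetU _)
        (hD.analyticAt_bP i _) ?_
      filter_upwards [hjet.2, eventually_notMem_of_finite hS (p i)] with u e1 e2
      rw [e1, hb _ hr u e2, sub_self, zero_mul, add_zero]
  · refine (hn'.isDivisorGerm_q j).hasJetAt (fun r hr => ?_) fun r hr => ?_
    all_goals
      obtain ⟨l, rfl⟩ := hsucc r hr
      have hjet := hn'.jet_q hς rfl hD (fun r hr' => ha r (hsub hr r hr'))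
        (fun r hr' => hb r (hsub hr r hr')) j
    · refine eventuallyEq_of_punctured ((hn'.isDivisorGerm_q j).analyticAt_jetX _)
        (hD.analyticAt_aQ j _) ?_
      filter_upwards [hjet.1, eventually_notMem_of_finite hS (q j)] with u e1 e2
      rw [e1, ha _ hr u e2, sub_self, zero_mul, add_zero]
    · refine eventuallyEq_of_punctured ((hn'.isDivisorGerm_q j).analyticAt_jetU _)
        (hD.analyticAt_bQ j _) ?_
      filter_upwards [hjet.2, eventually_notMem_of_finite hS (q j)] with u e1 e2
      rw [e1, hb _ hr u e2, sub_self, zero_mul, add_zero]
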